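/- Work over $\mathbb{C}$. Let $V_8\subset\mathbb{P}^6$ denote a prime Fano threefold of genus $5$, i.e. a smooth complete intersection (of dimension $3$) of three quadrics; the net of quadrics spanned by these three is called the net of $V_8$. "The general $V_8$" means: all $V_8$ defined by triples of quadratic forms in some nonempty Zariski open subset of the space of all triples of quadratic forms in $7$ variables. An elliptic quartic in $\mathbb{P}^6$ means either a smooth irreducible curve of degree $4$ and genus $1$, or, more generally, any one-dimensional subscheme (possibly singular, reducible or non-reduced) which is a complete intersection of two quadrics in a $3$-space $\mathbb{P}^3\subset\mathbb{P}^6$. **Proposition.** (1) On the general $V_8$ there is a smooth irreducible curve of degree $4$ and genus $1$ which is projectively normal, i.e. whose homogeneous coordinate ring is an integrally closed domain; moreover, for every elliptic quartic $C\subset V_8$ there are a quadric $Q$ of rank $6$ in the net of $V_8$ and a $3$-space $\Lambda\subset Q$ such that $C=V_8\cap\Lambda$ as schemes. (2) On an arbitrary $V_8$, for every elliptic quartic $C\subset V_8$ there are a quadric $Q$ of rank at most $6$ in the net of $V_8$ and a $3$-space $\Lambda\subset Q$ such that $C=V_8\cap\Lambda$ as schemes. -/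

import Mathlib

namespace FanoV8

open MvPolynomial

/-- The homogeneous coordinate ring `ℂ[x₀, …, x₆]` of `ℙ⁶`. Closed subschemes of `ℙ⁶` are
described below by their (saturated) homogeneous ideals. -/
abbrev CoordRing : Type := MvPolynomial (Fin 7) ℂ

/-- The parameter space `ℂ^{3·28}` of ordered triples of quadratic forms in `7` variables:
the coordinate at `(k, s(i, j))` is the coefficient of `xᵢ xⱼ` in the `k`-th form. -/
abbrev Param : Type := Fin 3 × Sym2 (Fin 7) → ℂ

/-- The triple of quadratic forms with given coefficients. -/
noncomputable def quadrics (c : Param) (k : Fin 3) : CoordRing :=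
  ∑ s : Sym2 (Fin 7), C (c (k, s)) * (s.map X).mul

/-- The net (linear system) of quadrics spanned by the three forms. -/
noncomputable def net (c : Param) : Submodule ℂ CoordRing :=
  Submodule.span ℂ (Set.range (quadrics c))

/-- The homogeneous ideal of the base locus `V ⊂ ℙ⁶` of the net. -/
noncomputable def idealV (c : Param) : Ideal CoordRing :=
  Ideal.span (Set.range (quadrics c))

/-- The gradient of a polynomial at a point of the affine cone. -/
noncomputable def gradAt (f : CoordRing) (x : Fin 7 → ℂ) : Fin 7 → ℂ :=
  fun j => eval x (pderiv j f)

/-- `V` is a smooth complete intersection of three quadrics in `ℙ⁶`, that is, a prime Fano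
threefold `V₈` of genus `5`: the three gradients are linearly independent at each point of `V`. -/
def IsV8 (c : Param) : Prop :=
  ∀ x : Fin 7 → ℂ, x ≠ 0 → (∀ k, eval x (quadrics c k) = 0) →
    LinearIndependent ℂ (fun k => gradAt (quadrics c k) x)

/-- A property holds for the general `V₈`: every member of a nonempty (hence dense) Zariski open
subset of the parameter space is a `V₈` and has the property. As every Zariski open set is a union
of principal ones, it is enough to speak of the locus where one nonzero polynomial `F` in
the coefficients does not vanish. -/
def GeneralV8 (P : Param → Prop) : Prop :=
  ∃ F : MvPolynomial (Fin 3 × Sym2 (Fin 7)) ℂ, F ≠ 0 ∧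
    ∀ c : Param, eval c F ≠ 0 → IsV8 c ∧ P c

/-- The rank of a quadratic form: the rank of its (constant) Hessian matrix. -/
noncomputable def quadricRank (Q : CoordRing) : ℕ :=
  (Matrix.of fun i j : Fin 7 => eval 0 (pderiv i (pderiv j Q))).rank

/-- The homogeneous ideal of the linear subspace `ℙ(W) ⊂ ℙ⁶`. -/
noncomputable def linIdeal (W : Submodule ℂ (Fin 7 → ℂ)) : Ideal CoordRing :=
  vanishingIdeal ℂ (W : Set (Fin 7 → ℂ))

/-- The Hilbert function of the subscheme of `ℙ⁶` with homogeneous ideal `I`: the dimension of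
the degree `n` part of the homogeneous coordinate ring `S / I`. -/
noncomputable def hilbertFn (I : Ideal CoordRing) (n : ℕ) : ℕ :=
  Module.finrank ℂ
    ((homogeneousSubmodule (Fin 7) ℂ n).map (Ideal.Quotient.mkₐ ℂ I).toLinearMap)

/-- `I` is the homogeneous ideal of a smooth irreducible curve in `ℙ⁶` of degree `d ≥ 1` and
genus `g`: `I` is a homogeneous prime, the Hilbert polynomial is `d·n + 1 - g` and (Jacobian
criterion) the gradients of the elements of `I` span a space of dimension `5` at each point. -/
structure IsSmoothCurve (I : Ideal CoordRing) (d g : ℕ) : Prop where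
  one_le_degree : 1 ≤ d
  homogeneous : ∀ f ∈ I, ∀ n : ℕ, homogeneousComponent n f ∈ I
  prime : I.IsPrime
  hilbert : ∀ᶠ n : ℕ in Filter.atTop, (hilbertFn I n : ℤ) = d * n + 1 - g
  smooth : ∀ x : Fin 7 → ℂ, x ≠ 0 → (∀ f ∈ I, eval x f = 0) →
    Module.finrank ℂ (Submodule.span ℂ ((fun f => gradAt f x) '' (I : Set CoordRing))) = 5

/-- The subscheme with homogeneous ideal `I` is projectively normal: its homogeneous coordinate
ring is an integrally closed domain. -/
def IsProjectivelyNormal (I : Ideal CoordRing) : Prop :=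
  IsDomain (CoordRing ⧸ I) ∧ IsIntegrallyClosed (CoordRing ⧸ I)

/-- `I` is the homogeneous ideal of a complete intersection of two quadrics in a `3`-space
`ℙ(W) ⊂ ℙ⁶`, possibly singular, reducible or non-reduced. The affine cone has dimension `2`,
so that the subscheme has dimension `1`. -/
def IsQuadricCI (I : Ideal CoordRing) : Prop :=
  ∃ (W : Submodule ℂ (Fin 7 → ℂ)) (a b : CoordRing),
    Module.finrank ℂ W = 4 ∧ a.IsHomogeneous 2 ∧ b.IsHomogeneous 2 ∧
    I = linIdeal W ⊔ Ideal.span {a, b} ∧ ringKrullDim (CoordRing ⧸ I) = 2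

/-- Elliptic quartics in `ℙ⁶`: smooth irreducible curves of degree `4` and genus `1`, and all
one-dimensional complete intersections of two quadrics in a `3`-space. -/
def IsEllipticQuartic (I : Ideal CoordRing) : Prop :=
  IsSmoothCurve I 4 1 ∨ IsQuadricCI I

/-- The curve with homogeneous ideal `I` is the scheme-theoretic intersection of `V` with a
`3`-space `ℙ(W)` which lies in the quadric `Q = 0`. -/
def IsCutOutInside (c : Param) (I : Ideal CoordRing) (Q : CoordRing) : Prop :=
  ∃ W : Submodule ℂ (Fin 7 → ℂ), Module.finrank ℂ W = 4 ∧
    (∀ x ∈ W, eval x Q = 0) ∧ I = idealV c ⊔ linIdeal W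

end FanoV8

namespace FanoV8
open MvPolynomial

/-! ### Genericity tools: elimination of projective variables, and Chevalley's theorem -/

section Homogeneous
variable {σ R : Type*} [CommRing R]

/-! Every elliptic quartic C is cut out by two quadrics a = b = 0 in a 3-space Λ
(`IsEllipticQuartic.exists_eq_comap`). If C lies on V, the net restricted to Λ lands in the span of
a and b, so some nontrivial combination Q of the three forms vanishes on Λ; a nondegenerate quadric
in ℙ⁶ contains no 3-space, hence Q has rank at most 6. No second independent member contains Λ
(`finrank_ker_restrict_le_one`): the gradients of two such members along Λ would be a pencil of
linear maps from a 4-dimensional space to a 3-dimensional one, and some map of the pencil would kill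
a vector on the quadric that the net still cuts on Λ, a point where V is singular. So the restricted
net is all of ⟨a, b⟩, and C = V ∩ Λ already as homogeneous ideals (`exists_mem_net_of_le`).

For a smooth curve, the quadrics a and b come from the Hilbert polynomial 4n of a prime ideal. The
Hilbert function of the saturated hyperplane section is stationary once it repeats a value, and it
ends at 4. Summing it shows that the curve spans at most a 3-space and, if it spans one, has Hilbert
function 4n for all n ≥ 1 (`hilb_one_le_four`); plane curves are excluded, and two quadrics generate
the ideal (`exists_eq_comap_span_pair`).

For general V three open conditions are intersected. Smoothness and the absence of members of rank
below 6 are open by elimination (`exists_ne_zero_forall_eq_zero`), and nonempty by explicit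
examples. For the existence of a curve, every net has a singular member and a singular quadric
contains a 3-space, so an affine space of nets adapted to a 3-space maps onto all nets; by Chevalley
(`exists_ne_zero_forall_exists_preimage`) it suffices to treat generic parameters. There the net
restricts to a smooth pencil, which is diagonalisable, and its coordinate ring is ℂ[y₀, y₁][√f][√g]
with fg squarefree, a normal domain (`isIntegrallyClosed_sqrt_sqrt`). -/

lemma homogeneousComponent_add_mul {f : MvPolynomial σ R} {d : ℕ} (hf : f.IsHomogeneous d)
    (n : ℕ) (u : MvPolynomial σ R) :
    homogeneousComponent (n + d) (u * f) = homogeneousComponent n u * f := by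
  let _ := gradedAlgebra (σ := σ) (R := R)
  have h := DirectSum.coe_decompose_mul_of_right_mem_of_le (homogeneousSubmodule σ R)
    (n := n + d) (a := u) hf (Nat.le_add_left d n)
  rw [Nat.add_sub_cancel] at h
  rw [← decomposition.decompose'_apply, ← decomposition.decompose'_apply]
  exact h

lemma homogeneousComponent_mul_of_lt {f : MvPolynomial σ R} {d : ℕ} (hf : f.IsHomogeneous d)
    {n : ℕ} (hn : n < d) (u : MvPolynomial σ R) :
    homogeneousComponent n (u * f) = 0 := by
  let _ := gradedAlgebra (σ := σ) (R := R)
  rw [← decomposition.decompose'_apply]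
  exact DirectSum.coe_decompose_mul_of_right_mem_of_not_le (homogeneousSubmodule σ R)
    (n := n) (a := u) hf (not_le.2 hn)

lemma monomial_mem_span_X_pow (d : σ →₀ ℕ) :
    monomial d (1 : R) ∈ Ideal.span (Set.range (X : σ → MvPolynomial σ R)) ^ d.degree := by
  rw [Ideal.mem_span_pow_iff_exists_isHomogeneous]
  refine ⟨monomial d 1, isHomogeneous_monomial _ rfl, ?_⟩
  rw [eval_monomial, one_mul, monomial_eq, map_one, one_mul]

/-- By the Nullstellensatz the variables lie in the radical of the ideal; finitely many generators
need only one common exponent. -/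
lemma span_X_pow_le_of_forall_eq_zero {ι τ : Type*} [Finite τ] {K : Type*} [Field K]
    [IsAlgClosed K] (f : ι → MvPolynomial τ K) (h : ∀ x, (∀ i, eval x (f i) = 0) → x = 0) :
    ∃ N, Ideal.span (Set.range (X : τ → MvPolynomial τ K)) ^ N ≤ Ideal.span (Set.range f) := by
  apply Ideal.exists_pow_le_of_le_radical_of_fg
  · rw [← vanishingIdeal_zeroLocus_eq_radical (K := K), Ideal.span_le]
    rintro _ ⟨j, rfl⟩
    simp only [SetLike.mem_coe, mem_vanishingIdeal_iff, mem_zeroLocus_iff]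
    intro x hx
    have : x = 0 := h x fun i => by
      simpa [aeval_eq_eval] using hx _ (Ideal.subset_span ⟨i, rfl⟩)
    simp [this]
  · exact ⟨(Set.finite_range X).toFinset, by simp⟩

/-- Elimination: that a family of forms has only the trivial common zero is an open condition on
the coefficients. -/
theorem exists_ne_zero_forall_eq_zero {K : Type*} [Field K] [IsAlgClosed K]
    {σ τ ι : Type*} [Finite τ] (f : ι → MvPolynomial τ (MvPolynomial σ K)) (d : ι → ℕ)
    (hf : ∀ i, (f i).IsHomogeneous (d i)) (c₀ : σ → K)
    (h₀ : ∀ x : τ → K, (∀ i, eval x (map (eval c₀) (f i)) = 0) → x = 0) :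
    ∃ F : MvPolynomial σ K, eval c₀ F ≠ 0 ∧ ∀ c, eval c F ≠ 0 →
      ∀ x : τ → K, (∀ i, eval x (map (eval c) (f i)) = 0) → x = 0 := by
  obtain ⟨N, hN⟩ := span_X_pow_le_of_forall_eq_zero _ h₀
  let A := MvPolynomial τ (MvPolynomial σ K)
  let I : Ideal A := Ideal.span (Set.range f)
  let M := homogeneousSubmodule τ (MvPolynomial σ K) N
  let q : A →ₗ[MvPolynomial σ K] A ⧸ I := (Ideal.Quotient.mkₐ (MvPolynomial σ K) I).toLinearMap
  have hq : ∀ a, q a = 0 ↔ a ∈ I := fun a => Ideal.Quotient.eq_zero_iff_mem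
  let m : Ideal (MvPolynomial σ K) := RingHom.ker (eval c₀)
  -- At `c₀` each monomial of degree `N` lies in the specialised ideal. Lifting the multipliers with
  -- constant coefficients shows that it is congruent modulo `I` to a form `r` whose coefficients
  -- all vanish at `c₀`: the hypothesis of Nakayama's lemma.
  have key : M.map q ≤ m • M.map q := by
    have mono : ∀ e : τ →₀ ℕ, e.degree = N → q (monomial e 1) ∈ m • M.map q := by
      intro e he
      have h1 : monomial e (1 : K) ∈ Ideal.span (Set.range fun i => map (eval c₀) (f i)) :=
        hN (he ▸ monomial_mem_span_X_pow e)
      obtain ⟨u, hu⟩ := (Finsupp.mem_ideal_span_range_iff_exists_finsupp).1 h1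
      let v : ι → MvPolynomial τ K := fun i =>
        if d i ≤ N then homogeneousComponent (N - d i) (u i) else 0
      have hv : ∑ i ∈ u.support, v i * map (eval c₀) (f i) = monomial e 1 := by
        have h2 := congrArg (homogeneousComponent N) hu
        rw [homogeneousComponent_eq_self (isHomogeneous_monomial _ he), Finsupp.sum,
          map_sum] at h2
        rw [← h2]
        refine Finset.sum_congr rfl fun i _ => ?_
        simp only [v]
        split_ifs with hi
        · obtain ⟨k, hk⟩ := Nat.exists_eq_add_of_le' hi
          rw [hk, Nat.add_sub_cancel, homogeneousComponent_add_mul ((hf i).map _)]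
        · rw [homogeneousComponent_mul_of_lt ((hf i).map _) (not_le.1 hi), zero_mul]
      let r : A := monomial e 1 - ∑ i ∈ u.support, map C (v i) * f i
      have hr : r.IsHomogeneous N := by
        refine (isHomogeneous_monomial _ he).sub (IsHomogeneous.sum _ _ _ fun i _ => ?_)
        simp only [v]
        split_ifs with hi
        · have := ((homogeneousComponent_isHomogeneous (N - d i) (u i)).map
            (C : K →+* MvPolynomial σ K)).mul (hf i)
          rwa [Nat.sub_add_cancel hi] at this
        · simpa using isHomogeneous_zero _ _ _
      have hr0 : map (eval c₀) r = 0 := by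
        have : (eval c₀).comp (C : K →+* MvPolynomial σ K) = RingHom.id K := by ext; simp
        simp only [r, map_sub, map_sum, map_mul, map_map, this, map_monomial, map_one,
          MvPolynomial.map_id]
        rw [hv, sub_self]
      have hqr : q (monomial e 1) = q r := by
        rw [← sub_eq_zero, ← map_sub, hq]
        simp only [r, sub_sub_cancel]
        exact I.sum_mem fun i _ => I.mul_mem_left _ (Ideal.subset_span ⟨i, rfl⟩)
      rw [hqr, r.as_sum, map_sum]
      refine Submodule.sum_mem _ fun b hb => ?_
      have hb' : b.degree = N := by
        by_contra hne
        exact (mem_support_iff.1 hb) (hr.coeff_eq_zero hne)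
      have : monomial b (coeff b r) = coeff b r • monomial b (1 : MvPolynomial σ K) := by
        simp [smul_monomial]
      rw [this, map_smul]
      refine Submodule.smul_mem_smul ?_ ⟨_, isHomogeneous_monomial _ hb', rfl⟩
      have := congrArg (coeff b) hr0
      rwa [coeff_map] at this
    rintro _ ⟨p, hp, rfl⟩
    rw [p.as_sum, map_sum]
    refine Submodule.sum_mem _ fun b hb => ?_
    have : monomial b (coeff b p) = coeff b p • monomial b (1 : MvPolynomial σ K) := by
      simp [smul_monomial]
    rw [this, map_smul]
    refine Submodule.smul_mem _ _ (mono b ?_)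
    by_contra hne
    exact (mem_support_iff.1 hb) (IsHomogeneous.coeff_eq_zero hp hne)
  -- Nakayama gives `F` with value 1 at `c₀` and `F * X j ^ N ∈ I` for all `j`; where `F` does not
  -- vanish, a common zero is therefore 0.
  obtain ⟨F, hF, hF'⟩ := Submodule.exists_sub_one_mem_and_smul_eq_zero_of_fg_of_le_smul m (M.map q)
    ((homogeneousSubmodule_fg _ _ N).map q) key
  refine ⟨F, ?_, fun c hc x hx => ?_⟩
  · have : eval c₀ (F - 1) = 0 := hF
    rw [map_sub, map_one, sub_eq_zero] at this
    rw [this]; exact one_ne_zero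
  · have hI : ∀ a ∈ I, eval x (map (eval c) a) = 0 := by
      have : I ≤ RingHom.ker ((eval x).comp (map (eval c))) := by
        rw [Ideal.span_le]
        rintro _ ⟨i, rfl⟩
        exact hx i
      exact fun a ha => this ha
    funext j
    have h1 := hF' (q (X j ^ N)) ⟨_, isHomogeneous_X_pow (R := MvPolynomial σ K) j N, rfl⟩
    rw [← map_smul, hq] at h1
    have h2 := hI _ h1
    rw [smul_eq_C_mul] at h2
    simp only [map_mul, map_C, eval_C, map_pow, map_X, eval_X] at h2
    simpa using eq_zero_of_pow_eq_zero ((mul_eq_zero.1 h2).resolve_left hc)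

/-- A polynomial map between affine spaces that is surjective on points maps each principal open
set onto a set containing a nonempty principal open set. -/
theorem exists_ne_zero_forall_exists_preimage {K : Type*} [Field K] [IsAlgClosed K]
    {σ τ : Type*} [Finite σ] [Finite τ] (φ : σ → MvPolynomial τ K)
    (hφ : ∀ c : σ → K, ∃ y : τ → K, ∀ i, eval y (φ i) = c i)
    {G : MvPolynomial τ K} (hG : G ≠ 0) :
    ∃ F : MvPolynomial σ K, F ≠ 0 ∧ ∀ c : σ → K, eval c F ≠ 0 →
      ∃ y : τ → K, (∀ i, eval y (φ i) = c i) ∧ eval y G ≠ 0 := by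
  let f : MvPolynomial σ K →+* MvPolynomial τ K := (aeval φ).toRingHom
  -- Surjectivity on points makes the comorphism injective, so the generic point of the target is an
  -- image point.
  have hf : Function.Injective f := by
    rw [injective_iff_map_eq_zero]
    intro p hp
    apply MvPolynomial.funext
    intro c
    obtain ⟨y, hy⟩ := hφ c
    have h1 : aeval y (bind₁ φ p) = 0 := by
      rw [show bind₁ φ p = 0 from hp, map_zero]
    rw [aeval_bind₁] at h1
    simp only [aeval_eq_eval, hy] at h1
    rw [map_zero, ← h1]
  have hfp : f.FinitePresentation := by
    rw [← RingHom.FinitePresentation.of_finiteType]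
    refine RingHom.FiniteType.of_comp_finiteType (f := (C : K →+* MvPolynomial σ K)) (g := f) ?_
    have : f.comp C = (C : K →+* MvPolynomial τ K) := by ext; simp [f]
    rw [this]
    exact (RingHom.finiteType_algebraMap (A := K) (B := MvPolynomial τ K)).2 inferInstance
  have hc := PrimeSpectrum.isConstructible_comap_image hfp
    (PrimeSpectrum.isConstructible_basicOpen (f := G))
  obtain ⟨S, hS⟩ := PrimeSpectrum.exists_constructibleSetData_iff.mpr hc
  let η : PrimeSpectrum (MvPolynomial τ K) := ⟨⊥, Ideal.isPrime_bot⟩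
  have hη : PrimeSpectrum.comap f η ∈ S.toSet := by
    rw [hS]
    exact ⟨η, by simpa [η] using hG, rfl⟩
  have hη0 : (PrimeSpectrum.comap f η).asIdeal = ⊥ := by
    rw [PrimeSpectrum.comap_asIdeal]
    exact (RingHom.injective_iff_ker_eq_bot f).1 hf
  simp only [PrimeSpectrum.ConstructibleSetData.toSet, Set.mem_iUnion] at hη
  -- `D` is a locally closed piece of the image through the generic point: its closed conditions are
  -- trivial, and `D.f` is the required polynomial.
  obtain ⟨D, hD, hDη⟩ := hη
  have hsub : D.toSet ⊆ PrimeSpectrum.comap f '' PrimeSpectrum.basicOpen G := by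
    rw [← hS]
    exact Set.subset_biUnion_of_mem (u := fun C => C.toSet) hD
  simp only [PrimeSpectrum.BasicConstructibleSetData.toSet, Set.mem_sdiff,
    PrimeSpectrum.mem_zeroLocus, hη0, Set.singleton_subset_iff, SetLike.mem_coe,
    Ideal.mem_bot] at hDη hsub
  refine ⟨D.f, hDη.2, fun c hc => ?_⟩
  let p : PrimeSpectrum (MvPolynomial σ K) := ⟨RingHom.ker (eval c), RingHom.ker_isPrime _⟩
  obtain ⟨q, hqG, hqp⟩ := hsub (show p ∈ _ from ⟨by
    rw [PrimeSpectrum.mem_zeroLocus]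
    intro x hx
    have : x = 0 := by simpa using hDη.1 hx
    simp [this], by simpa [p] using hc⟩)
  -- The prime `q` over `c` need not be maximal; the Nullstellensatz gives a closed point of its
  -- zero locus off `G = 0`, which still lies over `c`.
  have hq := IsPrime.vanishingIdeal_zeroLocus (K := K) q.asIdeal
  have hG' : G ∉ vanishingIdeal K (zeroLocus K q.asIdeal) := by
    rw [hq]; exact hqG
  simp only [mem_vanishingIdeal_iff, not_forall] at hG'
  obtain ⟨y, hy, hyG⟩ := hG'
  refine ⟨y, fun i => ?_, by simpa [aeval_eq_eval] using hyG⟩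
  have h1 : X i - C (c i) ∈ (PrimeSpectrum.comap f q).asIdeal := by
    rw [hqp]
    simp [p, RingHom.mem_ker]
  have h2 := hy _ h1
  simpa [f, aeval_eq_eval, sub_eq_zero] using h2

end Homogeneous

/-- A binary form of positive degree has a nontrivial zero. -/
theorem exists_binary_zero {K : Type*} [Field K] [IsAlgClosed K] (f : MvPolynomial (Fin 2) K)
    {n : ℕ} (hn : n ≠ 0) (hf : ∀ (s : K) (x : Fin 2 → K), eval (s • x) f = s ^ n * eval x f) :
    ∃ x : Fin 2 → K, x ≠ 0 ∧ eval x f = 0 := by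
  let p : Polynomial K := aeval ![1, Polynomial.X] f
  have hp : ∀ t, p.eval t = eval ![1, t] f := by
    intro t
    have := congrArg (fun g : MvPolynomial (Fin 2) K →ₐ[K] K => g f)
      (algHom_ext (f := (Polynomial.aeval t).comp (aeval ![1, Polynomial.X]))
        (g := aeval ![1, t]) (by intro i; fin_cases i <;> simp))
    simpa [Polynomial.coe_aeval_eq_eval, aeval_eq_eval, p] using this
  let r : Polynomial K := aeval ![Polynomial.X, 1] f
  have hr : ∀ t, r.eval t = eval ![t, 1] f := by
    intro t
    have := congrArg (fun g : MvPolynomial (Fin 2) K →ₐ[K] K => g f)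
      (algHom_ext (f := (Polynomial.aeval t).comp (aeval ![Polynomial.X, 1]))
        (g := aeval ![t, 1]) (by intro i; fin_cases i <;> simp))
    simpa [Polynomial.coe_aeval_eq_eval, aeval_eq_eval, r] using this
  -- If `f(1, t)` is a nonzero constant, the form is a multiple of the `n`-th power of the first
  -- variable and vanishes at `(0, 1)`. The zero polynomial has degree `⊥` and goes with the other
  -- case.
  by_cases hdeg : p.degree = 0
  · rw [Polynomial.eq_C_of_degree_eq_zero hdeg] at hp
    simp only [Polynomial.eval_C] at hp
    have hrX : r = Polynomial.C (p.coeff 0) * Polynomial.X ^ n := by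
      refine Polynomial.eq_of_infinite_eval_eq _ _ (Set.Infinite.mono ?_
        (Set.finite_singleton (0 : K)).infinite_compl)
      intro t ht
      have ht : t ≠ 0 := ht
      have : (![t, 1] : Fin 2 → K) = t • ![1, t⁻¹] := by
        ext i; fin_cases i <;> simp [ht]
      rw [Set.mem_ofPred, hr, this, hf, ← hp t⁻¹]
      rw [Polynomial.eval_mul, Polynomial.eval_C, Polynomial.eval_pow, Polynomial.eval_X, mul_comm]
    refine ⟨![0, 1], fun h => one_ne_zero (congrFun h 1), ?_⟩
    rw [← hr, hrX]
    simp [hn]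
  · obtain ⟨t, ht⟩ := IsAlgClosed.exists_root p hdeg
    exact ⟨![1, t], fun h => one_ne_zero (congrFun h 0), by rw [← hp]; exact ht⟩

end FanoV8
-- Hilbert functions, saturation and regular linear forms
namespace FanoV8
open MvPolynomial

set_option linter.unusedSectionVars false

lemma finrank_map_of_injective {K V W : Type*} [Field K] [AddCommGroup V] [Module K V]
    [AddCommGroup W] [Module K W] {f : V →ₗ[K] W} (hf : Function.Injective f)
    (p : Submodule K V) : Module.finrank K (p.map f) = Module.finrank K p :=
  (Submodule.equivMapOfInjective f hf p).finrank_eq.symm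

section Hilbert
variable {σ K : Type*} [Fintype σ] [Field K]

/-- The degree `n` part of the homogeneous coordinate ring of `I`. -/
noncomputable def gradedPart (I : Ideal (MvPolynomial σ K)) (n : ℕ) :
    Submodule K (MvPolynomial σ K ⧸ I) :=
  (homogeneousSubmodule σ K n).map (Ideal.Quotient.mkₐ K I).toLinearMap

/-- The Hilbert function of the homogeneous coordinate ring of `I`. -/
noncomputable def hilb (I : Ideal (MvPolynomial σ K)) (n : ℕ) : ℕ :=
  Module.finrank K (gradedPart I n)

instance (n : ℕ) : FiniteDimensional K (homogeneousSubmodule σ K n) :=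
  Module.Finite.iff_fg.2 (homogeneousSubmodule_fg σ K n)

instance (I : Ideal (MvPolynomial σ K)) (n : ℕ) : FiniteDimensional K (gradedPart I n) :=
  Module.Finite.iff_fg.2 ((homogeneousSubmodule_fg σ K n).map _)

/-- The degree `n` part of an ideal. -/
noncomputable def idealPart (I : Ideal (MvPolynomial σ K)) (n : ℕ) : Submodule K (MvPolynomial σ K) :=
  homogeneousSubmodule σ K n ⊓ I.restrictScalars K

lemma mem_idealPart {I : Ideal (MvPolynomial σ K)} {n : ℕ} {f : MvPolynomial σ K} :
    f ∈ idealPart I n ↔ f.IsHomogeneous n ∧ f ∈ I := Iff.rfl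

instance (I : Ideal (MvPolynomial σ K)) (n : ℕ) : FiniteDimensional K (idealPart I n) :=
  Submodule.finiteDimensional_inf_left _ _

lemma hilb_add_finrank_idealPart (I : Ideal (MvPolynomial σ K)) (n : ℕ) :
    hilb I n + Module.finrank K (idealPart I n) =
      Module.finrank K (homogeneousSubmodule σ K n) := by
  let g := (Ideal.Quotient.mkₐ K I).toLinearMap.domRestrict (homogeneousSubmodule σ K n)
  have h := g.finrank_range_add_finrank_ker
  rw [LinearMap.range_domRestrict] at h
  have h2 : idealPart I n = (LinearMap.ker g).map (homogeneousSubmodule σ K n).subtype := by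
    ext f
    simp only [mem_idealPart, Submodule.mem_map, LinearMap.mem_ker]
    constructor
    · rintro ⟨h1, h2⟩
      exact ⟨⟨f, h1⟩, Ideal.Quotient.eq_zero_iff_mem.2 h2, rfl⟩
    · rintro ⟨⟨f', h1⟩, h2, rfl⟩
      exact ⟨h1, Ideal.Quotient.eq_zero_iff_mem.1 h2⟩
  rw [h2, Submodule.finrank_map_subtype_eq]
  exact h

lemma idealPart_mono {I J : Ideal (MvPolynomial σ K)} (h : I ≤ J) (n : ℕ) :
    idealPart I n ≤ idealPart J n := fun _ hf => ⟨hf.1, h hf.2⟩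

lemma hilb_antitone {I J : Ideal (MvPolynomial σ K)} (h : I ≤ J) (n : ℕ) :
    hilb J n ≤ hilb I n := by
  have h1 := hilb_add_finrank_idealPart I n
  have h2 := hilb_add_finrank_idealPart J n
  have := Submodule.finrank_mono (idealPart_mono h n)
  omega

lemma idealPart_eq_of_hilb_le {I J : Ideal (MvPolynomial σ K)} (h : I ≤ J) {n : ℕ}
    (hn : hilb I n ≤ hilb J n) : idealPart I n = idealPart J n := by
  have h1 := hilb_add_finrank_idealPart I n
  have h2 := hilb_add_finrank_idealPart J n
  exact Submodule.eq_of_le_of_finrank_le (idealPart_mono h n) (by omega)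

/-- Euler's formula, divided by the degree. -/
lemma exists_eq_sum_X_mul [CharZero K] {n : ℕ} {f : MvPolynomial σ K}
    (hf : f.IsHomogeneous (n + 1)) :
    ∃ g : σ → MvPolynomial σ K, (∀ i, (g i).IsHomogeneous n) ∧ f = ∑ i, X i * g i := by
  refine ⟨fun i => C ((n + 1 : K)⁻¹) * pderiv i f, fun i => ?_, ?_⟩
  · exact IsHomogeneous.C_mul hf.pderiv _
  · have h := hf.sum_X_mul_pderiv
    have h0 : (n + 1 : K) ≠ 0 := by exact_mod_cast Nat.succ_ne_zero n
    calc f = C ((n + 1 : K)⁻¹) * ((n + 1) • f) := by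
          rw [nsmul_eq_mul, ← mul_assoc]
          have : ((n + 1 : ℕ) : MvPolynomial σ K) = C (n + 1 : K) := by simp
          rw [this, ← C_mul, inv_mul_cancel₀ h0, C_1, one_mul]
      _ = _ := by
          rw [← h, Finset.mul_sum]
          exact Finset.sum_congr rfl fun i _ => by ring

/-- `I` contains the homogeneous components of its elements. -/
def HasComponents (I : Ideal (MvPolynomial σ K)) : Prop :=
  ∀ f ∈ I, ∀ n : ℕ, homogeneousComponent n f ∈ I

lemma HasComponents.sup {I J : Ideal (MvPolynomial σ K)} (hI : HasComponents I)
    (hJ : HasComponents J) : HasComponents (I ⊔ J) := by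
  intro f hf n
  obtain ⟨a, ha, b, hb, rfl⟩ := Submodule.mem_sup.1 hf
  rw [map_add]
  exact add_mem (Ideal.mem_sup_left (hI a ha n)) (Ideal.mem_sup_right (hJ b hb n))

lemma hasComponents_span_singleton {f : MvPolynomial σ K} {d : ℕ} (hf : f.IsHomogeneous d) :
    HasComponents (Ideal.span {f}) := by
  intro g hg n
  obtain ⟨u, rfl⟩ := Ideal.mem_span_singleton'.1 hg
  rcases lt_or_ge n d with h | h
  · rw [homogeneousComponent_mul_of_lt hf h]; exact zero_mem _
  · obtain ⟨k, rfl⟩ := Nat.exists_eq_add_of_le' h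
    rw [homogeneousComponent_add_mul hf]
    exact Ideal.mul_mem_left _ _ (Ideal.mem_span_singleton_self f)

/-- Elements of degree `n + d` of `I + (f)`. -/
lemma exists_of_mem_sup_span {I : Ideal (MvPolynomial σ K)} (hI : HasComponents I)
    {f : MvPolynomial σ K} {d : ℕ} (hf : f.IsHomogeneous d) {n : ℕ} {g : MvPolynomial σ K}
    (hg : g.IsHomogeneous (n + d)) (hgI : g ∈ I ⊔ Ideal.span {f}) :
    ∃ a ∈ idealPart I (n + d), ∃ u : MvPolynomial σ K, u.IsHomogeneous n ∧ g = a + f * u := by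
  obtain ⟨a, ha, b, hb, rfl⟩ := Submodule.mem_sup.1 hgI
  obtain ⟨u, rfl⟩ := Ideal.mem_span_singleton'.1 hb
  refine ⟨homogeneousComponent (n + d) a, ⟨homogeneousComponent_isHomogeneous _ _, hI a ha _⟩,
    homogeneousComponent n u, homogeneousComponent_isHomogeneous _ _, ?_⟩
  rw [mul_comm f, ← homogeneousComponent_add_mul hf, ← map_add, homogeneousComponent_eq_self hg]

lemma mem_of_mem_sup_span_of_lt {I : Ideal (MvPolynomial σ K)} (hI : HasComponents I)
    {f : MvPolynomial σ K} {d : ℕ} (hf : f.IsHomogeneous d) {n : ℕ} (hn : n < d)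
    {g : MvPolynomial σ K} (hg : g.IsHomogeneous n) (hgI : g ∈ I ⊔ Ideal.span {f}) : g ∈ I := by
  obtain ⟨a, ha, b, hb, rfl⟩ := Submodule.mem_sup.1 hgI
  obtain ⟨u, rfl⟩ := Ideal.mem_span_singleton'.1 hb
  rw [← homogeneousComponent_eq_self hg, map_add, homogeneousComponent_mul_of_lt hf hn, add_zero]
  exact hI a ha n

/-- The Hilbert function of a section by a form that is regular modulo `I`. -/
theorem hilb_sup_span {I : Ideal (MvPolynomial σ K)} (hI : HasComponents I)
    {f : MvPolynomial σ K} {d : ℕ} (hf : f.IsHomogeneous d) (hreg : ∀ g, f * g ∈ I → g ∈ I) (n : ℕ) :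
    hilb (I ⊔ Ideal.span {f}) (n + d) + hilb I n = hilb I (n + d) := by
  -- The zero form is regular only modulo the unit ideal. Otherwise multiplication by `f` is
  -- injective, and the degree `n + d` part of `I + (f)` is the sum of that of `I` and of `f` times
  -- the forms of degree `n`, which meet in `f` times the degree `n` part of `I`.
  by_cases hf0 : f = 0
  · have : I = ⊤ := by
      rw [Ideal.eq_top_iff_one]; exact hreg 1 (by simp [hf0])
    subst this
    have h0 : ∀ m, hilb (⊤ : Ideal (MvPolynomial σ K)) m = 0 := by
      intro m
      rw [hilb, Submodule.finrank_eq_zero, eq_bot_iff]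
      intro z _
      rw [Submodule.mem_bot]
      exact Subsingleton.elim _ _
    simp [h0]
  let μ : MvPolynomial σ K →ₗ[K] MvPolynomial σ K := LinearMap.mulLeft K f
  have hμ : Function.Injective μ := mul_right_injective₀ hf0
  have e1 : idealPart (I ⊔ Ideal.span {f}) (n + d) =
      idealPart I (n + d) ⊔ (homogeneousSubmodule σ K n).map μ := by
    apply le_antisymm
    · rintro g ⟨hg, hgI⟩
      obtain ⟨a, ha, u, hu, rfl⟩ := exists_of_mem_sup_span hI hf hg hgI
      exact Submodule.add_mem_sup ha ⟨u, hu, rfl⟩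
    · refine sup_le (idealPart_mono le_sup_left _) ?_
      rintro _ ⟨u, hu, rfl⟩
      refine ⟨add_comm d n ▸ hf.mul hu, Ideal.mem_sup_right ?_⟩
      exact Ideal.mul_mem_right _ _ (Ideal.mem_span_singleton_self f)
  have e2 : idealPart I (n + d) ⊓ (homogeneousSubmodule σ K n).map μ = (idealPart I n).map μ := by
    apply le_antisymm
    · rintro _ ⟨hg, u, hu, rfl⟩
      exact ⟨u, ⟨hu, hreg u hg.2⟩, rfl⟩
    · rintro _ ⟨u, hu, rfl⟩
      exact ⟨⟨add_comm d n ▸ hf.mul hu.1, Ideal.mul_mem_left _ _ hu.2⟩, u, hu.1, rfl⟩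
  have h1 := Submodule.finrank_sup_add_finrank_inf_eq (idealPart I (n + d))
    ((homogeneousSubmodule σ K n).map μ)
  rw [← e1, e2, finrank_map_of_injective hμ,
    finrank_map_of_injective hμ] at h1
  have h2 := hilb_add_finrank_idealPart (I ⊔ Ideal.span {f}) (n + d)
  have h3 := hilb_add_finrank_idealPart I (n + d)
  have h4 := hilb_add_finrank_idealPart I n
  omega

lemma hilb_sup_span_of_lt {I : Ideal (MvPolynomial σ K)} (hI : HasComponents I)
    {f : MvPolynomial σ K} {d : ℕ} (hf : f.IsHomogeneous d) {n : ℕ} (hn : n < d) :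
    hilb (I ⊔ Ideal.span {f}) n = hilb I n := by
  have e : idealPart (I ⊔ Ideal.span {f}) n = idealPart I n :=
    le_antisymm (fun g hg => ⟨hg.1, mem_of_mem_sup_span_of_lt hI hf hn hg.1 hg.2⟩)
      (idealPart_mono le_sup_left _)
  have h1 := hilb_add_finrank_idealPart (I ⊔ Ideal.span {f}) n
  have h2 := hilb_add_finrank_idealPart I n
  rw [e] at h1
  omega

/-- Saturation with respect to the irrelevant ideal. -/
theorem exists_saturation [CharZero K] (A : Ideal (MvPolynomial σ K)) :
    ∃ (J : Ideal (MvPolynomial σ K)) (N : ℕ), A ≤ J ∧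
      (∀ f ∈ J, ∀ g : MvPolynomial σ K, g.IsHomogeneous N → g * f ∈ A) ∧
      (∀ f, (∀ i, X i * f ∈ J) → f ∈ J) := by
  -- `J n` consists of the elements that all forms of degree `n` multiply into `A`. The chain
  -- stabilises by noetherianity, and its limit is saturated because testing with the variables
  -- raises `n` by one.
  let J : ℕ → Ideal (MvPolynomial σ K) := fun n =>
    { carrier := {f | ∀ g : MvPolynomial σ K, g.IsHomogeneous n → g * f ∈ A}
      add_mem' := fun {a b} ha hb g hg => by rw [mul_add]; exact add_mem (ha g hg) (hb g hg)
      zero_mem' := fun g _ => by rw [mul_zero]; exact zero_mem _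
      smul_mem' := fun c f hf g hg => by
        rw [smul_eq_mul, mul_left_comm]; exact Ideal.mul_mem_left _ _ (hf g hg) }
  have step : ∀ n f, (∀ i, X i * f ∈ J n) → f ∈ J (n + 1) := by
    intro n f h g hg
    obtain ⟨u, hu, rfl⟩ := exists_eq_sum_X_mul hg
    rw [Finset.sum_mul]
    refine sum_mem fun i _ => ?_
    have := h i (u i) (hu i)
    rwa [show X i * u i * f = u i * (X i * f) by ring]
  have mono : Monotone J := monotone_nat_of_le_succ fun n f hf =>
    step n f fun i => Ideal.mul_mem_left _ _ hf
  obtain ⟨N, hN⟩ := monotone_stabilizes_iff_noetherian.2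
    (inferInstance : IsNoetherian (MvPolynomial σ K) (MvPolynomial σ K)) ⟨J, mono⟩
  refine ⟨J N, N, fun f hf g _ => Ideal.mul_mem_left _ _ hf, fun f hf => hf, fun f h => ?_⟩
  have := step N f h
  rwa [show J N = J (N + 1) from hN (N + 1) (Nat.le_succ N)]

/-- A saturated ideal has a regular linear form. -/
theorem exists_regular_linear_form [Infinite K] {J : Ideal (MvPolynomial σ K)}
    (hJ : ∀ f, (∀ i, X i * f ∈ J) → f ∈ J) :
    ∃ y : MvPolynomial σ K, y.IsHomogeneous 1 ∧ ∀ f, y * f ∈ J → f ∈ J := by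
  classical
  let V := homogeneousSubmodule σ K 1
  let s := (associatedPrimes.finite (MvPolynomial σ K) (MvPolynomial σ K ⧸ J)).toFinset
  let t : Finset (Subspace K V) := s.image fun p => (p.restrictScalars K).comap V.subtype
  -- An associated prime containing all variables would annihilate the class of some `f ∉ J`,
  -- against saturation. Hence the linear zero divisors lie in finitely many proper subspaces, which
  -- do not fill a vector space over an infinite field.
  have ht : ⊤ ∉ t := by
    intro h
    obtain ⟨p, hp, hpt⟩ := Finset.mem_image.1 h
    rw [Set.Finite.mem_toFinset, AssociatedPrimes.mem_iff, isAssociatedPrime_iff] at hp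
    obtain ⟨hp, b, hb⟩ := hp
    obtain ⟨f, rfl⟩ := Ideal.Quotient.mk_surjective b
    have hmem : ∀ g, g ∈ p ↔ g * f ∈ J := by
      intro g
      rw [hb, Submodule.mem_colon_singleton, Submodule.mem_bot]
      exact Ideal.Quotient.eq_zero_iff_mem (a := g * f)
    refine hp.ne_top ((Ideal.eq_top_iff_one _).2 ((hmem 1).2 ?_))
    rw [one_mul]
    refine hJ f fun i => (hmem _).1 ?_
    have : (⟨X i, isHomogeneous_X K i⟩ : V) ∈ (p.restrictScalars K).comap V.subtype := by
      rw [hpt]; trivial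
    exact this
  obtain ⟨y, hy⟩ := (Set.ne_univ_iff_exists_notMem _).1 (Subspace.biUnion_ne_univ_of_top_notMem ht)
  refine ⟨y, y.2, fun f hf => ?_⟩
  by_contra hfJ
  have hz : (y : MvPolynomial σ K) ∈ ⋃ p ∈ associatedPrimes (MvPolynomial σ K)
      (MvPolynomial σ K ⧸ J), (p : Set (MvPolynomial σ K)) := by
    rw [biUnion_associatedPrimes_eq_zero_divisors]
    refine ⟨Ideal.Quotient.mk J f, fun h => hfJ (Ideal.Quotient.eq_zero_iff_mem.1 h), ?_⟩
    exact Ideal.Quotient.eq_zero_iff_mem.2 hf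
  simp only [Set.mem_iUnion] at hz
  obtain ⟨p, hp, hyp⟩ := hz
  apply hy
  simp only [Set.mem_iUnion]
  exact ⟨_, Finset.mem_image.2 ⟨p, (Set.Finite.mem_toFinset _).2 hp, rfl⟩, hyp⟩

section Regular
variable {J : Ideal (MvPolynomial σ K)} {y : MvPolynomial σ K}

lemma map_mul_gradedPart_le (J : Ideal (MvPolynomial σ K)) (hy : y.IsHomogeneous 1) (n : ℕ) :
    (gradedPart J n).map (LinearMap.mulLeft K (Ideal.Quotient.mk J y)) ≤ gradedPart J (n + 1) := by
  rintro _ ⟨_, ⟨f, hf, rfl⟩, rfl⟩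
  exact ⟨y * f, add_comm 1 n ▸ hy.mul hf, map_mul (Ideal.Quotient.mk J) y f⟩

lemma mulLeft_injective_of_regular (hreg : ∀ f, y * f ∈ J → f ∈ J) :
    Function.Injective (LinearMap.mulLeft K (Ideal.Quotient.mk J y)) := by
  rw [injective_iff_map_eq_zero]
  intro z hz
  obtain ⟨f, rfl⟩ := Ideal.Quotient.mk_surjective z
  rw [LinearMap.mulLeft_apply, ← map_mul, Ideal.Quotient.eq_zero_iff_mem] at hz
  exact Ideal.Quotient.eq_zero_iff_mem.2 (hreg f hz)

lemma hilb_le_succ (hy : y.IsHomogeneous 1) (hreg : ∀ f, y * f ∈ J → f ∈ J) (n : ℕ) :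
    hilb J n ≤ hilb J (n + 1) := by
  have := Submodule.finrank_mono (map_mul_gradedPart_le J hy n)
  rwa [finrank_map_of_injective (mulLeft_injective_of_regular hreg)] at this

lemma map_mul_gradedPart_eq (hy : y.IsHomogeneous 1) (hreg : ∀ f, y * f ∈ J → f ∈ J) {n : ℕ}
    (h : hilb J n = hilb J (n + 1)) :
    (gradedPart J n).map (LinearMap.mulLeft K (Ideal.Quotient.mk J y)) = gradedPart J (n + 1) :=
  Submodule.eq_of_le_of_finrank_eq (map_mul_gradedPart_le J hy n) (by
    rwa [finrank_map_of_injective (mulLeft_injective_of_regular hreg)])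

/-- The quotient ring is generated in degree one: if multiplication by `y` is onto from degree `n`
to `n + 1`, then `X i * g i` with `g i` congruent to `y * u` is `y` times `X i * u`, so it is onto
in the next degree. -/
lemma hilb_eq_succ_of_eq [CharZero K] (hy : y.IsHomogeneous 1) (hreg : ∀ f, y * f ∈ J → f ∈ J)
    {n : ℕ} (h : hilb J n = hilb J (n + 1)) : hilb J (n + 1) = hilb J (n + 2) := by
  have h1 := map_mul_gradedPart_eq hy hreg h
  have h2 : gradedPart J (n + 2) ≤
      (gradedPart J (n + 1)).map (LinearMap.mulLeft K (Ideal.Quotient.mk J y)) := by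
    rintro _ ⟨f, hf, rfl⟩
    obtain ⟨g, hg, rfl⟩ := exists_eq_sum_X_mul (show f.IsHomogeneous (n + 1 + 1) from hf)
    rw [map_sum]
    refine sum_mem fun i _ => ?_
    have h3 : Ideal.Quotient.mk J (g i) ∈ gradedPart J (n + 1) := ⟨g i, hg i, rfl⟩
    rw [← h1] at h3
    obtain ⟨_, ⟨u, hu, rfl⟩, h4⟩ := h3
    refine ⟨Ideal.Quotient.mk J (X i * u), ⟨X i * u, ?_, rfl⟩, ?_⟩
    · exact add_comm 1 n ▸ (isHomogeneous_X K i).mul hu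
    · change Ideal.Quotient.mk J y * Ideal.Quotient.mk J u = _ at h4
      change Ideal.Quotient.mk J y * Ideal.Quotient.mk J (X i * u) = Ideal.Quotient.mk J (X i * g i)
      rw [map_mul, map_mul, ← h4]
      ring
  have h5 := Submodule.finrank_mono h2
  rw [finrank_map_of_injective (mulLeft_injective_of_regular hreg)] at h5
  exact le_antisymm (hilb_le_succ hy hreg _) h5

end Regular
end Hilbert
end FanoV8
namespace FanoV8
open MvPolynomial

set_option linter.unusedSectionVars false

/-! ### Hyperplane sections of integral curves -/

section PrimeSection
variable {σ K : Type*} [Fintype σ] [Field K]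

/-- A linear form that vanishes on a hyperplane section of an integral scheme is a multiple of the
equation of the hyperplane. -/
theorem exists_sub_C_mul_mem [IsAlgClosed K] {I : Ideal (MvPolynomial σ K)} (hI : HasComponents I)
    [I.IsPrime] {l f : MvPolynomial σ K} (hl : l.IsHomogeneous 1) (hlI : l ∉ I)
    (hf : f.IsHomogeneous 1) {N : ℕ}
    (h : ∀ g : MvPolynomial σ K, g.IsHomogeneous N → g * f ∈ I ⊔ Ideal.span {l}) :
    ∃ t : K, f - C t * l ∈ I := by
  let E := gradedPart I N
  let μ := LinearMap.mulLeft K (Ideal.Quotient.mk I l)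
  have hμ : Function.Injective μ := mulLeft_injective_of_regular fun g hg =>
    (Ideal.IsPrime.mem_or_mem ‹_› hg).resolve_left hlI
  have hle : ∀ z ∈ E, LinearMap.mulLeft K (Ideal.Quotient.mk I f) z ∈ E.map μ := by
    rintro _ ⟨g, hg, rfl⟩
    obtain ⟨a, ha, u, hu, hau⟩ := exists_of_mem_sup_span hI hl (hg.mul hf) (h g hg)
    refine ⟨Ideal.Quotient.mk I u, ⟨u, hu, rfl⟩, ?_⟩
    change Ideal.Quotient.mk I (l * u) = Ideal.Quotient.mk I (f * g)
    rw [Ideal.Quotient.mk_eq_mk_iff_sub_mem, mul_comm f, hau]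
    simpa using I.neg_mem ha.2
  let e := Submodule.equivMapOfInjective μ hμ E
  -- `T` is multiplication by `f / l` on the degree `N` part. An eigenvector `z` with eigenvalue `t`
  -- satisfies `(f - t l) z = 0` in a domain. This replaces the fact that global functions on an
  -- integral projective scheme are constant.
  let T : Module.End K E := e.symm.toLinearMap ∘ₗ
    ((LinearMap.mulLeft K (Ideal.Quotient.mk I f)).restrict hle)
  have hnt : Nontrivial E := by
    refine ⟨⟨⟨Ideal.Quotient.mk I (l ^ N), ⟨l ^ N, by simpa using hl.pow N, rfl⟩⟩, 0, fun h0 => ?_⟩⟩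
    have h1 := Ideal.Quotient.eq_zero_iff_mem.1 (congrArg Subtype.val h0)
    exact hlI (Ideal.IsPrime.mem_of_pow_mem ‹_› _ h1)
  obtain ⟨t, ht⟩ := Module.End.exists_eigenvalue T
  obtain ⟨z, hz⟩ := ht.exists_hasEigenvector
  have h1 : e (T z) = t • e z := by rw [hz.apply_eq_smul, map_smul]
  have h2 := congrArg Subtype.val h1
  simp only [T, LinearMap.comp_apply, LinearEquiv.coe_coe, LinearEquiv.apply_symm_apply,
    LinearMap.coe_restrict_apply, Submodule.coe_smul, e, Submodule.coe_equivMapOfInjective_apply,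
    μ, LinearMap.mulLeft_apply] at h2
  have h3 : Ideal.Quotient.mk I (f - C t * l) * (z : MvPolynomial σ K ⧸ I) = 0 := by
    rw [map_sub, map_mul, sub_mul, h2, mul_assoc, sub_eq_zero]
    obtain ⟨z', hz'⟩ := Ideal.Quotient.mk_surjective (z : MvPolynomial σ K ⧸ I)
    rw [← hz', ← map_mul, ← map_mul, ← smul_eq_C_mul]
    rfl
  have h4 : (z : MvPolynomial σ K ⧸ I) ≠ 0 := fun h => hz.2 (Subtype.ext h)
  exact ⟨t, Ideal.Quotient.eq_zero_iff_mem.1 ((mul_eq_zero.1 h3).resolve_right h4)⟩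

/-- A surjection onto a space of the same finite dimension is injective. -/
lemma mem_of_mul_mem_of_map_gradedPart_eq {A : Ideal (MvPolynomial σ K)} {y : MvPolynomial σ K}
    {m : ℕ} (hm : hilb A m = hilb A (m + 1))
    (h : gradedPart A (m + 1) ≤ (gradedPart A m).map (LinearMap.mulLeft K (Ideal.Quotient.mk A y)))
    {f : MvPolynomial σ K} (hf : f.IsHomogeneous m) (hyf : y * f ∈ A) : f ∈ A := by
  let g := (LinearMap.mulLeft K (Ideal.Quotient.mk A y)).domRestrict (gradedPart A m)
  have h1 := g.finrank_range_add_finrank_ker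
  rw [LinearMap.range_domRestrict] at h1
  have h2 := Submodule.finrank_mono h
  have h3 : Module.finrank K (LinearMap.ker g) = 0 := by
    unfold hilb at hm
    omega
  rw [Submodule.finrank_eq_zero] at h3
  have h4 : (⟨Ideal.Quotient.mk A f, ⟨f, hf, rfl⟩⟩ : gradedPart A m) ∈ LinearMap.ker g := by
    rw [LinearMap.mem_ker]
    exact Ideal.Quotient.eq_zero_iff_mem.2 hyf
  rw [h3, Submodule.mem_bot] at h4
  exact Ideal.Quotient.eq_zero_iff_mem.1 (congrArg Subtype.val h4)

/-- The Hilbert function of the saturated hyperplane section of an integral curve of degree `d`. -/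
theorem exists_hilb_section [IsAlgClosed K] [CharZero K] {I : Ideal (MvPolynomial σ K)}
    (hI : HasComponents I) [I.IsPrime] {d : ℕ} (hd : ∀ᶠ n in Filter.atTop, hilb I (n + 1) = hilb I n + d)
    {l : MvPolynomial σ K} (hl : l.IsHomogeneous 1) (hlI : l ∉ I) :
    ∃ h : ℕ → ℕ, (∀ n, h n ≤ h (n + 1)) ∧ (∀ n, h n = h (n + 1) → h (n + 1) = h (n + 2)) ∧
      (∀ n, hilb I n + h (n + 1) ≤ hilb I (n + 1)) ∧ hilb I 1 ≤ h 1 + 1 ∧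
      ∀ᶠ n in Filter.atTop, h n = d := by
  have : Infinite K := IsAlgClosed.instInfinite
  set A := I ⊔ Ideal.span {l} with hA
  obtain ⟨J, N, hAJ, hJA, hsat⟩ := exists_saturation A
  obtain ⟨y, hy, hreg⟩ := exists_regular_linear_form hsat
  have hHA : ∀ n, hilb A (n + 1) + hilb I n = hilb I (n + 1) :=
    hilb_sup_span hI hl fun g hg => (Ideal.IsPrime.mem_or_mem ‹_› hg).resolve_left hlI
  have hJA' := hilb_antitone hAJ
  obtain ⟨n₀, hn₀⟩ := Filter.eventually_atTop.1 hd
  have hAd : ∀ n ≥ n₀, hilb A (n + 1) = d := fun n hn => by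
    have := hHA n; have := hn₀ n hn; omega
  have mono : Monotone (hilb J) := monotone_nat_of_le_succ (hilb_le_succ hy hreg)
  refine ⟨hilb J, hilb_le_succ hy hreg, fun n => hilb_eq_succ_of_eq hy hreg, fun n => ?_, ?_, ?_⟩
  · have := hHA n; have := hJA' (n + 1); omega
  -- Saturating adds no linear form beyond those of `I` and `l`, so the section spans the whole
  -- hyperplane.
  · have h1 : idealPart J 1 ≤ idealPart I 1 ⊔ Submodule.span K {l} := by
      rintro f ⟨hf, hfJ⟩
      obtain ⟨t, ht⟩ := exists_sub_C_mul_mem hI hl hlI hf (fun g hg => hJA f hfJ g hg)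
      rw [← sub_add_cancel f (C t * l)]
      refine Submodule.add_mem_sup ⟨IsHomogeneous.sub hf (hl.C_mul t), ht⟩ ?_
      rw [← smul_eq_C_mul]
      exact Submodule.smul_mem _ _ (Submodule.mem_span_singleton_self l)
    have h2 := Submodule.finrank_mono h1
    have h3 := Submodule.finrank_add_le_finrank_add_finrank (idealPart I 1) (Submodule.span K {l})
    have h4 := finrank_span_le_card (R := K) ({l} : Set (MvPolynomial σ K))
    rw [Set.toFinset_singleton, Finset.card_singleton] at h4
    have h5 := hilb_add_finrank_idealPart I 1
    have h6 := hilb_add_finrank_idealPart J 1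
    omega
  · have hconst : ∃ n₁, ∀ n ≥ n₁, hilb J n = hilb J (n + 1) := by
      by_contra hcon
      push Not at hcon
      have : ∀ k, ∃ n, k ≤ hilb J n := by
        intro k
        induction k with
        | zero => exact ⟨0, Nat.zero_le _⟩
        | succ k ih =>
          obtain ⟨n, hn⟩ := ih
          obtain ⟨m, hm, hne⟩ := hcon n
          exact ⟨m + 1, by have := mono hm; have := hilb_le_succ hy hreg m; omega⟩
      obtain ⟨n, hn⟩ := this (d + 1)
      have h1 := mono (show n ≤ n + n₀ + 1 by omega)
      have h2 := hJA' (n + n₀ + 1)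
      have h3 := hAd (n + n₀) (by omega)
      omega
    obtain ⟨n₁, hn₁⟩ := hconst
    -- Multiplication by `y` is onto modulo `J`, and forms of degree `N` carry the error from `J`
    -- into `A`; so it is onto modulo `A` too. Both dimensions there are `d`, hence it is injective,
    -- and `y ^ N * J ⊆ A` forces `J` and `A` to agree in large degrees.
    have hsurj : ∀ n ≥ n₁, gradedPart A (n + N + 1) ≤
        (gradedPart A (n + N)).map (LinearMap.mulLeft K (Ideal.Quotient.mk A y)) := by
      intro n hn
      have h1 := map_mul_gradedPart_eq hy hreg (hn₁ n hn)
      have hgen : ∀ k, homogeneousSubmodule σ K (k + (n + 1)) ≤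
          homogeneousSubmodule σ K k * homogeneousSubmodule σ K (n + 1) := by
        intro k
        rw [← homogeneousSubmodule_one_pow (σ := σ) (R := K) (k + (n + 1)), pow_add,
          homogeneousSubmodule_one_pow, homogeneousSubmodule_one_pow]
      rintro _ ⟨f, hf, rfl⟩
      have hf' := hgen N (show f ∈ homogeneousSubmodule σ K (N + (n + 1)) by
        rw [show N + (n + 1) = n + N + 1 by omega]; exact hf)
      refine Submodule.mul_induction_on hf' ?_ ?_
      · intro u hu v hv
        have h3 : Ideal.Quotient.mk J v ∈ gradedPart J (n + 1) := ⟨v, hv, rfl⟩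
        rw [← h1] at h3
        obtain ⟨_, ⟨w, hw, rfl⟩, h4⟩ := h3
        have h4 : Ideal.Quotient.mk J (y * w) = Ideal.Quotient.mk J v := h4
        rw [Ideal.Quotient.mk_eq_mk_iff_sub_mem] at h4
        refine ⟨Ideal.Quotient.mk A (u * w), ⟨u * w, add_comm N n ▸ IsHomogeneous.mul hu hw, rfl⟩, ?_⟩
        change Ideal.Quotient.mk A (y * (u * w)) = Ideal.Quotient.mk A (u * v)
        rw [Ideal.Quotient.mk_eq_mk_iff_sub_mem]
        have := hJA _ h4 u hu
        rwa [show y * (u * w) - u * v = u * (y * w - v) by ring]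
      · intro a b ha hb
        rw [map_add]
        exact add_mem ha hb
    have hinj : ∀ m ≥ n₁ + N + n₀ + 1, ∀ f : MvPolynomial σ K, f.IsHomogeneous m → y * f ∈ A → f ∈ A := by
      intro m hm f hf hyf
      refine mem_of_mul_mem_of_map_gradedPart_eq ?_ ?_ hf hyf
      · obtain ⟨k, rfl⟩ := Nat.exists_eq_add_of_le' hm
        have h1 := hAd (k + (n₁ + N + n₀)) (by omega)
        have h2 := hAd (k + (n₁ + N + n₀ + 1)) (by omega)
        rw [← Nat.add_assoc, h1.trans h2.symm]
        rfl
      · obtain ⟨k, rfl⟩ := Nat.exists_eq_add_of_le' hm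
        have := hsurj (k + (n₁ + n₀ + 1)) (by omega)
        rwa [show k + (n₁ + n₀ + 1) + N = k + (n₁ + N + n₀ + 1) by omega] at this
    refine Filter.eventually_atTop.2 ⟨n₁ + N + n₀ + 1, fun m hm => ?_⟩
    have hpow : ∀ k, ∀ f : MvPolynomial σ K, f.IsHomogeneous m → y ^ k * f ∈ A → f ∈ A := by
      intro k
      induction k with
      | zero => intro f _ h; simpa using h
      | succ k ih =>
        intro f hf h
        refine ih f hf (hinj (k + m) (by omega) _ ?_ ?_)
        · have := (hy.pow k).mul hf
          rwa [one_mul] at this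
        · rwa [← mul_assoc, ← pow_succ']
    have heq : idealPart J m = idealPart A m := by
      refine le_antisymm (fun f hf => ⟨hf.1, ?_⟩) (idealPart_mono hAJ m)
      exact hpow N f hf.1 (hJA f hf.2 _ (by simpa using hy.pow N))
    have h1 := hilb_add_finrank_idealPart J m
    have h2 := hilb_add_finrank_idealPart A m
    obtain ⟨k, rfl⟩ := Nat.exists_eq_add_of_le' hm
    have h3 := hAd (k + (n₁ + N + n₀)) (by omega)
    rw [show k + (n₁ + N + n₀) + 1 = k + (n₁ + N + n₀ + 1) by omega] at h3
    rw [heq] at h1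
    omega

/-- The Hilbert function of an integral curve of degree `4` and arithmetic genus `1`. -/
theorem hilb_one_le_four [IsAlgClosed K] [CharZero K] {I : Ideal (MvPolynomial σ K)}
    (hI : HasComponents I) [I.IsPrime] (hd : ∀ᶠ n in Filter.atTop, hilb I n = 4 * n) :
    hilb I 1 ≤ 4 ∧ (hilb I 1 = 4 → ∀ n, 1 ≤ n → hilb I n = 4 * n) := by
  by_cases hl : ∃ l : MvPolynomial σ K, l.IsHomogeneous 1 ∧ l ∉ I
  · obtain ⟨l, hl, hlI⟩ := hl
    have hd' : ∀ᶠ n in Filter.atTop, hilb I (n + 1) = hilb I n + 4 := by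
      filter_upwards [hd, (Filter.tendsto_add_atTop_nat 1).eventually hd] with n h1 h2
      rw [h1, h2]; ring
    obtain ⟨h, hmono, hstep, hH, h1, hev⟩ := exists_hilb_section hI hd' hl hlI
    have mono : Monotone h := monotone_nat_of_le_succ hmono
    have hsum : ∀ n, 1 ≤ n → hilb I 1 + 4 * (n - 1) ≤ hilb I n ∨ h 2 ≤ 3 := by
      intro n hn
      by_cases h2 : h 2 ≤ 3
      · exact Or.inr h2
      left
      induction n, hn using Nat.le_induction with
      | base => simp
      | succ n hn ih =>
        have := mono (show 2 ≤ n + 1 by omega)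
        have := hH n
        omega
    have hconst : h 1 = h 2 → ∀ n, 1 ≤ n → h n = h 1 := by
      intro h12
      have : ∀ n, 1 ≤ n → h n = h 1 ∧ h (n + 1) = h 1 := by
        intro n hn
        induction n, hn using Nat.le_induction with
        | base => exact ⟨rfl, h12.symm⟩
        | succ n hn ih => exact ⟨ih.2, by rw [← hstep n (by omega)]; exact ih.2⟩
      exact fun n hn => (this n hn).1
    obtain ⟨m, hm1, hm2, hm3⟩ := (hev.and (hd.and (Filter.eventually_ge_atTop 1))).exists
    have h2 : 3 ≤ h 1 → 4 ≤ h 2 := by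
      intro h3
      by_contra hcon
      have h11 : h 1 ≤ h 2 := hmono 1
      have h12 : h 1 = h 2 := by omega
      have := hconst h12 m hm3
      omega
    refine ⟨?_, fun h4 n hn => ?_⟩
    · by_contra hcon
      have := hsum m hm3
      omega
    -- Increments from degree `n ≥ 1` on are at least 4 and the value is eventually `4 n`, so no
    -- earlier value exceeds `4 n`; `hsum` gives the opposite bound.
    · have hlow : ∀ k, hilb I n + 4 * k ≤ hilb I (n + k) := by
        intro k
        induction k with
        | zero => simp
        | succ k ih =>
          have := mono (show 2 ≤ n + k + 1 by omega)
          have := hH (n + k)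
          rw [← Nat.add_assoc]
          omega
      have h4 := hsum n hn
      obtain ⟨k, hk1, hk2⟩ := (hd.and (Filter.eventually_ge_atTop n)).exists
      obtain ⟨j, rfl⟩ := Nat.exists_eq_add_of_le hk2
      have h5 := hlow j
      omega
  · have h0 : hilb I 1 = 0 := by
      rw [hilb, Submodule.finrank_eq_zero, eq_bot_iff]
      rintro _ ⟨f, hf, rfl⟩
      rw [Submodule.mem_bot]
      by_contra hne
      exact hl ⟨f, hf, fun h => hne (Ideal.Quotient.eq_zero_iff_mem.2 h)⟩
    omega

end PrimeSection
end FanoV8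
namespace FanoV8
open MvPolynomial Matrix

set_option linter.unusedSectionVars false

/-! ### Linear substitutions -/

section Substitution
variable {σ τ K : Type*} [Fintype σ] [Fintype τ] [Field K]

/-- Pull-back of polynomials along the linear map with matrix `w`. -/
noncomputable def pullback (w : Matrix τ σ K) : MvPolynomial τ K →ₐ[K] MvPolynomial σ K :=
  aeval fun i => ∑ j, C (w i j) * X j

@[simp]
lemma pullback_X (w : Matrix τ σ K) (i : τ) : pullback w (X i) = ∑ j, C (w i j) * X j := by
  simp [pullback]

lemma eval_pullback (w : Matrix τ σ K) (f : MvPolynomial τ K) (y : σ → K) :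
    eval y (pullback w f) = eval (w *ᵥ y) f := by
  have : (aeval y).comp (pullback w) = (aeval (w *ᵥ y) : MvPolynomial τ K →ₐ[K] K) := by
    apply algHom_ext
    intro i
    simp [aeval_eq_eval, mulVec, dotProduct]
  simpa [aeval_eq_eval] using DFunLike.congr_fun this f

lemma isHomogeneous_pullback (w : Matrix τ σ K) {f : MvPolynomial τ K} {n : ℕ}
    (hf : f.IsHomogeneous n) : (pullback w f).IsHomogeneous n := by
  have := hf.aeval (fun i => ∑ j, C (w i j) * X j) (n := 1)
    (fun i => IsHomogeneous.sum _ _ _ fun j _ => isHomogeneous_C_mul_X _ _)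
  rwa [one_mul] at this

lemma homogeneousComponent_pullback (w : Matrix τ σ K) (f : MvPolynomial τ K) (n : ℕ) :
    homogeneousComponent n (pullback w f) = pullback w (homogeneousComponent n f) := by
  conv_lhs => rw [← sum_homogeneousComponent f, map_sum, map_sum]
  have : ∀ i, homogeneousComponent n (pullback w (homogeneousComponent i f)) =
      if n = i then pullback w (homogeneousComponent i f) else 0 := fun i => by
    rw [homogeneousComponent_of_mem
      (isHomogeneous_pullback w (homogeneousComponent_isHomogeneous i f))]
  simp only [this]
  rw [Finset.sum_ite_eq]
  split_ifs with h
  · rfl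
  · rw [homogeneousComponent_eq_zero, map_zero]
    simpa using h

lemma HasComponents.comap_pullback {P : Ideal (MvPolynomial σ K)} (hP : HasComponents P)
    (w : Matrix τ σ K) : HasComponents (P.comap (pullback w)) := by
  intro f hf n
  rw [Ideal.mem_comap, ← homogeneousComponent_pullback]
  exact hP _ hf n

variable [DecidableEq σ]

lemma pullback_pullback [Infinite K] {w : Matrix τ σ K} {u : Matrix σ τ K} (h : u * w = 1)
    (f : MvPolynomial σ K) : pullback w (pullback u f) = f := by
  apply MvPolynomial.funext
  intro y
  rw [eval_pullback, eval_pullback, mulVec_mulVec, h, one_mulVec]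

/-- `pullback w` is a degree-preserving surjection, split by `pullback u`, so it identifies the two
graded quotients. -/
lemma hilb_comap_pullback [Infinite K] {w : Matrix τ σ K} {u : Matrix σ τ K} (h : u * w = 1)
    (P : Ideal (MvPolynomial σ K)) (n : ℕ) : hilb (P.comap (pullback w)) n = hilb P n := by
  let φ := Ideal.quotientMapₐ P (pullback w) (le_refl (P.comap (pullback w)))
  have hφ : Function.Injective φ.toLinearMap := Ideal.quotientMap_injective
  rw [hilb, ← finrank_map_of_injective hφ]
  suffices h' : (gradedPart (P.comap (pullback w)) n).map φ.toLinearMap = gradedPart P n by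
    rw [h']; rfl
  ext z
  constructor
  · rintro ⟨_, ⟨f, hf, rfl⟩, rfl⟩
    exact ⟨pullback w f, isHomogeneous_pullback w hf, rfl⟩
  · rintro ⟨f, hf, rfl⟩
    refine ⟨_, ⟨pullback u f, isHomogeneous_pullback u hf, rfl⟩, ?_⟩
    change Ideal.Quotient.mk P (pullback w (pullback u f)) = Ideal.Quotient.mk P f
    rw [pullback_pullback h]

end Substitution

/-! ### Reduction to the linear span -/

section Span
variable {τ K : Type*} [Fintype τ] [DecidableEq τ] [Field K]

/-- A homogeneous ideal is the pull-back of an ideal without linear forms in the coordinate ring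
of its linear span. -/
theorem exists_span (I : Ideal (MvPolynomial τ K)) :
    ∃ (w : Matrix τ (Fin (hilb I 1)) K) (u : Matrix (Fin (hilb I 1)) τ K), u * w = 1 ∧
      I = (I.comap (pullback u)).comap (pullback w) ∧
      ∀ g : MvPolynomial (Fin (hilb I 1)) K, g.IsHomogeneous 1 → g ∈ I.comap (pullback u) →
        g = 0 := by
  let lin : (τ → K) →ₗ[K] MvPolynomial τ K := Fintype.linearCombination K X
  have hlin : LinearMap.range lin = homogeneousSubmodule τ K 1 := by
    rw [Fintype.range_linearCombination, homogeneousSubmodule_one_eq_span_X]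
  let q : (τ → K) →ₗ[K] MvPolynomial τ K ⧸ I := (Ideal.Quotient.mkₐ K I).toLinearMap ∘ₗ lin
  have hq : LinearMap.range q = gradedPart I 1 := by
    rw [LinearMap.range_comp, hlin]; rfl
  have e : LinearMap.range q ≃ₗ[K] (Fin (hilb I 1) → K) :=
    LinearEquiv.ofFinrankEq _ _ (by rw [hq, Module.finrank_fin_fun]; rfl)
  let π : (τ → K) →ₗ[K] (Fin (hilb I 1) → K) := e.toLinearMap ∘ₗ q.rangeRestrict
  have hπ : Function.Surjective π := e.surjective.comp q.surjective_rangeRestrict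
  have hπI : ∀ v, π v = 0 ↔ lin v ∈ I := by
    intro v
    rw [← Ideal.Quotient.eq_zero_iff_mem]
    change e (q.rangeRestrict v) = 0 ↔ _
    rw [LinearEquiv.map_eq_zero_iff, Subtype.ext_iff]
    rfl
  -- `π` gives the coordinates of a linear form modulo `I`, and `s` lifts them back. The matrices
  -- are transposed since `π` and `s` act on coefficient vectors of forms, whereas `w` and `u` act
  -- on points.
  obtain ⟨s, hs⟩ := π.exists_rightInverse_of_surjective (LinearMap.range_eq_top.2 hπ)
  let w := (LinearMap.toMatrix' π)ᵀ
  let u := (LinearMap.toMatrix' s)ᵀ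
  have hw : ∀ v, v ᵥ* w = π v := fun v => by
    rw [vecMul_transpose, LinearMap.toMatrix'_mulVec]
  have huw : u * w = 1 := by
    rw [← transpose_mul, ← LinearMap.toMatrix'_comp, hs, LinearMap.toMatrix'_id, transpose_one]
  have hpl : ∀ (v : Fin (hilb I 1) → K), pullback u (∑ j, C (v j) * X j) = lin (v ᵥ* u) := by
    intro v
    simp only [map_sum, map_mul, pullback_X, lin, Fintype.linearCombination_apply, vecMul, dotProduct,
      smul_eq_C_mul, algHom_C, algebraMap_eq, Finset.mul_sum, Finset.sum_mul]
    rw [Finset.sum_comm]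
    refine Finset.sum_congr rfl fun i _ => Finset.sum_congr rfl fun j _ => by ring
  refine ⟨w, u, huw, ?_, ?_⟩
  · have key : (Ideal.Quotient.mkₐ K I).comp ((pullback u).comp (pullback w)) =
        Ideal.Quotient.mkₐ K I := by
      apply algHom_ext
      intro i
      simp only [AlgHom.comp_apply, pullback_X]
      rw [hpl]
      change Ideal.Quotient.mk I _ = Ideal.Quotient.mk I _
      have h1 : (X i : MvPolynomial τ K) = lin (Pi.single i 1) := by
        simp [lin, Fintype.linearCombination_apply_single]
      rw [Ideal.Quotient.mk_eq_mk_iff_sub_mem, h1, ← map_sub, ← hπI, ← hw, sub_vecMul,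
        vecMul_vecMul, huw, vecMul_one, sub_eq_zero]
      ext j
      simp
    ext f
    rw [Ideal.mem_comap, Ideal.mem_comap, ← Ideal.Quotient.eq_zero_iff_mem,
      ← Ideal.Quotient.eq_zero_iff_mem]
    exact Eq.congr_left (DFunLike.congr_fun key f).symm
  · intro g hg hgI
    have h1 : g ∈ homogeneousSubmodule (Fin (hilb I 1)) K 1 := hg
    rw [homogeneousSubmodule_one_eq_span_X, ← Fintype.range_linearCombination] at h1
    obtain ⟨v, rfl⟩ := h1
    have h2 : Fintype.linearCombination K X v = ∑ j, C (v j) * (X j : MvPolynomial _ K) := by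
      simp [Fintype.linearCombination_apply, smul_eq_C_mul]
    rw [h2, Ideal.mem_comap, hpl, ← hπI, ← hw, vecMul_vecMul, huw, vecMul_one] at hgI
    rw [hgI, map_zero]

end Span

/-! ### Classification of integral curves with Hilbert polynomial 4n -/

section Count
variable {σ K : Type*} [Fintype σ] [Field K]

lemma finrank_homogeneousSubmodule (σ K : Type*) [Fintype σ] [Field K] (n : ℕ) :
    Module.finrank K (homogeneousSubmodule σ K n) = (Fintype.card σ).multichoose n := by
  classical
  rw [← Sym.card_sym_eq_multichoose, homogeneousSubmodule_eq_finsupp_supported]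
  let e : Sym σ n ≃ {d : σ →₀ ℕ | d.degree = n} := Sym.equivNatSum σ n
  let _ : Fintype {d : σ →₀ ℕ | d.degree = n} := Fintype.ofEquiv _ e
  rw [(AddMonoidAlgebra.supportedEquivFinsupp (R := K) (S := K)
    {d : σ →₀ ℕ | d.degree = n}).finrank_eq, Module.finrank_finsupp_self]
  exact Fintype.card_congr e.symm

lemma hilb_bot (n : ℕ) : hilb (⊥ : Ideal (MvPolynomial σ K)) n = (Fintype.card σ).multichoose n := by
  have h := hilb_add_finrank_idealPart (⊥ : Ideal (MvPolynomial σ K)) n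
  have h2 : idealPart (⊥ : Ideal (MvPolynomial σ K)) n = ⊥ := by
    rw [eq_bot_iff]
    exact fun f hf => hf.2
  rw [h2, finrank_bot, add_zero, finrank_homogeneousSubmodule] at h
  exact h

lemma hilb_le_multichoose (I : Ideal (MvPolynomial σ K)) (n : ℕ) :
    hilb I n ≤ (Fintype.card σ).multichoose n :=
  hilb_bot (σ := σ) (K := K) n ▸ hilb_antitone bot_le n

lemma multichoose_one_left (n : ℕ) : Nat.multichoose 1 n = 1 := by simp

lemma multichoose_two_left (n : ℕ) : Nat.multichoose 2 n = n + 1 := by simp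

lemma multichoose_three_left (n : ℕ) : 2 * Nat.multichoose 3 n = (n + 1) * (n + 2) := by
  induction n with
  | zero => simp
  | succ n ih =>
    rw [Nat.multichoose_succ_succ, mul_add, ih, multichoose_two_left]
    ring

lemma multichoose_four_left (n : ℕ) : 6 * Nat.multichoose 4 n = (n + 1) * (n + 2) * (n + 3) := by
  induction n with
  | zero => simp
  | succ n ih =>
    rw [Nat.multichoose_succ_succ, mul_add, ih]
    have := multichoose_three_left (n + 1)
    linarith

/-- A form of minimal degree in a homogeneous prime ideal is prime. -/
theorem prime_of_minimal_degree {P : Ideal (MvPolynomial σ K)} [hP : P.IsPrime]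
    (hPc : HasComponents P) {f : MvPolynomial σ K} {d : ℕ} (hf : f.IsHomogeneous d) (hf0 : f ≠ 0)
    (hfP : f ∈ P) (hmin : ∀ m < d, ∀ g : MvPolynomial σ K, g.IsHomogeneous m → g ∈ P → g = 0) :
    Prime f := by
  have hdeg : ∀ g ∈ P, g ≠ 0 → d ≤ g.totalDegree := by
    intro g hg hg0
    by_contra hlt
    push Not at hlt
    have hz : ∀ n, homogeneousComponent n g = 0 := fun n => by
      rcases lt_or_ge g.totalDegree n with h | h
      · exact homogeneousComponent_eq_zero _ _ h
      · exact hmin n (by omega) _ (homogeneousComponent_isHomogeneous _ _) (hPc g hg n)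
    apply hg0
    rw [← sum_homogeneousComponent g]
    exact Finset.sum_eq_zero fun i _ => hz i
  -- A factor in `P` already has degree at least `d`, so the cofactor is constant.
  have hunit : ∀ a b : MvPolynomial σ K, f = a * b → a ∈ P → IsUnit b := by
    intro a b hab ha
    have ha0 : a ≠ 0 := fun h => hf0 (by rw [hab, h, zero_mul])
    have hb0 : b ≠ 0 := fun h => hf0 (by rw [hab, h, mul_zero])
    have h1 := totalDegree_mul_of_isDomain ha0 hb0
    rw [← hab, hf.totalDegree hf0] at h1
    have h2 := hdeg a ha ha0
    have h3 : b.totalDegree = 0 := by omega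
    rw [totalDegree_eq_zero_iff_eq_C] at h3
    rw [h3]
    refine (IsUnit.mk0 _ ?_).map C
    intro h
    rw [h, C_0] at h3
    exact hb0 h3
  rw [← UniqueFactorizationMonoid.irreducible_iff_prime]
  refine ⟨fun h => hP.ne_top (Ideal.eq_top_of_isUnit_mem _ hfP h), fun {a b} hab => ?_⟩
  rcases hP.mem_or_mem (hab ▸ hfP) with ha | hb
  · exact Or.inr (hunit a b hab ha)
  · exact Or.inl (hunit b a (by rw [hab, mul_comm]) hb)

lemma hilb_span_singleton {f : MvPolynomial σ K} (hf0 : f ≠ 0) {d : ℕ} (hf : f.IsHomogeneous d)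
    (n : ℕ) : hilb (Ideal.span {f}) (n + d) + (Fintype.card σ).multichoose n =
      (Fintype.card σ).multichoose (n + d) := by
  have h := hilb_sup_span (I := (⊥ : Ideal (MvPolynomial σ K)))
    (fun g hg n => by rw [Ideal.mem_bot.1 hg, map_zero]; exact zero_mem _) hf
    (fun g hg => (mul_eq_zero.1 (Ideal.mem_bot.1 hg)).resolve_left hf0) n
  rwa [bot_sup_eq, hilb_bot, hilb_bot] at h

lemma hilb_span_singleton_of_lt {f : MvPolynomial σ K} {d : ℕ} (hf : f.IsHomogeneous d)
    {n : ℕ} (hn : n < d) : hilb (Ideal.span {f}) n = (Fintype.card σ).multichoose n := by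
  have h := hilb_sup_span_of_lt (I := (⊥ : Ideal (MvPolynomial σ K)))
    (fun g hg n => by rw [Ideal.mem_bot.1 hg, map_zero]; exact zero_mem _) hf hn
  rwa [bot_sup_eq, hilb_bot] at h

lemma regular_of_prime {f g : MvPolynomial σ K} (hf : Prime f) (hg : ¬ f ∣ g) :
    ∀ u, g * u ∈ Ideal.span {f} → u ∈ Ideal.span {f} := by
  intro u hu
  rw [Ideal.mem_span_singleton] at hu ⊢
  exact (hf.dvd_or_dvd hu).resolve_left hg

lemma hilb_span_pair {f g : MvPolynomial σ K} {d e : ℕ} (hf : f.IsHomogeneous d)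
    (hg : g.IsHomogeneous e) (hfp : Prime f) (hfg : ¬ f ∣ g) (n : ℕ) :
    hilb (Ideal.span {f} ⊔ Ideal.span {g}) (n + e) + hilb (Ideal.span {f}) n =
      hilb (Ideal.span {f}) (n + e) :=
  hilb_sup_span (hasComponents_span_singleton hf) hg (regular_of_prime hfp hfg) n

/-- The Hilbert function of a complete intersection of two quadrics in `ℙ³`. -/
theorem hilb_two_quadrics {a b : MvPolynomial (Fin 4) K} (ha : a.IsHomogeneous 2)
    (hb : b.IsHomogeneous 2) (hap : Prime a) (hab : ¬ a ∣ b) {n : ℕ} (hn : 1 ≤ n) :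
    hilb (Ideal.span {a} ⊔ Ideal.span {b}) n = 4 * n := by
  have hM := multichoose_four_left
  have h1 := hilb_span_pair ha hb hap hab
  have h2 := hilb_span_singleton hap.ne_zero ha
  have h3 := fun n => hilb_span_singleton_of_lt (n := n) ha
  simp only [Fintype.card_fin] at h2 h3
  rcases lt_or_ge n 2 with h | h
  · obtain rfl : n = 1 := by omega
    rw [hilb_sup_span_of_lt (hasComponents_span_singleton ha) hb h, h3 1 h]
    have := hM 1
    omega
  · obtain ⟨k, rfl⟩ := Nat.exists_eq_add_of_le' h
    have e1 := h1 k
    have e2 := h2 k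
    have e3 := hM k
    have e4 := hM (k + 2)
    rcases lt_or_ge k 2 with hk | hk
    · rw [h3 k hk] at e1
      interval_cases k <;> omega
    · obtain ⟨j, rfl⟩ := Nat.exists_eq_add_of_le' hk
      have e5 := h2 j
      have e6 := hM j
      zify at *
      linarith

lemma eq_zero_of_isHomogeneous_zero {P : Ideal (MvPolynomial σ K)} (hP : P ≠ ⊤)
    {g : MvPolynomial σ K} (hg : g.IsHomogeneous 0) (hgP : g ∈ P) : g = 0 := by
  have h := (mem_homogeneousSubmodule 0 g).2 hg
  rw [homogeneousSubmodule_zero] at h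
  obtain ⟨c, rfl⟩ := Submodule.mem_one.1 h
  by_contra hne
  refine hP (Ideal.eq_top_of_isUnit_mem _ hgP ((IsUnit.mk0 c ?_).map C))
  rintro rfl
  simp at hne

lemma HasComponents.le_of_forall {P Q : Ideal (MvPolynomial σ K)} (hP : HasComponents P)
    (h : ∀ n, ∀ g : MvPolynomial σ K, g.IsHomogeneous n → g ∈ P → g ∈ Q) : P ≤ Q := by
  intro g hg
  rw [← sum_homogeneousComponent g]
  exact sum_mem fun i _ => h i _ (homogeneousComponent_isHomogeneous _ _) (hP g hg i)

/-- There are no plane curves with Hilbert polynomial `4n`. -/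
theorem not_hilb_plane {P : Ideal (MvPolynomial (Fin 3) K)} [hP : P.IsPrime] (hPc : HasComponents P)
    (h : ∀ᶠ n in Filter.atTop, hilb P n = 4 * n) : False := by
  classical
  have hM := multichoose_three_left
  obtain ⟨n₀, h⟩ := Filter.eventually_atTop.1 h
  have hex : ∃ d, ∃ f : MvPolynomial (Fin 3) K, f.IsHomogeneous d ∧ f ∈ P ∧ f ≠ 0 := by
    by_contra hcon
    have hbot : P = ⊥ := by
      rw [eq_bot_iff]
      refine hPc.le_of_forall fun n g hg hgP => ?_
      by_contra hne
      exact hcon ⟨n, g, hg, hgP, hne⟩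
    have h1 := h (n₀ + 6) (by omega)
    rw [hbot, hilb_bot, Fintype.card_fin] at h1
    have h2 := hM (n₀ + 6)
    nlinarith
  obtain ⟨f, hf, hfP, hf0⟩ := Nat.find_spec hex
  set d := Nat.find hex with hd
  have hfp : Prime f := prime_of_minimal_degree hPc hf hf0 hfP fun m hm g hg hgP => by
    by_contra hne
    exact Nat.find_min hex hm ⟨g, hg, hgP, hne⟩
  have hF := hilb_span_singleton hf0 hf
  simp only [Fintype.card_fin] at hF
  by_cases hall : ∀ n, ∀ g : MvPolynomial (Fin 3) K, g.IsHomogeneous n → g ∈ P → f ∣ g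
  · have hPf : P = Ideal.span {f} := le_antisymm
      (hPc.le_of_forall fun n g hg hgP => Ideal.mem_span_singleton.2 (hall n g hg hgP))
      ((Ideal.span_singleton_le_iff_mem _).2 hfP)
    subst hPf
    have a1 := h (n₀ + d) (by omega)
    have a2 := h (n₀ + 1 + d) (by omega)
    have b1 := hF n₀
    have b2 := hF (n₀ + 1)
    have c1 := hM n₀
    have c2 := hM (n₀ + 1)
    have c3 := hM (n₀ + d)
    have c4 := hM (n₀ + 1 + d)
    -- The Hilbert polynomial of a plane curve has slope `d`; for `d = 4` it is `4 n - 2`, as plane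
    -- quartics have arithmetic genus 3.
    have hd4 : d = 4 := by zify at *; linarith
    rw [hd4] at a1 b1 c3
    zify at *
    linarith
  · push Not at hall
    obtain ⟨e, g, hg, hgP, hfg⟩ := hall
    have hle : Ideal.span {f} ⊔ Ideal.span {g} ≤ P := sup_le
      ((Ideal.span_singleton_le_iff_mem _).2 hfP) ((Ideal.span_singleton_le_iff_mem _).2 hgP)
    have hG := hilb_span_pair hf hg hfp hfg
    -- Bézout: two plane curves without common component meet in a scheme of length `d * e`, so
    -- `hilb P` would be bounded.
    have key : ∀ n, hilb (Ideal.span {f} ⊔ Ideal.span {g}) (n + d + e) = d * e := by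
      intro n
      have a1 := hG (n + d)
      have a2 := hF n
      have a3 := hF (n + e)
      rw [show n + e + d = n + d + e by omega] at a3
      have c1 := hM n
      have c2 := hM (n + e)
      have c3 := hM (n + d)
      have c4 := hM (n + d + e)
      zify at *
      linarith
    have h1 := hilb_antitone hle (n₀ + d * e + 1 + d + e)
    rw [key, h _ (by nlinarith)] at h1
    nlinarith

/-- An integral curve of degree `4` and arithmetic genus `1` is a complete intersection of two
quadrics in a `3`-space. -/
theorem exists_eq_comap_span_pair {τ : Type*} [Fintype τ] [DecidableEq τ] [IsAlgClosed K]
    [CharZero K] {I : Ideal (MvPolynomial τ K)} (hI : HasComponents I) [hIp : I.IsPrime]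
    (hd : ∀ᶠ n in Filter.atTop, hilb I n = 4 * n) :
    ∃ (w : Matrix τ (Fin 4) K) (u : Matrix (Fin 4) τ K) (a b : MvPolynomial (Fin 4) K),
      u * w = 1 ∧ a.IsHomogeneous 2 ∧ b.IsHomogeneous 2 ∧
      I = (Ideal.span {a} ⊔ Ideal.span {b}).comap (pullback w) := by
  have : Infinite K := IsAlgClosed.instInfinite
  obtain ⟨hle, h4⟩ := hilb_one_le_four hI hd
  obtain ⟨w, u, huw, hIw, hlin⟩ := exists_span I
  generalize hP : I.comap (pullback u) = P at hIw hlin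
  have hPp : P.IsPrime := hP ▸ inferInstance
  have hPc : HasComponents P := hP ▸ hI.comap_pullback u
  have hH : ∀ n, hilb I n = hilb P n := fun n => by
    conv_lhs => rw [hIw]
    exact hilb_comap_pullback huw P n
  simp only [hH] at hd
  replace h4 : hilb I 1 = 4 → ∀ n, 1 ≤ n → hilb P n = 4 * n := fun h n hn => hH n ▸ h4 h n hn
  clear hP
  revert w u P
  generalize hilb I 1 = r at *
  intro w u huw P hIw hlin hPp hPc hH hd h4
  obtain ⟨m, hm, hm1⟩ := (hd.and (Filter.eventually_ge_atTop 1)).exists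
  have hub := hilb_le_multichoose P m
  rw [Fintype.card_fin, hm] at hub
  -- Two or fewer variables have at most `m + 1 < 4 m` monomials of degree `m`, and three variables
  -- give plane curves. With four there are at least `10 - 8 = 2` independent quadrics in the ideal,
  -- and they generate it by comparison of Hilbert functions.
  interval_cases r
  · obtain ⟨k, rfl⟩ := Nat.exists_eq_add_of_le' hm1
    simp at hub
  · rw [multichoose_one_left] at hub; omega
  · rw [multichoose_two_left] at hub; omega
  · exact (not_hilb_plane hPc hd).elim
  · have hH4 := h4 rfl
    have h2 := hilb_add_finrank_idealPart P 2
    have hM2 := multichoose_four_left 2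
    rw [finrank_homogeneousSubmodule, Fintype.card_fin, hH4 2 (by norm_num)] at h2
    have hne : idealPart P 2 ≠ ⊥ := by
      intro h0
      rw [h0, finrank_bot] at h2
      omega
    obtain ⟨a, ha, ha0⟩ := Submodule.exists_mem_ne_zero_of_ne_bot hne
    have hb : ∃ b ∈ idealPart P 2, b ∉ Submodule.span K {a} := by
      by_contra hcon
      push Not at hcon
      have h3 := Submodule.finrank_mono (show idealPart P 2 ≤ Submodule.span K {a} from hcon)
      have h5 := finrank_span_le_card (R := K) ({a} : Set (MvPolynomial (Fin 4) K))
      rw [Set.toFinset_singleton, Finset.card_singleton] at h5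
      omega
    obtain ⟨b, hb, hba⟩ := hb
    have hlow : ∀ m < 2, ∀ g : MvPolynomial (Fin 4) K, g.IsHomogeneous m → g ∈ P → g = 0 := by
      intro m hm g hg hgP
      interval_cases m
      · exact eq_zero_of_isHomogeneous_zero hPp.ne_top hg hgP
      · exact hlin g hg hgP
    have hap : Prime a := prime_of_minimal_degree hPc ha.1 ha0 ha.2 hlow
    have hab : ¬ a ∣ b := by
      rintro ⟨c, hc⟩
      have h6 := homogeneousComponent_add_mul ha.1 0 c
      rw [zero_add, mul_comm, ← hc, homogeneousComponent_eq_self hb.1,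
        homogeneousComponent_zero] at h6
      rw [h6, ← smul_eq_C_mul] at hba
      exact hba (Submodule.smul_mem _ _ (Submodule.mem_span_singleton_self a))
    have hle2 : Ideal.span {a} ⊔ Ideal.span {b} ≤ P := sup_le
      ((Ideal.span_singleton_le_iff_mem _).2 ha.2) ((Ideal.span_singleton_le_iff_mem _).2 hb.2)
    have hPeq : P = Ideal.span {a} ⊔ Ideal.span {b} := by
      refine le_antisymm (hPc.le_of_forall fun n g hg hgP => ?_) hle2
      rcases Nat.eq_zero_or_pos n with rfl | hn
      · rw [hlow 0 (by norm_num) g hg hgP]; exact zero_mem _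
      · have h7 := idealPart_eq_of_hilb_le hle2 (n := n)
          (by rw [hH4 n hn, hilb_two_quadrics ha.1 hb.1 hap hab hn])
        have h8 : g ∈ idealPart P n := ⟨hg, hgP⟩
        rw [← h7] at h8
        exact h8.2
    exact ⟨w, u, a, b, huw, ha.1, hb.1, by rw [hIw, hPeq]⟩

end Count
end FanoV8
namespace FanoV8
open MvPolynomial Matrix

set_option linter.unusedSectionVars false

/-! ### Isotropic subspaces -/

section Isotropic
variable {K V : Type*} [Field K] [IsAlgClosed K] [AddCommGroup V] [Module K V]
  [FiniteDimensional K V]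

/-- A symmetric bilinear form has an isotropic vector in each subspace of dimension two. -/
theorem exists_isotropic_vector (B : LinearMap.BilinForm K V) (hB : B.IsSymm) {U : Submodule K V}
    (hU : 2 ≤ Module.finrank K U) : ∃ v ∈ U, v ≠ 0 ∧ B v v = 0 := by
  obtain ⟨f, hf⟩ := exists_linearIndependent_of_le_finrank hU
  let p : MvPolynomial (Fin 2) K := C (B (f 0) (f 0)) * X 0 ^ 2 +
    C (2 * B (f 0) (f 1)) * (X 0 * X 1) + C (B (f 1) (f 1)) * X 1 ^ 2
  obtain ⟨x, hx, hpx⟩ := exists_binary_zero p two_ne_zero (fun s x => by simp [p]; ring)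
  refine ⟨x 0 • f 0 + x 1 • f 1, ?_, ?_, ?_⟩
  · exact add_mem (U.smul_mem _ (f 0).2) (U.smul_mem _ (f 1).2)
  · intro h
    have h' : x 0 • f 0 + x 1 • f 1 = 0 := Subtype.ext h
    have := Fintype.linearIndependent_iff.1 hf x (by rw [Fin.sum_univ_two]; exact h')
    exact hx (funext this)
  · have hs : B (f 1) (f 0) = B (f 0) (f 1) := hB.eq _ _
    simp only [p, map_add, map_mul, eval_C, map_pow, eval_X] at hpx
    simp only [map_add, map_smul, LinearMap.add_apply, LinearMap.smul_apply, smul_eq_mul, hs]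
    linear_combination hpx

/-- Extension of isotropic subspaces. -/
theorem exists_isotropic_subspace (B : LinearMap.BilinForm K V) (hB : B.IsSymm)
    {W₀ : Submodule K V} (hW₀ : ∀ x ∈ W₀, ∀ y ∈ W₀, B x y = 0) {m : ℕ}
    (hm : Module.finrank K W₀ ≤ m)
    (hm2 : 2 * m ≤ Module.finrank K V + Module.finrank K (W₀ ⊓ B.ker : Submodule K V)) :
    ∃ W : Submodule K V, W₀ ≤ W ∧ Module.finrank K W = m ∧ ∀ x ∈ W, ∀ y ∈ W, B x y = 0 := by
  induction m, hm using Nat.le_induction with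
  | base => exact ⟨W₀, le_rfl, rfl, hW₀⟩
  | succ m hm ih =>
    obtain ⟨W, hW₀W, hWm, hW⟩ := ih (by omega)
    -- `W` lies in its orthogonal, whose dimension is `dim V - m + dim (W ⊓ ker B)`. By the bound on
    -- `m`, a complement of `W` in it has dimension at least two and contains an isotropic vector to
    -- adjoin.
    have h1 := LinearMap.BilinForm.finrank_add_finrank_orthogonal' (B := B) W
    have h2 := Submodule.finrank_mono (inf_le_inf_right B.ker hW₀W)
    have hle : W ≤ B.orthogonal W := fun x hx =>
      LinearMap.BilinForm.mem_orthogonal_iff.2 fun y hy => hW y hy x hx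
    obtain ⟨D, hD⟩ := Submodule.exists_isCompl W
    have h3 : W ⊔ (D ⊓ B.orthogonal W) = B.orthogonal W := by
      rw [← sup_inf_assoc_of_le _ hle, hD.sup_eq_top, top_inf_eq]
    have h4 : W ⊓ (D ⊓ B.orthogonal W) = ⊥ := by
      rw [← inf_assoc, hD.inf_eq_bot, bot_inf_eq]
    have h5 := Submodule.finrank_sup_add_finrank_inf_eq W (D ⊓ B.orthogonal W)
    rw [h3, h4, finrank_bot] at h5
    obtain ⟨v, hv, hv0, hvv⟩ := exists_isotropic_vector B hB (U := D ⊓ B.orthogonal W) (by omega)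
    have hvW : ∀ x ∈ W, B x v = 0 := LinearMap.BilinForm.mem_orthogonal_iff.1 hv.2
    have hvW' : ∀ x ∈ W, B v x = 0 := fun x hx => (hB.eq x v).symm.trans (hvW x hx)
    refine ⟨W ⊔ K ∙ v, hW₀W.trans le_sup_left, ?_, ?_⟩
    · have h6 := Submodule.finrank_sup_add_finrank_inf_eq W (K ∙ v)
      have h7 : W ⊓ (K ∙ v) = ⊥ := by
        rw [eq_bot_iff, ← h4]
        exact inf_le_inf_left _ ((Submodule.span_singleton_le_iff_mem _ _).2 hv)
      rw [h7, finrank_bot, finrank_span_singleton hv0] at h6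
      omega
    · intro x hx y hy
      obtain ⟨x₁, hx₁, x₂, hx₂, rfl⟩ := Submodule.mem_sup.1 hx
      obtain ⟨y₁, hy₁, y₂, hy₂, rfl⟩ := Submodule.mem_sup.1 hy
      obtain ⟨s, rfl⟩ := Submodule.mem_span_singleton.1 hx₂
      obtain ⟨t, rfl⟩ := Submodule.mem_span_singleton.1 hy₂
      simp [hW x₁ hx₁ y₁ hy₁, hvW x₁ hx₁, hvW' y₁ hy₁, hvv]

end Isotropic

/-! ### Hessians, and degeneracy along a pencil of 3 × 4 matrices -/

section Hessian
variable {σ τ K : Type*} [Fintype σ] [Fintype τ] [Field K]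

/-- The Hessian matrix at the origin. -/
noncomputable def hess (Q : MvPolynomial σ K) : Matrix σ σ K :=
  Matrix.of fun i j => eval 0 (pderiv i (pderiv j Q))

lemma pderiv_comm (i j : σ) (Q : MvPolynomial σ K) :
    pderiv i (pderiv j Q) = pderiv j (pderiv i Q) := by
  classical
  have h : ⁅(pderiv i : Derivation K (MvPolynomial σ K) (MvPolynomial σ K)),
      (pderiv j : Derivation K (MvPolynomial σ K) (MvPolynomial σ K))⁆ = 0 := by
    refine derivation_ext fun k => ?_
    rw [Derivation.commutator_apply, pderiv_X, pderiv_X]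
    simp [Pi.single_apply, apply_ite]
  have := DFunLike.congr_fun h Q
  rwa [Derivation.commutator_apply, Derivation.zero_apply, sub_eq_zero] at this

lemma hess_isSymm (Q : MvPolynomial σ K) : (hess Q).IsSymm := by
  ext i j
  simp [hess, pderiv_comm i j]

lemma hess_sum_C_mul {ι : Type*} (t : Finset ι) (s : ι → K) (q : ι → MvPolynomial σ K) :
    hess (∑ k ∈ t, C (s k) * q k) = ∑ k ∈ t, s k • hess (q k) := by
  ext i j
  simp [hess, Matrix.sum_apply]

lemma eval_eq_of_isHomogeneous_zero {f : MvPolynomial σ K} (hf : f.IsHomogeneous 0) (x y : σ → K) :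
    eval x f = eval y f := by
  have h := (mem_homogeneousSubmodule 0 f).2 hf
  rw [homogeneousSubmodule_zero] at h
  obtain ⟨c, rfl⟩ := Submodule.mem_one.1 h
  simp

lemma eval_pderiv_eq_hess_mulVec {Q : MvPolynomial σ K} (hQ : Q.IsHomogeneous 2) (x : σ → K) (j : σ) :
    eval x (pderiv j Q) = (hess Q *ᵥ x) j := by
  have h := congrArg (eval x) (hQ.pderiv (i := j)).sum_X_mul_pderiv
  simp only [map_sum, map_mul, eval_X, Nat.add_one_sub_one, one_smul] at h
  rw [← h, mulVec, dotProduct]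
  refine Finset.sum_congr rfl fun i _ => ?_
  rw [mul_comm, hess, Matrix.of_apply, pderiv_comm j i,
    eval_eq_of_isHomogeneous_zero (hQ.pderiv.pderiv) x 0]

lemma two_mul_eval_eq {Q : MvPolynomial σ K} (hQ : Q.IsHomogeneous 2) (x : σ → K) :
    2 * eval x Q = x ⬝ᵥ hess Q *ᵥ x := by
  have h := congrArg (eval x) hQ.sum_X_mul_pderiv
  simp only [map_sum, map_mul, eval_X, eval_pderiv_eq_hess_mulVec hQ, map_nsmul] at h
  rw [dotProduct, h]
  simp

lemma dotProduct_mulVec_comm {M : Matrix σ σ K} (hM : M.IsSymm) (x y : σ → K) :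
    x ⬝ᵥ M *ᵥ y = y ⬝ᵥ M *ᵥ x := by
  rw [dotProduct_mulVec, ← mulVec_transpose, hM.eq, dotProduct_comm]

lemma isSymm_toBilin' [DecidableEq σ] {M : Matrix σ σ K} (hM : M.IsSymm) :
    (Matrix.toBilin' M).IsSymm :=
  ⟨fun x y => by
    rw [Matrix.toBilin'_apply', Matrix.toBilin'_apply', dotProduct_mulVec_comm hM]⟩

/-- Polarisation: gradients of `Q` at points of a linear space contained in `Q = 0` annihilate that
space. -/
lemma transpose_mulVec_hess_mulVec [CharZero K] {Q : MvPolynomial τ K} (hQ : Q.IsHomogeneous 2)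
    {w : Matrix τ σ K} (hw : ∀ y, eval (w *ᵥ y) Q = 0) (y : σ → K) :
    wᵀ *ᵥ (hess Q *ᵥ (w *ᵥ y)) = 0 := by
  have h0 : ∀ z, (w *ᵥ z) ⬝ᵥ hess Q *ᵥ (w *ᵥ z) = 0 := fun z => by
    rw [← two_mul_eval_eq hQ, hw, mul_zero]
  refine dotProduct_eq_zero _ fun z => ?_
  have h1 := h0 (y + z)
  rw [mulVec_add, mulVec_add, add_dotProduct, dotProduct_add, dotProduct_add, h0, h0,
    dotProduct_mulVec_comm (hess_isSymm Q) (w *ᵥ y), zero_add, add_zero, ← two_mul] at h1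
  rw [mulVec_transpose, ← dotProduct_mulVec, dotProduct_comm]
  simpa using h1

end Hessian

lemma isHomogeneous_quadrics (c : Param) (k : Fin 3) : (quadrics c k).IsHomogeneous 2 := by
  refine IsHomogeneous.sum _ _ _ fun s _ => IsHomogeneous.C_mul ?_ _
  induction s using Sym2.ind with
  | _ i j => exact (isHomogeneous_X ℂ i).mul (isHomogeneous_X ℂ j)

/-- A pencil of `3 × 4` matrices meets each quadric in `ℙ³` in the kernel of some member. -/
theorem exists_pencil_kernel_zero {K : Type*} [Field K] [IsAlgClosed K]
    (A : Fin 2 → Matrix (Fin 3) (Fin 4) K) {B : Matrix (Fin 4) (Fin 4) K} (hB : B.IsSymm) :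
    ∃ s : Fin 2 → K, s ≠ 0 ∧ ∃ x : Fin 4 → K, x ≠ 0 ∧ (s 0 • A 0 + s 1 • A 1) *ᵥ x = 0 ∧
      x ⬝ᵥ B *ᵥ x = 0 := by
  let M : (Fin 2 → K) → Matrix (Fin 3) (Fin 4) K := fun s => s 0 • A 0 + s 1 • A 1
  let MX : Matrix (Fin 3) (Fin 4) (MvPolynomial (Fin 2) K) :=
    (X 0 : MvPolynomial (Fin 2) K) • (A 0).map C + (X 1 : MvPolynomial (Fin 2) K) • (A 1).map C
  -- A null vector `(x, z)` of the bordered matrix satisfies `M s x = 0` and `B x = -(M s)ᵀ z`, so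
  -- `x` is isotropic for `B`. The determinant has degree 6 in `s`, since three rows and three
  -- columns scale.
  let f : MvPolynomial (Fin 2) K := (fromBlocks (B.map C) MXᵀ MX 0).det
  have hf : ∀ s, eval s f = (fromBlocks B (M s)ᵀ (M s) 0).det := by
    intro s
    rw [RingHom.map_det]
    congr 1
    ext i j
    rcases i with i | i <;> rcases j with j | j <;> simp [MX, M]
  have hsc : ∀ (t : K) (s : Fin 2 → K), eval (t • s) f = t ^ 6 * eval s f := by
    intro t s
    rw [hf, hf]
    have hM : M (t • s) = t • M s := by simp [M, mul_smul]
    have : fromBlocks B (M (t • s))ᵀ (M (t • s)) 0 =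
        fromBlocks (1 : Matrix (Fin 4) (Fin 4) K) 0 0 (t • (1 : Matrix (Fin 3) (Fin 3) K)) *
          fromBlocks B (M s)ᵀ (M s) 0 * fromBlocks 1 0 0 (t • 1) := by
      simp [fromBlocks_multiply, hM]
    rw [this, det_mul, det_mul, det_fromBlocks_zero₂₁]
    simp
    ring
  obtain ⟨s, hs, hfs⟩ := exists_binary_zero f (n := 6) (by norm_num) hsc
  refine ⟨s, hs, ?_⟩
  rw [hf, ← exists_mulVec_eq_zero_iff] at hfs
  obtain ⟨v, hv, hv0⟩ := hfs
  obtain ⟨x, z, rfl⟩ : ∃ x z, v = Sum.elim x z := ⟨v ∘ Sum.inl, v ∘ Sum.inr, by simp⟩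
  rw [fromBlocks_mulVec] at hv0
  have h1 : B *ᵥ x + (M s)ᵀ *ᵥ z = 0 := funext fun i => by simpa using congrFun hv0 (Sum.inl i)
  have h2 : M s *ᵥ x = 0 := funext fun i => by simpa using congrFun hv0 (Sum.inr i)
  -- If only `z` is nonzero, `M s` has rank at most two; its kernel then has dimension at least two
  -- and contains an isotropic vector of `B`.
  by_cases hx : x = 0
  · subst hx
    rw [mulVec_zero, zero_add] at h1
    have hz : z ≠ 0 := by
      rintro rfl
      exact hv (by ext i; rcases i with i | i <;> rfl)
    have r1 := (M s)ᵀ.mulVecLin.finrank_range_add_finrank_ker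
    have r2 := (M s).mulVecLin.finrank_range_add_finrank_ker
    have r3 : (M s)ᵀ.rank = (M s).rank := rank_transpose _
    have r4 : 0 < Module.finrank K (LinearMap.ker (M s)ᵀ.mulVecLin) := by
      rw [Module.finrank_pos_iff_exists_ne_zero]
      exact ⟨⟨z, h1⟩, fun h => hz (congrArg Subtype.val h)⟩
    simp only [Module.finrank_fin_fun] at r1 r2
    unfold Matrix.rank at r3
    obtain ⟨x, hxk, hx0, hxx⟩ := exists_isotropic_vector (Matrix.toBilin' B) (isSymm_toBilin' hB)
      (U := LinearMap.ker (M s).mulVecLin) (by omega)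
    exact ⟨x, hx0, hxk, by simpa [Matrix.toBilin'_apply'] using hxx⟩
  · refine ⟨x, hx, h2, ?_⟩
    rw [eq_neg_of_add_eq_zero_left h1, dotProduct_neg, dotProduct_mulVec, vecMul_transpose, h2,
      zero_dotProduct, neg_zero]

/-- Two quadrics in `ℙ³` meet. -/
theorem exists_common_zero_of_two_quadrics {K : Type*} [Field K] [IsAlgClosed K]
    {A B : Matrix (Fin 4) (Fin 4) K} (hA : A.IsSymm) (hB : B.IsSymm) :
    ∃ x : Fin 4 → K, x ≠ 0 ∧ x ⬝ᵥ A *ᵥ x = 0 ∧ x ⬝ᵥ B *ᵥ x = 0 := by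
  obtain ⟨W, -, hW, hiso⟩ := exists_isotropic_subspace (Matrix.toBilin' A) (isSymm_toBilin' hA)
    (W₀ := ⊥) (m := 2) (by intro x hx; simp [(Submodule.mem_bot K).1 hx]) (by simp) (by simp)
  obtain ⟨x, hxW, hx, hxx⟩ := exists_isotropic_vector (Matrix.toBilin' B) (isSymm_toBilin' hB) hW.ge
  exact ⟨x, hx, by simpa [Matrix.toBilin'_apply'] using hiso x hxW x hxW,
    by simpa [Matrix.toBilin'_apply'] using hxx⟩

/-! ### Members of the net through a 3-space -/

section Cut

lemma finrank_ker_transpose {w : Matrix (Fin 7) (Fin 4) ℂ} {u : Matrix (Fin 4) (Fin 7) ℂ}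
    (huw : u * w = 1) : Module.finrank ℂ (LinearMap.ker wᵀ.mulVecLin) = 3 := by
  have h1 := wᵀ.mulVecLin.finrank_range_add_finrank_ker
  have h2 : LinearMap.range wᵀ.mulVecLin = ⊤ := by
    rw [LinearMap.range_eq_top]
    intro y
    refine ⟨uᵀ *ᵥ y, ?_⟩
    rw [mulVecLin_apply, mulVec_mulVec, ← transpose_mul, huw, transpose_one, one_mulVec]
  rw [h2, finrank_top, Module.finrank_fin_fun, Module.finrank_fin_fun] at h1
  omega

lemma mulVec_ne_zero_of_leftInverse {m n : Type*} [Fintype m] [Fintype n] [DecidableEq n]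
    {w : Matrix m n ℂ} {u : Matrix n m ℂ} (huw : u * w = 1) {x : n → ℂ} (hx : x ≠ 0) :
    w *ᵥ x ≠ 0 := by
  intro h
  apply hx
  rw [← one_mulVec x, ← huw, ← mulVec_mulVec, h, mulVec_zero]

lemma eval_eq_zero_iff_hess {σ : Type*} [Fintype σ] {Q : MvPolynomial σ ℂ} (hQ : Q.IsHomogeneous 2)
    (x : σ → ℂ) : eval x Q = 0 ↔ x ⬝ᵥ hess Q *ᵥ x = 0 := by
  rw [← two_mul_eval_eq hQ]
  simp

/-- A quadric in `ℙ⁶` that contains a `3`-space is singular. -/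
lemma rank_hess_le_six {Q : CoordRing} (hQ : Q.IsHomogeneous 2) {w : Matrix (Fin 7) (Fin 4) ℂ}
    {u : Matrix (Fin 4) (Fin 7) ℂ} (huw : u * w = 1) (hw : ∀ y, eval (w *ᵥ y) Q = 0) :
    (hess Q).rank ≤ 6 := by
  -- The gradient sends the 4-dimensional image of `w` into its 3-dimensional annihilator, so the
  -- Hessian kills a nonzero vector.
  let a : (Fin 4 → ℂ) →ₗ[ℂ] LinearMap.ker wᵀ.mulVecLin :=
    ((hess Q).mulVecLin ∘ₗ w.mulVecLin).codRestrict _ fun y =>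
      transpose_mulVec_hess_mulVec hQ hw y
  have h1 : LinearMap.ker a ≠ ⊥ := LinearMap.ker_ne_bot_of_finrank_lt (by
    rw [finrank_ker_transpose huw, Module.finrank_fin_fun]; norm_num)
  obtain ⟨y, hy, hy0⟩ := Submodule.exists_mem_ne_zero_of_ne_bot h1
  have h2 : hess Q *ᵥ (w *ᵥ y) = 0 := congrArg Subtype.val hy
  have h3 := (hess Q).mulVecLin.finrank_range_add_finrank_ker
  have h4 : 0 < Module.finrank ℂ (LinearMap.ker (hess Q).mulVecLin) := by
    rw [Module.finrank_pos_iff_exists_ne_zero]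
    exact ⟨⟨w *ᵥ y, h2⟩, fun h => mulVec_ne_zero_of_leftInverse huw hy0 (congrArg Subtype.val h)⟩
  rw [Module.finrank_fin_fun] at h3
  unfold Matrix.rank
  omega

/-- At most one member of the net of a `V₈` contains a given `3`-space. -/
theorem finrank_ker_restrict_le_one {c : Param} (hc : IsV8 c) {w : Matrix (Fin 7) (Fin 4) ℂ}
    {u : Matrix (Fin 4) (Fin 7) ℂ} (huw : u * w = 1) :
    Module.finrank ℂ (LinearMap.ker
      (Fintype.linearCombination ℂ fun k => pullback w (quadrics c k))) ≤ 1 := by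
  set L := Fintype.linearCombination ℂ fun k => pullback w (quadrics c k) with hL
  have hLs : ∀ s : Fin 3 → ℂ, pullback w (∑ k, C (s k) * quadrics c k) = L s := fun s => by
    rw [hL, Fintype.linearCombination_apply, map_sum]
    refine Finset.sum_congr rfl fun k _ => ?_
    rw [map_mul, algHom_C, smul_eq_C_mul]
    rfl
  by_contra hcon
  push Not at hcon
  have h1 := L.finrank_range_add_finrank_ker
  rw [Module.finrank_fin_fun] at h1
  -- With a kernel of dimension at least two, the restricted net is spanned by one form `g`,
  -- possibly zero, and every zero of `g` in the 3-space is a point of `V`.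
  obtain ⟨g, hg⟩ := (finrank_le_one_iff (K := ℂ) (V := LinearMap.range L)).1 (by omega)
  obtain ⟨t, ht⟩ := exists_linearIndependent_of_le_finrank (show 2 ≤ _ from hcon)
  have hhom : ∀ s, (L s).IsHomogeneous 2 := fun s => by
    rw [hL, Fintype.linearCombination_apply]
    refine (homogeneousSubmodule (Fin 4) ℂ 2).sum_mem fun k _ => Submodule.smul_mem _ _ ?_
    exact isHomogeneous_pullback w (isHomogeneous_quadrics c k)
  obtain ⟨s₀, hs₀⟩ := g.2
  have hg2 : (g : MvPolynomial (Fin 4) ℂ).IsHomogeneous 2 := hs₀ ▸ hhom s₀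
  have hgk : ∀ k, ∃ r : ℂ, r • (g : MvPolynomial (Fin 4) ℂ) = pullback w (quadrics c k) := by
    intro k
    obtain ⟨r, hr⟩ := hg ⟨L (Pi.single k 1), ⟨_, rfl⟩⟩
    refine ⟨r, (congrArg Subtype.val hr).trans ?_⟩
    simp [hL, Fintype.linearCombination_apply_single]
  let Q : Fin 2 → CoordRing := fun i => ∑ k, C ((t i : Fin 3 → ℂ) k) * quadrics c k
  have hQ2 : ∀ i, (Q i).IsHomogeneous 2 := fun i =>
    IsHomogeneous.sum _ _ _ fun k _ => (isHomogeneous_quadrics c k).C_mul _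
  have hQw : ∀ i y, eval (w *ᵥ y) (Q i) = 0 := by
    intro i y
    rw [← eval_pullback]
    have h2 : L (t i) = 0 := (t i).2
    rw [show pullback w (Q i) = L (t i) from hLs _, h2, map_zero]
  let e : LinearMap.ker wᵀ.mulVecLin ≃ₗ[ℂ] (Fin 3 → ℂ) :=
    LinearEquiv.ofFinrankEq _ _ (by rw [finrank_ker_transpose huw, Module.finrank_fin_fun])
  let α : Fin 2 → (Fin 4 → ℂ) →ₗ[ℂ] LinearMap.ker wᵀ.mulVecLin := fun i =>
    ((hess (Q i)).mulVecLin ∘ₗ w.mulVecLin).codRestrict _ fun y =>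
      transpose_mulVec_hess_mulVec (hQ2 i) (hQw i) y
  -- The matrices are the gradient maps of `Q 0` and `Q 1`, in coordinates of the annihilator. The
  -- point `w *ᵥ x` lies on `V`, and the combination `s` of the two gradients vanishes there.
  obtain ⟨s, hs, x, hx, hAx, hBx⟩ := exists_pencil_kernel_zero
    (fun i => LinearMap.toMatrix' (e.toLinearMap ∘ₗ α i))
    (hess_isSymm (g : MvPolynomial (Fin 4) ℂ))
  rw [← eval_eq_zero_iff_hess hg2] at hBx
  rw [add_mulVec, smul_mulVec, smul_mulVec, LinearMap.toMatrix'_mulVec,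
    LinearMap.toMatrix'_mulVec] at hAx
  have h4 : s 0 • α 0 x + s 1 • α 1 x = 0 := by
    apply e.injective
    rw [map_add, map_smul, map_smul, map_zero]
    exact hAx
  have h5 : s 0 • (hess (Q 0) *ᵥ (w *ᵥ x)) + s 1 • (hess (Q 1) *ᵥ (w *ᵥ x)) = 0 :=
    congrArg Subtype.val h4
  have hx0 : ∀ k, eval (w *ᵥ x) (quadrics c k) = 0 := fun k => by
    obtain ⟨r, hr⟩ := hgk k
    rw [← eval_pullback, ← hr, smul_eval, hBx, mul_zero]
  have hind := hc (w *ᵥ x) (mulVec_ne_zero_of_leftInverse huw hx) hx0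
  rw [Fintype.linearIndependent_iff] at hind
  have h6 : ∀ i, hess (Q i) *ᵥ (w *ᵥ x) =
      ∑ k, (t i : Fin 3 → ℂ) k • gradAt (quadrics c k) (w *ᵥ x) := by
    intro i
    rw [hess_sum_C_mul, sum_mulVec]
    refine Finset.sum_congr rfl fun k _ => ?_
    rw [smul_mulVec]
    congr 1
    funext j
    exact (eval_pderiv_eq_hess_mulVec (isHomogeneous_quadrics c k) _ j).symm
  have h7 := hind (s 0 • (t 0 : Fin 3 → ℂ) + s 1 • (t 1 : Fin 3 → ℂ)) (by
    rw [← h5, h6, h6, Finset.smul_sum, Finset.smul_sum, ← Finset.sum_add_distrib]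
    refine Finset.sum_congr rfl fun k _ => ?_
    simp [add_smul, mul_smul])
  rw [Fintype.linearIndependent_iff] at ht
  refine hs (funext (ht s ?_))
  rw [Fin.sum_univ_two]
  exact Subtype.ext (funext h7)

lemma exists_C_of_mem_span_pair {σ : Type*} {a b f : MvPolynomial σ ℂ} {d : ℕ}
    (ha : a.IsHomogeneous d) (hb : b.IsHomogeneous d) (hf : f.IsHomogeneous d)
    (h : f ∈ Ideal.span {a} ⊔ Ideal.span {b}) : ∃ s t : ℂ, f = s • a + t • b := by
  obtain ⟨p, hp, q, hq, rfl⟩ := Submodule.mem_sup.1 h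
  obtain ⟨p, rfl⟩ := Ideal.mem_span_singleton'.1 hp
  obtain ⟨q, rfl⟩ := Ideal.mem_span_singleton'.1 hq
  refine ⟨coeff 0 p, coeff 0 q, ?_⟩
  have h1 := homogeneousComponent_add_mul ha 0 p
  have h2 := homogeneousComponent_add_mul hb 0 q
  rw [zero_add, homogeneousComponent_zero] at h1 h2
  rw [← homogeneousComponent_eq_self hf, map_add, h1, h2, smul_eq_C_mul, smul_eq_C_mul]

/-- A complete intersection of two quadrics in a `3`-space that lies on a `V₈` is cut out by the
`3`-space, which lies in a member of the net. -/
theorem exists_mem_net_of_le {c : Param} (hc : IsV8 c) {w : Matrix (Fin 7) (Fin 4) ℂ}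
    {u : Matrix (Fin 4) (Fin 7) ℂ} (huw : u * w = 1) {a b : MvPolynomial (Fin 4) ℂ}
    (ha : a.IsHomogeneous 2) (hb : b.IsHomogeneous 2)
    (hle : idealV c ≤ (Ideal.span {a} ⊔ Ideal.span {b}).comap (pullback w)) :
    ∃ Q ∈ net c, Q ≠ 0 ∧ quadricRank Q ≤ 6 ∧ (∀ y, eval (w *ᵥ y) Q = 0) ∧
      (Ideal.span {a} ⊔ Ideal.span {b}).comap (pullback w) =
        idealV c ⊔ RingHom.ker (pullback w) := by
  have hker := finrank_ker_restrict_le_one hc huw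
  set L := Fintype.linearCombination ℂ fun k => pullback w (quadrics c k) with hL
  have hLs : ∀ s : Fin 3 → ℂ, pullback w (∑ k, C (s k) * quadrics c k) = L s := fun s => by
    rw [hL, Fintype.linearCombination_apply, map_sum]
    refine Finset.sum_congr rfl fun k _ => ?_
    rw [map_mul, algHom_C, smul_eq_C_mul]
    rfl
  have hqmem : ∀ k, pullback w (quadrics c k) ∈ Submodule.span ℂ {a, b} := by
    intro k
    obtain ⟨s, t, h⟩ := exists_C_of_mem_span_pair ha hb
      (isHomogeneous_pullback w (isHomogeneous_quadrics c k))
      (hle (Ideal.subset_span ⟨k, rfl⟩))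
    exact Submodule.mem_span_pair.2 ⟨s, t, h.symm⟩
  have hrange : LinearMap.range L ≤ Submodule.span ℂ {a, b} := by
    rw [hL, Fintype.range_linearCombination, Submodule.span_le]
    rintro _ ⟨k, rfl⟩
    exact hqmem k
  have h1 := L.finrank_range_add_finrank_ker
  rw [Module.finrank_fin_fun] at h1
  have hfin : FiniteDimensional ℂ (Submodule.span ℂ {a, b}) :=
    FiniteDimensional.span_of_finite ℂ (Set.toFinite _)
  have h2 : Module.finrank ℂ (Submodule.span ℂ {a, b}) ≤ 2 := by
    classical
    refine (finrank_span_le_card _).trans ?_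
    rw [Set.toFinset_insert, Set.toFinset_singleton]
    exact Finset.card_le_two
  -- A kernel of dimension at most one leaves an image of dimension at least two, which fills the
  -- span of `a` and `b`.
  have h3 := Submodule.eq_of_le_of_finrank_le hrange (by omega)
  have h4 := Submodule.finrank_mono hrange
  have h5 : LinearMap.ker L ≠ ⊥ := fun h => by rw [h, finrank_bot] at h1; omega
  obtain ⟨s, hs, hs0⟩ := Submodule.exists_mem_ne_zero_of_ne_bot h5
  let Q : CoordRing := ∑ k, C (s k) * quadrics c k
  have hQ2 : Q.IsHomogeneous 2 :=
    IsHomogeneous.sum _ _ _ fun k _ => (isHomogeneous_quadrics c k).C_mul _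
  have hQw : ∀ y, eval (w *ᵥ y) Q = 0 := by
    intro y
    rw [← eval_pullback, show pullback w Q = L s from hLs s, show L s = 0 from hs, map_zero]
  refine ⟨Q, ?_, ?_, rank_hess_le_six hQ2 huw hQw, hQw, ?_⟩
  · refine sum_mem fun k _ => ?_
    rw [← smul_eq_C_mul]
    exact Submodule.smul_mem _ _ (Submodule.subset_span ⟨k, rfl⟩)
  -- `Q = 0` would be a linear relation among the three forms. A common zero of `a` and `b` is a
  -- point of `V`, where this relation would make the gradients dependent.
  · intro hQ0
    obtain ⟨x, hx, hxa, hxb⟩ := exists_common_zero_of_two_quadrics (hess_isSymm a) (hess_isSymm b)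
    rw [← eval_eq_zero_iff_hess ha] at hxa
    rw [← eval_eq_zero_iff_hess hb] at hxb
    have hind := hc (w *ᵥ x) (mulVec_ne_zero_of_leftInverse huw hx) fun k => by
      obtain ⟨r, t, h⟩ := Submodule.mem_span_pair.1 (hqmem k)
      rw [← eval_pullback, ← h, map_add, smul_eval, smul_eval, hxa, hxb]
      simp
    rw [Fintype.linearIndependent_iff] at hind
    refine hs0 (funext (hind s ?_))
    funext j
    have := congrArg (fun q => gradAt q (w *ᵥ x) j) hQ0
    simpa [Q, gradAt] using this
  · have hsurj : Function.Surjective (pullback w) := fun f => ⟨pullback u f, pullback_pullback huw f⟩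
    have hmap : (idealV c).map (pullback w) = Ideal.span {a} ⊔ Ideal.span {b} := by
      apply le_antisymm
      · rwa [Ideal.map_le_iff_le_comap]
      · have hmem : ∀ f ∈ Submodule.span ℂ {a, b}, f ∈ (idealV c).map (pullback w) := by
          intro f hf
          rw [← h3] at hf
          obtain ⟨t, rfl⟩ := hf
          rw [hL, Fintype.linearCombination_apply]
          refine sum_mem fun k _ => ?_
          rw [smul_eq_C_mul]
          exact Ideal.mul_mem_left _ _ (Ideal.mem_map_of_mem _ (Ideal.subset_span ⟨k, rfl⟩))
        exact sup_le ((Ideal.span_singleton_le_iff_mem _).2 (hmem a (Submodule.subset_span (by simp))))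
          ((Ideal.span_singleton_le_iff_mem _).2 (hmem b (Submodule.subset_span (by simp))))
    rw [← hmap, Ideal.comap_map_of_surjective _ hsurj]
    rfl

end Cut
end FanoV8
namespace FanoV8
open MvPolynomial Matrix

/-! ### Elliptic quartics on an arbitrary V₈ -/

section EllipticQuartic

lemma linIdeal_range (w : Matrix (Fin 7) (Fin 4) ℂ) :
    linIdeal (LinearMap.range w.mulVecLin) = RingHom.ker (pullback w) := by
  ext f
  rw [linIdeal, mem_vanishingIdeal_iff, RingHom.mem_ker]
  constructor
  · intro h
    apply MvPolynomial.funext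
    intro y
    rw [eval_pullback, map_zero]
    simpa [aeval_eq_eval] using h (w *ᵥ y) ⟨y, rfl⟩
  · rintro h _ ⟨y, rfl⟩
    rw [mulVecLin_apply, aeval_eq_eval]
    exact (eval_pullback w f y).symm.trans (by rw [h, map_zero])

lemma finrank_range_mulVecLin {w : Matrix (Fin 7) (Fin 4) ℂ} {u : Matrix (Fin 4) (Fin 7) ℂ}
    (huw : u * w = 1) : Module.finrank ℂ (LinearMap.range w.mulVecLin) = 4 := by
  rw [LinearMap.finrank_range_of_inj, Module.finrank_fin_fun]
  intro x y hxy
  have := congrArg (u *ᵥ ·) hxy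
  simpa [mulVec_mulVec, huw] using this

lemma exists_matrix_of_finrank_eq_four {W : Submodule ℂ (Fin 7 → ℂ)}
    (hW : Module.finrank ℂ W = 4) :
    ∃ (w : Matrix (Fin 7) (Fin 4) ℂ) (u : Matrix (Fin 4) (Fin 7) ℂ), u * w = 1 ∧
      LinearMap.range w.mulVecLin = W := by
  let e : (Fin 4 → ℂ) ≃ₗ[ℂ] W := LinearEquiv.ofFinrankEq _ _ (by rw [hW, Module.finrank_fin_fun])
  let g : (Fin 4 → ℂ) →ₗ[ℂ] (Fin 7 → ℂ) := W.subtype ∘ₗ e.toLinearMap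
  have hg : LinearMap.ker g = ⊥ := LinearMap.ker_eq_bot.2 (W.injective_subtype.comp e.injective)
  obtain ⟨l, hl⟩ := g.exists_leftInverse_of_injective hg
  refine ⟨LinearMap.toMatrix' g, LinearMap.toMatrix' l, ?_, ?_⟩
  · rw [← LinearMap.toMatrix'_comp, hl, LinearMap.toMatrix'_id]
  · have : (LinearMap.toMatrix' g).mulVecLin = g := LinearMap.toMatrix'.symm_apply_apply g
    rw [this, LinearMap.range_comp, LinearEquiv.range, Submodule.map_top, Submodule.range_subtype]

/-- Elliptic quartics are complete intersections of two quadrics in a `3`-space. -/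
theorem IsEllipticQuartic.exists_eq_comap {I : Ideal CoordRing} (hI : IsEllipticQuartic I) :
    ∃ (w : Matrix (Fin 7) (Fin 4) ℂ) (u : Matrix (Fin 4) (Fin 7) ℂ)
      (a b : MvPolynomial (Fin 4) ℂ), u * w = 1 ∧ a.IsHomogeneous 2 ∧ b.IsHomogeneous 2 ∧
      I = (Ideal.span {a} ⊔ Ideal.span {b}).comap (pullback w) := by
  rcases hI with h | ⟨W, a, b, hW, ha, hb, hI, -⟩
  · have := h.prime
    refine exists_eq_comap_span_pair h.homogeneous ?_
    filter_upwards [h.hilbert] with n hn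
    change hilbertFn I n = 4 * n
    push_cast at hn
    omega
  · obtain ⟨w, u, huw, rfl⟩ := exists_matrix_of_finrank_eq_four hW
    refine ⟨w, u, pullback w a, pullback w b, huw, isHomogeneous_pullback w ha,
      isHomogeneous_pullback w hb, ?_⟩
    have hsurj : Function.Surjective (pullback w) := fun f => ⟨pullback u f, pullback_pullback huw f⟩
    have h1 : Ideal.span {pullback w a} ⊔ Ideal.span {pullback w b} =
        (Ideal.span {a, b}).map (pullback w) := by
      rw [Ideal.map_span, Set.image_pair, Ideal.span_insert]
    rw [h1, Ideal.comap_map_of_surjective _ hsurj, hI, linIdeal_range, sup_comm]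
    rfl

/-- Elliptic quartics on an arbitrary `V₈`. -/
theorem exists_quadric_of_isEllipticQuartic {c : Param} (hc : IsV8 c) {I : Ideal CoordRing}
    (hle : idealV c ≤ I) (hI : IsEllipticQuartic I) :
    ∃ Q ∈ net c, Q ≠ 0 ∧ quadricRank Q ≤ 6 ∧ IsCutOutInside c I Q := by
  obtain ⟨w, u, a, b, huw, ha, hb, rfl⟩ := hI.exists_eq_comap
  obtain ⟨Q, hQ, hQ0, hrk, hQw, heq⟩ := exists_mem_net_of_le hc huw ha hb hle
  refine ⟨Q, hQ, hQ0, hrk, LinearMap.range w.mulVecLin, finrank_range_mulVecLin huw, ?_, ?_⟩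
  · rintro _ ⟨y, rfl⟩
    exact hQw y
  · rw [heq, linIdeal_range]

end EllipticQuartic
end FanoV8
namespace FanoV8
open MvPolynomial Matrix

/-! ### Coefficients and Hessians of the net -/

section Param

/-- The Hessian matrix of a quadratic form in terms of its coefficients. -/
def coeffHess {R : Type*} [CommRing R] (c : Fin 3 × Sym2 (Fin 7) → R) (k : Fin 3) :
    Matrix (Fin 7) (Fin 7) R :=
  Matrix.of fun i j => c (k, s(i, j)) * if i = j then 2 else 1

lemma hess_mul_X (s : Sym2 (Fin 7)) (i j : Fin 7) :
    hess ((s.map (X : Fin 7 → CoordRing)).mul) i j =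
      if s = s(i, j) then (if i = j then 2 else 1) else 0 := by
  induction s using Sym2.ind with
  | _ a b =>
    have h1 : ((s(a, b).map (X : Fin 7 → CoordRing)).mul) = X a * X b := rfl
    rw [h1, hess, Matrix.of_apply]
    simp only [pderiv_mul, pderiv_X, map_add, map_mul, eval_X, Pi.single_apply, apply_ite, map_one,
      map_zero, Sym2.eq_iff]
    simp
    grind

lemma hess_quadrics (c : Param) (k : Fin 3) : hess (quadrics c k) = coeffHess c k := by
  ext i j
  rw [quadrics, hess_sum_C_mul, Matrix.sum_apply]
  simp [hess_mul_X, coeffHess]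

lemma coeffHess_map {R S : Type*} [CommRing R] [CommRing S] (f : R →+* S)
    (c : Fin 3 × Sym2 (Fin 7) → R) (k : Fin 3) (i j : Fin 7) :
    f (coeffHess c k i j) = coeffHess (fun p => f (c p)) k i j := by
  by_cases h : i = j <;> simp [coeffHess, h, map_ofNat f 2]

lemma gradAt_quadrics (c : Param) (k : Fin 3) (x : Fin 7 → ℂ) :
    gradAt (quadrics c k) x = coeffHess c k *ᵥ x := by
  funext j
  rw [gradAt, eval_pderiv_eq_hess_mulVec (isHomogeneous_quadrics c k) x j, hess_quadrics]

lemma eval_quadrics_eq_zero_iff (c : Param) (k : Fin 3) (x : Fin 7 → ℂ) :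
    eval x (quadrics c k) = 0 ↔ x ⬝ᵥ coeffHess c k *ᵥ x = 0 := by
  rw [eval_eq_zero_iff_hess (isHomogeneous_quadrics c k), hess_quadrics]

end Param

lemma isHomogeneous_det {σ R n : Type*} [CommRing R] [Fintype n] [DecidableEq n]
    {M : Matrix n n (MvPolynomial σ R)} (hM : ∀ i j, (M i j).IsHomogeneous 1) :
    M.det.IsHomogeneous (Fintype.card n) := by
  rw [det_apply]
  refine IsHomogeneous.sum _ _ _ fun e _ => ?_
  have h : (∏ i, M (e i) i).IsHomogeneous (Fintype.card n) := by
    simpa using IsHomogeneous.prod Finset.univ (fun i => M (e i) i) (fun _ => 1)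
      fun i _ => hM _ _
  rcases Int.units_eq_one_or (Equiv.Perm.sign e) with he | he <;> rw [he]
  · simpa using h
  · simpa using h.neg

/-! ### Openness of smoothness -/

section Smooth

/-- Smooth complete intersections of three quadrics form an open set. -/
theorem exists_ne_zero_forall_isV8 :
    ∃ F : MvPolynomial (Fin 3 × Sym2 (Fin 7)) ℂ, F ≠ 0 ∧ ∀ c, eval c F ≠ 0 → IsV8 c := by
  let R := MvPolynomial (Fin 3 × Sym2 (Fin 7)) ℂ
  let H : Fin 3 → Matrix (Fin 7) (Fin 7) R := coeffHess X
  let g : Fin 3 → Fin 7 → MvPolynomial (Fin 7) R := fun k j => ∑ i, C (H k j i) * X i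
  -- The three equations with all 3 × 3 minors of the Jacobian: a nontrivial common zero is a point
  -- where the gradients are dependent.
  let f : Fin 3 ⊕ (Fin 3 → Fin 7) → MvPolynomial (Fin 7) R :=
    Sum.elim (fun k => ∑ j, X j * g k j) (fun e => (Matrix.of fun k l => g k (e l)).det)
  have hg : ∀ k j, (g k j).IsHomogeneous 1 := fun k j =>
    IsHomogeneous.sum _ _ _ fun i _ => isHomogeneous_C_mul_X _ _
  have hge : ∀ (c : Param) (x : Fin 7 → ℂ) k j,
      eval x (map (eval c) (g k j)) = (coeffHess c k *ᵥ x) j := by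
    intro c x k j
    simp [g, H, mulVec, dotProduct, coeffHess_map]
  have hfq : ∀ (c : Param) (x : Fin 7 → ℂ) k,
      eval x (map (eval c) (f (Sum.inl k))) = x ⬝ᵥ coeffHess c k *ᵥ x := by
    intro c x k
    simp only [f, Sum.elim_inl, map_sum, map_mul, map_X, eval_X, hge]
    rfl
  have hfd : ∀ (c : Param) (x : Fin 7 → ℂ) e,
      eval x (map (eval c) (f (Sum.inr e))) =
        (Matrix.of fun k l => (coeffHess c k *ᵥ x) (e l)).det := by
    intro c x e
    simp only [f, Sum.elim_inr]
    rw [RingHom.map_det, RingHom.map_det]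
    congr 1
    ext k l
    simp [hge]
  -- The forms `∑ i ^ k * x i ^ 2` for `k = 0, 1, 2`. Up to sign a minor is 8 times a Vandermonde
  -- determinant times three coordinates, so a singular point has at most two nonzero coordinates,
  -- which the first two equations exclude.
  let c₀ : Param := fun p => Sym2.lift ⟨fun i j : Fin 7 => if i = j then ((i : ℕ) : ℂ) ^ (p.1 : ℕ) else 0,
    fun i j => by by_cases h : i = j <;> simp [h, eq_comm]⟩ p.2
  have hc₀ : ∀ k (x : Fin 7 → ℂ) j, (coeffHess c₀ k *ᵥ x) j = 2 * ((j : ℕ) : ℂ) ^ (k : ℕ) * x j := by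
    intro k x j
    rw [mulVec, dotProduct, Finset.sum_eq_single j]
    · simp [coeffHess, c₀, mul_comm]
    · intro b _ hb
      simp [coeffHess, c₀, hb.symm]
    · simp
  obtain ⟨F, hF, hFc⟩ := exists_ne_zero_forall_eq_zero f (Sum.elim (fun _ => 2) (fun _ => 3)) (by
      rintro (k | e)
      · exact IsHomogeneous.sum _ _ _ fun j _ => (isHomogeneous_X R j).mul (hg k j)
      · exact isHomogeneous_det fun k l => hg k (e l)) c₀ (by
      intro x hx
      have hq : ∀ k : Fin 3, ∑ j : Fin 7, ((j : ℕ) : ℂ) ^ (k : ℕ) * x j ^ 2 = 0 := by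
        intro k
        have h1 := hx (Sum.inl k)
        rw [hfq, dotProduct] at h1
        simp only [hc₀] at h1
        have h2 : 2 * ∑ j : Fin 7, ((j : ℕ) : ℂ) ^ (k : ℕ) * x j ^ 2 = 0 := by
          rw [← h1, Finset.mul_sum]
          exact Finset.sum_congr rfl fun j _ => by ring
        simpa using h2
      have hm : ∀ i j l : Fin 7, i ≠ j → i ≠ l → j ≠ l → x i ≠ 0 → x j ≠ 0 → x l = 0 := by
        intro i j l hij hil hjl hi hj
        have h1 := hx (Sum.inr ![i, j, l])
        rw [hfd, det_fin_three] at h1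
        simp only [Matrix.of_apply, hc₀, cons_val] at h1
        have hij' : ((i : ℕ) : ℂ) - j ≠ 0 := by
          rw [sub_ne_zero]; exact_mod_cast fun h : (i : ℕ) = j => hij (Fin.ext h)
        have hil' : ((i : ℕ) : ℂ) - l ≠ 0 := by
          rw [sub_ne_zero]; exact_mod_cast fun h : (i : ℕ) = l => hil (Fin.ext h)
        have hjl' : ((j : ℕ) : ℂ) - l ≠ 0 := by
          rw [sub_ne_zero]; exact_mod_cast fun h : (j : ℕ) = l => hjl (Fin.ext h)
        have h2 : (((i : ℕ) : ℂ) - j) * ((i : ℂ) - l) * ((j : ℂ) - l) * x i * x j * x l = 0 := by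
          simp only [Fin.coe_ofNat_eq_mod, Nat.zero_mod, pow_zero, Nat.one_mod, pow_one] at h1
          norm_num at h1
          linear_combination (-1 / 8) * h1
        simpa [hij', hil', hjl', hi, hj] using h2
      by_contra hne
      obtain ⟨p, hp⟩ := Function.ne_iff.1 hne
      have hp : x p ≠ 0 := hp
      by_cases hr : ∃ r, r ≠ p ∧ x r ≠ 0
      · obtain ⟨r, hrp, hr⟩ := hr
        have hz : ∀ j, j ≠ p ∧ j ≠ r → x j = 0 := fun j hj =>
          hm p r j hrp.symm hj.1.symm hj.2.symm hp hr
        have h0 := hq 0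
        have h1 := hq 1
        rw [Fintype.sum_eq_add p r hrp.symm fun j hj => by simp [hz j hj]] at h0 h1
        have hpr : ((p : ℕ) : ℂ) - r ≠ 0 := by
          rw [sub_ne_zero]; exact_mod_cast fun h : (p : ℕ) = r => hrp (Fin.ext h.symm)
        have h2 : (((p : ℕ) : ℂ) - r) * x p ^ 2 = 0 := by
          simp at h0 h1
          linear_combination h1 - (r : ℂ) * h0
        simp [hpr, hp] at h2
      · push Not at hr
        have h0 := hq 0
        rw [Fintype.sum_eq_single p fun j hj => by simp [hr j hj]] at h0
        simp [hp] at h0)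
  refine ⟨F, fun h => hF (by rw [h, map_zero]), fun c hc x hx0 hx => ?_⟩
  by_contra hind
  refine hx0 (hFc c hc x ?_)
  rintro (k | e)
  · rw [hfq, ← eval_quadrics_eq_zero_iff]
    exact hx k
  · rw [hfd, ← exists_vecMul_eq_zero_iff]
    rw [Fintype.linearIndependent_iff] at hind
    push Not at hind
    obtain ⟨t, ht, k, hk⟩ := hind
    refine ⟨t, fun h => hk (congrFun h k), ?_⟩
    funext l
    have := congrFun ht (e l)
    simpa [gradAt_quadrics, vecMul, dotProduct] using this

end Smooth

/-! ### Absence of members of rank below 6 -/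

section Rank

/-- The general net contains no quadric of rank less than six. -/
theorem exists_ne_zero_forall_six_le_rank :
    ∃ F : MvPolynomial (Fin 3 × Sym2 (Fin 7)) ℂ, F ≠ 0 ∧ ∀ c, eval c F ≠ 0 →
      ∀ Q ∈ net c, Q ≠ 0 → 6 ≤ quadricRank Q := by
  let R := MvPolynomial (Fin 3 × Sym2 (Fin 7)) ℂ
  let H : Fin 3 → Matrix (Fin 7) (Fin 7) R := coeffHess X
  let M : Matrix (Fin 7) (Fin 7) (MvPolynomial (Fin 3) R) :=
    Matrix.of fun i j => ∑ k, C (H k i j) * X k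
  let r : Fin 3 → (Fin 6 → Fin 7) × (Fin 6 → Fin 7) :=
    ![(Fin.castSucc, fun j => j.rev.castSucc), (Fin.castSucc, fun j => j.rev.succ),
      (Fin.succ, fun j => j.rev.succ)]
  let f : Fin 3 → MvPolynomial (Fin 3) R := fun l => (M.submatrix (r l).1 (r l).2).det
  have hf : ∀ (c : Param) (s : Fin 3 → ℂ) l, eval s (map (eval c) (f l)) =
      ((∑ k, s k • coeffHess c k).submatrix (r l).1 (r l).2).det := by
    intro c s l
    simp only [f]
    rw [RingHom.map_det, RingHom.map_det]
    congr 1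
    ext i j
    simp [M, H, coeffHess_map, Matrix.sum_apply, mul_comm]
  -- A Hankel net: the Hessian of the member `s` has entry `s 0`, `s 1` or `s 2` where `i + j` is 5,
  -- 6 or 7; the `1 / 2` offsets the doubled diagonal of `coeffHess`. With columns reversed as in
  -- `r`, the outer two minors are triangular with diagonal `s 0` and `s 2`; once these vanish, the
  -- middle one is diagonal with entries `s 1`. The eliminated variables are the coordinates of a
  -- member in the net.
  let c₀ : Param := fun p => Sym2.lift ⟨fun i j : Fin 7 =>
    if (i : ℕ) + j = 5 + (p.1 : ℕ) then (if i = j then 1 / 2 else 1) else 0,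
    fun i j => by simp only [add_comm (i : ℕ), eq_comm (a := i)]⟩ p.2
  have hc₀ : ∀ (k : Fin 3) (i j : Fin 7), coeffHess c₀ k i j = if (i : ℕ) + j = 5 + (k : ℕ) then 1 else 0 := by
    intro k i j
    by_cases h : i = j <;> simp [coeffHess, c₀, h]
  obtain ⟨F, hF, hFc⟩ := exists_ne_zero_forall_eq_zero f (fun _ => 6) (fun l =>
      isHomogeneous_det fun i j => by
        simp only [M, submatrix_apply, of_apply]
        exact IsHomogeneous.sum _ _ _ fun k _ => isHomogeneous_C_mul_X _ _)
      c₀ (by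
      intro s hs
      have h : ∀ l, ((∑ k, s k • coeffHess c₀ k).submatrix (r l).1 (r l).2).det = 0 := fun l =>
        (hf c₀ s l).symm.trans (hs l)
      have hent : ∀ i j, (∑ k, s k • coeffHess c₀ k) i j =
          ∑ k : Fin 3, if (i : ℕ) + j = 5 + (k : ℕ) then s k else 0 := by
        intro i j
        simp [Matrix.sum_apply, hc₀]
      have hone : ∀ (N : Matrix (Fin 6) (Fin 6) ℂ) (t : ℂ), N.det = 0 →
          (N.IsLowerTriangular ∨ N.IsUpperTriangular) → (∀ i, N i i = t) → t = 0 := by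
        intro N t hN htri hd
        have h6 : t ^ 6 = 0 := by
          rcases htri with htri | htri
          · rw [det_of_isLowerTriangular N htri] at hN
            simpa [hd] using hN
          · rw [det_of_isUpperTriangular htri] at hN
            simpa [hd] using hN
        exact pow_eq_zero_iff (by norm_num) |>.1 h6
      have hent' : ∀ i j, (∑ k, s k • coeffHess c₀ k) i j = (if (i : ℕ) + j = 5 then s 0 else 0) +
          (if (i : ℕ) + j = 6 then s 1 else 0) + if (i : ℕ) + j = 7 then s 2 else 0 := by
        intro i j
        rw [hent, Fin.sum_univ_three]
        rfl
      have s0 : s 0 = 0 := by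
        refine hone _ _ (h 0) (Or.inl fun i j hij => ?_) fun i => ?_
        · have hij : (i : ℕ) < j := hij
          change (∑ k, s k • coeffHess c₀ k) i.castSucc j.rev.castSucc = 0
          rw [hent']
          simp only [Fin.val_castSucc, Fin.val_rev]
          grind
        · change (∑ k, s k • coeffHess c₀ k) i.castSucc i.rev.castSucc = _
          rw [hent']
          simp only [Fin.val_castSucc, Fin.val_rev]
          grind
      have s2 : s 2 = 0 := by
        refine hone _ _ (h 2) (Or.inr fun i j hij => ?_) fun i => ?_
        · have hij : (j : ℕ) < i := hij
          change (∑ k, s k • coeffHess c₀ k) i.succ j.rev.succ = 0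
          rw [hent']
          simp only [Fin.val_succ, Fin.val_rev]
          grind
        · change (∑ k, s k • coeffHess c₀ k) i.succ i.rev.succ = _
          rw [hent']
          simp only [Fin.val_succ, Fin.val_rev]
          grind
      have s1 : s 1 = 0 := by
        refine hone _ _ (h 1) (Or.inr fun i j hij => ?_) fun i => ?_
        · have hij : (j : ℕ) < i := hij
          change (∑ k, s k • coeffHess c₀ k) i.castSucc j.rev.succ = 0
          rw [hent', s0, s2]
          simp only [Fin.val_succ, Fin.val_rev, Fin.val_castSucc]
          grind
        · change (∑ k, s k • coeffHess c₀ k) i.castSucc i.rev.succ = _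
          rw [hent', s0, s2]
          simp only [Fin.val_succ, Fin.val_rev, Fin.val_castSucc]
          grind
      funext k
      fin_cases k
      exacts [s0, s1, s2])
  refine ⟨F, fun h => hF (by rw [h, map_zero]), fun c hc Q hQ hQ0 => ?_⟩
  obtain ⟨s, rfl⟩ := (Submodule.mem_span_range_iff_exists_fun ℂ).1 hQ
  have hs : s ≠ 0 := by
    rintro rfl
    simp at hQ0
  have hH : hess (∑ k, s k • quadrics c k) = ∑ k, s k • coeffHess c k := by
    simp only [smul_eq_C_mul, hess_sum_C_mul, hess_quadrics]
  change 6 ≤ (hess _).rank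
  rw [hH]
  by_contra hlt
  refine hs (hFc c hc s fun l => ?_)
  rw [hf]
  by_contra hdet
  have h1 := rank_of_isUnit _ ((isUnit_iff_isUnit_det _).2 (isUnit_iff_ne_zero.2 hdet))
  have h2 := rank_submatrix_le (∑ k, s k • coeffHess c k) (r l).1 (r l).2
  rw [h1, Fintype.card_fin] at h2
  omega

end Rank
end FanoV8
namespace FanoV8
open MvPolynomial Matrix

/-! ### Normality of R[√f] -/

section QuadraticExtension

variable {R K : Type*} [CommRing R] [Field K] [Algebra R K]

/-- Extension of scalars for `R[√f]`. -/
def sqrtMap (K : Type*) [Field K] [Algebra R K] (f : R) :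
    QuadraticAlgebra R f 0 →+* QuadraticAlgebra K (algebraMap R K f) 0 where
  toFun z := ⟨algebraMap R K z.re, algebraMap R K z.im⟩
  map_one' := by ext <;> simp [QuadraticAlgebra.re_one, QuadraticAlgebra.im_one]
  map_mul' x y := by ext <;> simp
  map_zero' := by ext <;> simp
  map_add' x y := by ext <;> simp

/-- Ring homomorphisms out of `R[√f]`. -/
lemma exists_ringHom_sqrt {S : Type*} [CommRing S] (θ : R →+* S) {f : R} {w : S}
    (hw : w * w = θ f) : ∃ F : QuadraticAlgebra R f 0 →+* S,
      ∀ z, F z = θ z.re + θ z.im * w := by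
  let := θ.toAlgebra
  have hw' : w * w = f • (1 : S) + (0 : R) • w := by
    rw [Algebra.smul_def, Algebra.smul_def, RingHom.algebraMap_toAlgebra, hw]
    simp
  refine ⟨(QuadraticAlgebra.lift ⟨w, hw'⟩).toRingHom, fun z => ?_⟩
  change θ z.re • (1 : S) + θ z.im • w = _
  simp

variable [IsFractionRing R K]

lemma sqrtMap_injective (f : R) : Function.Injective (sqrtMap K f) := by
  intro x y h
  have h1 := congrArg QuadraticAlgebra.re h
  have h2 := congrArg QuadraticAlgebra.im h
  exact QuadraticAlgebra.ext (IsFractionRing.injective R K h1) (IsFractionRing.injective R K h2)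

noncomputable instance (f : R) : Algebra (QuadraticAlgebra R f 0)
    (QuadraticAlgebra K (algebraMap R K f) 0) :=
  (sqrtMap K f).toAlgebra

instance (f : R) : IsScalarTower R (QuadraticAlgebra R f 0)
    (QuadraticAlgebra K (algebraMap R K f) 0) :=
  IsScalarTower.of_algebraMap_eq fun x => by
    ext <;> simp [RingHom.algebraMap_toAlgebra, sqrtMap]
    · rfl
    · rfl

/-- `QuadraticAlgebra R f 0` is `R[√f]`, the `0` being the linear coefficient. The `Fact` says that
`f` is no square in `K`, so that `K(√f)` is a field containing this ring. -/
lemma isDomain_sqrt (f : R) [Fact (∀ r, r ^ 2 ≠ algebraMap R K f + 0 * r)] :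
    IsDomain (QuadraticAlgebra R f 0) :=
  (sqrtMap_injective (K := K) f).isDomain (sqrtMap K f)

/-- Under a squarefreeness condition on `f`, the ring `R[√f]` is integrally closed in `K(√f)`. -/
lemma isIntegralClosure_sqrt [IsDomain R] [IsIntegrallyClosed R] (h2 : IsUnit (2 : R)) (f : R)
    [Fact (∀ r, r ^ 2 ≠ algebraMap R K f + 0 * r)]
    (hsq : ∀ k : K, k ^ 2 * algebraMap R K f ∈ (algebraMap R K).range →
      k ∈ (algebraMap R K).range) :
    IsIntegralClosure (QuadraticAlgebra R f 0) R (QuadraticAlgebra K (algebraMap R K f) 0) := by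
  let L := QuadraticAlgebra K (algebraMap R K f) 0
  have hK : ∀ k : K, IsIntegral R (algebraMap K L k) → k ∈ (algebraMap R K).range := by
    intro k hk
    exact IsIntegrallyClosed.isIntegral_iff.1
      ((isIntegral_algebraMap_iff (algebraMap K L).injective).1 hk)
  have hre : ∀ k : K, (algebraMap K L k).re = k := fun _ => rfl
  have him : ∀ k : K, (algebraMap K L k).im = 0 := fun _ => rfl
  have hmre : ∀ x y : L, (x * y).re = x.re * y.re + algebraMap R K f * x.im * y.im :=
    fun _ _ => rfl
  have hmim : ∀ x y : L, (x * y).im = x.re * y.im + x.im * y.re + 0 * x.im * y.im :=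
    fun _ _ => rfl
  obtain ⟨u, hu⟩ := h2.exists_left_inv
  have hu' : algebraMap R K u * 2 = 1 := by
    rw [← map_ofNat (algebraMap R K) 2, ← map_mul, hu, map_one]
  refine ⟨sqrtMap_injective f, fun {x} => ⟨fun hx => ?_, ?_⟩⟩
  -- If `x = p + q√f` is integral, so are half its trace `p` and `q² f = (x - p)²`. Thus `p` lies in
  -- `R`, and then `q` does by `hsq`.
  · let e : L →ₐ[R] L := { starRingEnd L with
      commutes' := fun r => by
        change star _ = _
        rw [IsScalarTower.algebraMap_apply R K L]
        ext
        · change algebraMap R K r + 0 * 0 = algebraMap R K r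
          ring
        · exact neg_zero }
    have hre : x.re ∈ (algebraMap R K).range := by
      have h1 : IsIntegral R (algebraMap K L x.re) := by
        have h : algebraMap K L x.re = u • (x + star x) := by
          rw [Algebra.smul_def, IsScalarTower.algebraMap_apply R K L]
          ext
          · have h : (x + star x).re = x.re + (x.re + 0 * x.im) := rfl
            rw [hmre, h, hre, hre, him]
            linear_combination -x.re * hu'
          · have h : (x + star x).im = x.im + -x.im := rfl
            rw [hmim, h, him, him]
            ring
        rw [h]
        exact (hx.add (hx.map e)).smul u
      exact hK _ h1
    obtain ⟨p, hp⟩ := hre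
    have him : x.im ∈ (algebraMap R K).range := by
      apply hsq
      apply hK
      have h : algebraMap K L (x.im ^ 2 * algebraMap R K f) =
          (x - algebraMap R L p) ^ 2 := by
        have h1 : (x - algebraMap K L x.re).re = 0 := sub_self x.re
        have h2 : (x - algebraMap K L x.re).im = x.im := sub_zero x.im
        rw [IsScalarTower.algebraMap_apply R K L, hp, sq (x - _)]
        ext
        · rw [hmre, hre, h1, h2]
          ring
        · rw [hmim, him, h1]
          ring
      rw [h]
      exact (hx.sub isIntegral_algebraMap).pow 2
    obtain ⟨q, hq⟩ := him
    exact ⟨⟨p, q⟩, QuadraticAlgebra.ext hp hq⟩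
  · rintro ⟨y, rfl⟩
    exact (Algebra.IsIntegral.isIntegral y).algebraMap

lemma isIntegrallyClosed_sqrt [IsDomain R] [IsIntegrallyClosed R] (h2 : IsUnit (2 : R)) (f : R)
    [Fact (∀ r, r ^ 2 ≠ algebraMap R K f + 0 * r)]
    (hsq : ∀ k : K, k ^ 2 * algebraMap R K f ∈ (algebraMap R K).range →
      k ∈ (algebraMap R K).range) :
    IsIntegrallyClosed (QuadraticAlgebra R f 0) := by
  have := isIntegralClosure_sqrt h2 f hsq
  have := integralClosure.isIntegrallyClosedOfFiniteExtension (R := R) K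
    (L := QuadraticAlgebra K (algebraMap R K f) 0)
  exact IsIntegrallyClosed.of_equiv (IsIntegralClosure.equiv R
    (integralClosure R (QuadraticAlgebra K (algebraMap R K f) 0))
    (QuadraticAlgebra K (algebraMap R K f) 0) _).toRingEquiv

lemma isFractionRing_sqrt [IsDomain R] [IsIntegrallyClosed R] (h2 : IsUnit (2 : R)) (f : R)
    [Fact (∀ r, r ^ 2 ≠ algebraMap R K f + 0 * r)]
    (hsq : ∀ k : K, k ^ 2 * algebraMap R K f ∈ (algebraMap R K).range →
      k ∈ (algebraMap R K).range) :
    IsFractionRing (QuadraticAlgebra R f 0) (QuadraticAlgebra K (algebraMap R K f) 0) := by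
  have := isIntegralClosure_sqrt h2 f hsq
  have := isDomain_sqrt (K := K) f
  exact IsIntegralClosure.isFractionRing_of_finite_extension R K _ _

end QuadraticExtension

/-! ### Normality of R[√f][√g] over a factorial ring -/

section Factorial

variable {R K : Type*} [CommRing R] [IsDomain R] [UniqueFactorizationMonoid R] [Field K]
  [Algebra R K] [IsFractionRing R K]

/-- For `k = x / y` in lowest terms, `y²` divides `x² h`, hence `h`; so `y` is a unit. -/
lemma mem_range_of_squarefree {h : R} (hh : Squarefree h) (k : K)
    (hk : k ^ 2 * algebraMap R K h ∈ (algebraMap R K).range) : k ∈ (algebraMap R K).range := by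
  obtain ⟨x, y, hxy, rfl⟩ := IsFractionRing.exists_reduced_fraction (A := R) k
  obtain ⟨r, hr⟩ := hk
  have hy : algebraMap R K (y : R) ≠ 0 := by
    simp
  have h1 : (y : R) * y * r = x ^ 2 * h := by
    apply IsFractionRing.injective R K
    simp only [map_mul, map_pow, hr]
    rw [IsFractionRing.mk'_eq_div]
    field_simp
  have hu : IsUnit (y : R) := by
    refine hh _ ((?_ : IsRelPrime ((y : R) * y) (x ^ 2)).dvd_of_dvd_mul_left ⟨r, h1.symm⟩)
    have := hxy.symm
    exact (this.mul_left this).pow_right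
  obtain ⟨v, hv⟩ := hu
  refine ⟨x * ((v⁻¹ : Rˣ) : R), ?_⟩
  rw [IsFractionRing.mk'_eq_div, eq_div_iff hy, ← map_mul, ← hv, mul_assoc, Units.inv_mul, mul_one]

/-- A square root in `K` is integral, hence in `R`; squarefreeness then makes it a unit. -/
lemma sq_ne_of_squarefree {h : R} (hh : Squarefree h) (hu : ¬ IsUnit h) (k : K) :
    k ^ 2 ≠ algebraMap R K h := by
  intro hk
  obtain ⟨p, rfl⟩ : k ∈ (algebraMap R K).range :=
    IsIntegrallyClosed.isIntegral_iff.1 (IsIntegral.of_pow two_pos (hk ▸ isIntegral_algebraMap))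
  have hp : p ^ 2 = h := IsFractionRing.injective R K (by rw [map_pow, hk])
  exact hu (hp ▸ (hh p ⟨1, by rw [← hp]; ring⟩).pow 2)

/-- Adjoining the square roots of two coprime squarefree elements of a factorial ring yields a
normal domain. -/
theorem isIntegrallyClosed_sqrt_sqrt (h2 : IsUnit (2 : R)) {f g : R} (hf : ¬ IsUnit f)
    (hg : ¬ IsUnit g) (hfg : Squarefree (f * g)) :
    IsDomain (QuadraticAlgebra (QuadraticAlgebra R f 0) (algebraMap R _ g) 0) ∧
      IsIntegrallyClosed (QuadraticAlgebra (QuadraticAlgebra R f 0) (algebraMap R _ g) 0) := by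
  let K := FractionRing R
  have hsf := hfg.of_mul_left
  have hsg := hfg.of_mul_right
  have : Fact (∀ r, r ^ 2 ≠ algebraMap R K f + 0 * r) :=
    ⟨fun r => by simpa using sq_ne_of_squarefree hsf hf r⟩
  let B := QuadraticAlgebra R f 0
  let L := QuadraticAlgebra K (algebraMap R K f) 0
  have h1 := mem_range_of_squarefree (K := K) hsf
  have : IsDomain B := isDomain_sqrt (K := K) f
  have : IsIntegrallyClosed B := isIntegrallyClosed_sqrt h2 f h1
  have : IsFractionRing B L := isFractionRing_sqrt h2 f h1
  have hgL : algebraMap B L (algebraMap R B g) = algebraMap K L (algebraMap R K g) := by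
    rw [← IsScalarTower.algebraMap_apply R B L, IsScalarTower.algebraMap_apply R K L]
  have hB2 : IsUnit (2 : B) := by
    have := h2.map (algebraMap R B)
    rwa [map_ofNat] at this
  have hre : ∀ k : K, (algebraMap K L k).re = k := fun _ => rfl
  have him : ∀ k : K, (algebraMap K L k).im = 0 := fun _ => rfl
  have hmre : ∀ x y : L, (x * y).re = x.re * y.re + algebraMap R K f * x.im * y.im :=
    fun _ _ => rfl
  have hmim : ∀ x y : L, (x * y).im = x.re * y.im + x.im * y.re + 0 * x.im * y.im :=
    fun _ _ => rfl
  have hf0 : algebraMap R K f ≠ 0 := by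
    simpa using hsf.ne_zero
  -- If `(p + q√f)² = g`, then `p q = 0`; for `p = 0` the product `f g` is the square of `q f`, for
  -- `q = 0` already `g` is a square.
  have : Fact (∀ r : L, r ^ 2 ≠ algebraMap B L (algebraMap R B g) + 0 * r) := by
    refine ⟨fun x hx => ?_⟩
    rw [hgL, zero_mul, add_zero, sq] at hx
    have e1 := congrArg QuadraticAlgebra.re hx
    have e2 := congrArg QuadraticAlgebra.im hx
    rw [hmre, hre] at e1
    rw [hmim, him] at e2
    have e3 : (2 : K) * (x.re * x.im) = 0 := by linear_combination e2
    have h20 : (2 : K) ≠ 0 := by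
      have := (h2.map (algebraMap R K)).ne_zero
      rwa [map_ofNat] at this
    rcases mul_eq_zero.1 ((mul_eq_zero.1 e3).resolve_left h20) with h | h
    · refine sq_ne_of_squarefree hfg (fun hu => hf (isUnit_of_mul_isUnit_left hu))
        (x.im * algebraMap R K f) ?_
      rw [h] at e1
      rw [map_mul]
      linear_combination algebraMap R K f * e1
    · refine sq_ne_of_squarefree hsg hg x.re ?_
      rw [h] at e1
      linear_combination e1
  refine ⟨isDomain_sqrt (K := L) _, isIntegrallyClosed_sqrt (K := L) hB2 _ fun x hx => ?_⟩
  obtain ⟨b, hb⟩ := hx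
  rw [hgL, sq] at hb
  have e1 := congrArg QuadraticAlgebra.re hb
  have e2 := congrArg QuadraticAlgebra.im hb
  rw [hmre, hmre, hmim, hre, him] at e1
  rw [hmim, hmim, hmre, hre, him] at e2
  change algebraMap R K b.re = _ at e1
  change algebraMap R K b.im = _ at e2
  obtain ⟨u, hu⟩ := h2.exists_left_inv
  have hu' : algebraMap R K u * 2 = 1 := by
    rw [← map_ofNat (algebraMap R K) 2, ← map_mul, hu, map_one]
  -- `R[√f]` need not be factorial, so the criterion is checked by norms. For `x = p + q√f` with `x²
  -- g = b`, the element `(p² - q² f) g` squares to the norm of `b`, so it is integral and lies in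
  -- `R`. Half its sum and half its difference with `b.re` give `p² g` and `q² f g` in `R`.
  obtain ⟨t, ht⟩ : (x.re ^ 2 - x.im ^ 2 * algebraMap R K f) * algebraMap R K g ∈
      (algebraMap R K).range := by
    refine IsIntegrallyClosed.isIntegral_iff.1 (IsIntegral.of_pow two_pos ?_)
    have : ((x.re ^ 2 - x.im ^ 2 * algebraMap R K f) * algebraMap R K g) ^ 2 =
        algebraMap R K (b.re ^ 2 - f * b.im ^ 2) := by
      simp only [map_sub, map_mul, map_pow, e1, e2]
      ring
    rw [this]
    exact isIntegral_algebraMap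
  obtain ⟨p, hp⟩ := mem_range_of_squarefree hsg x.re ⟨u * (b.re + t), by
    rw [map_mul, map_add, ht, e1]
    linear_combination (x.re ^ 2 * algebraMap R K g) * hu'⟩
  obtain ⟨q, hq⟩ := mem_range_of_squarefree hfg x.im ⟨u * (b.re - t), by
    rw [map_mul, map_sub, ht, e1, map_mul]
    linear_combination (x.im ^ 2 * algebraMap R K f * algebraMap R K g) * hu'⟩
  exact ⟨⟨p, q⟩, QuadraticAlgebra.ext hp hq⟩

end Factorial
end FanoV8
namespace FanoV8
open MvPolynomial Matrix

/-! ### Normality of the coordinate ring of a diagonal pencil -/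

section DiagonalPencil

lemma algebraMap_add_mul_omega {R : Type*} [CommRing R] {f : R} (z : QuadraticAlgebra R f 0) :
    algebraMap R (QuadraticAlgebra R f 0) z.re +
      algebraMap R (QuadraticAlgebra R f 0) z.im * QuadraticAlgebra.omega = z := by
  ext <;> simp

lemma isRelPrime_X_zero_one : IsRelPrime (X 0 : MvPolynomial (Fin 2) ℂ) (X 1) := by
  refine ((X_prime (R := ℂ) (i := (0 : Fin 2))).irreducible.isRelPrime_iff_not_dvd).2 fun h => ?_
  obtain ⟨q, hq⟩ := h
  have := congrArg (eval ![(0 : ℂ), 1]) hq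
  simp at this

/-- A square factor makes its root divide both partial derivatives, which are multiples of the
coprime variables. -/
lemma squarefree_binary {α β : ℂ} (hα : α ≠ 0) (hβ : β ≠ 0) :
    Squarefree (C α * X 0 ^ 2 + C β * X 1 ^ 2 : MvPolynomial (Fin 2) ℂ) := by
  rintro x ⟨q, hq⟩
  have h : ∀ i, x ∣ pderiv i (C α * X 0 ^ 2 + C β * X 1 ^ 2 : MvPolynomial (Fin 2) ℂ) := by
    intro i
    rw [hq]
    exact ⟨pderiv i x * q + pderiv i x * q + x * pderiv i q, by simp; ring⟩
  have hC : ∀ (c : ℂ) (p : MvPolynomial (Fin 2) ℂ), c ≠ 0 → x ∣ C c * p → x ∣ p :=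
    fun c p hc hx => (((isUnit_iff_ne_zero.2 hc).map C).dvd_mul_left).1 hx
  refine isRelPrime_X_zero_one (hC (2 * α) _ (by simpa) ?_) (hC (2 * β) _ (by simpa) ?_)
  · have := h 0
    simp at this
    convert this using 1
    rw [C_mul, show (C 2 : MvPolynomial (Fin 2) ℂ) = 2 from map_ofNat C 2]
    ring
  · have := h 1
    simp at this
    convert this using 1
    rw [C_mul, show (C 2 : MvPolynomial (Fin 2) ℂ) = 2 from map_ofNat C 2]
    ring

/-- By the nonzero determinant, a common factor of the two forms divides both `X 0 ^ 2` and `X 1 ^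
2`. -/
lemma squarefree_binary_mul {α β γ δ : ℂ} (hα : α ≠ 0) (hβ : β ≠ 0) (hγ : γ ≠ 0) (hδ : δ ≠ 0)
    (h : α * δ - β * γ ≠ 0) :
    Squarefree ((C α * X 0 ^ 2 + C β * X 1 ^ 2) * (C γ * X 0 ^ 2 + C δ * X 1 ^ 2) :
      MvPolynomial (Fin 2) ℂ) := by
  refine squarefree_mul_iff.2 ⟨fun x hx hy => ?_, squarefree_binary hα hβ, squarefree_binary hγ hδ⟩
  have hC : ∀ (c : ℂ) (p : MvPolynomial (Fin 2) ℂ), c ≠ 0 → x ∣ C c * p → x ∣ p :=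
    fun c p hc hx => (((isUnit_iff_ne_zero.2 hc).map C).dvd_mul_left).1 hx
  refine (isRelPrime_X_zero_one.pow_left (m := 2)).pow_right (n := 2) (hC _ _ h ?_) (hC _ _ h ?_)
  · convert dvd_sub (hx.mul_left (C δ)) (hy.mul_left (C β)) using 1
    simp only [C_sub, C_mul]
    ring
  · convert dvd_sub (hy.mul_left (C α)) (hx.mul_left (C γ)) using 1
    simp only [C_sub, C_mul]
    ring

/-- The homogeneous coordinate ring of `y₂² = f(y₀, y₁)`, `y₃² = g(y₀, y₁)` is normal. -/
theorem isIntegrallyClosed_quotient_sqrt {f g : MvPolynomial (Fin 2) ℂ} (hf : ¬ IsUnit f)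
    (hg : ¬ IsUnit g) (hfg : Squarefree (f * g)) {J : Ideal (MvPolynomial (Fin 4) ℂ)}
    (hJ : J = Ideal.span {X 2 * X 2 - rename ![0, 1] f, X 3 * X 3 - rename ![0, 1] g}) :
    IsDomain (MvPolynomial (Fin 4) ℂ ⧸ J) ∧ IsIntegrallyClosed (MvPolynomial (Fin 4) ℂ ⧸ J) := by
  have h2 : IsUnit (2 : MvPolynomial (Fin 2) ℂ) := by
    have := (isUnit_iff_ne_zero.2 (two_ne_zero (α := ℂ))).map (C (σ := Fin 2))
    rwa [map_ofNat] at this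
  obtain ⟨hd, hi⟩ := isIntegrallyClosed_sqrt_sqrt h2 hf hg hfg
  let A := MvPolynomial (Fin 2) ℂ
  let B := QuadraticAlgebra A f 0
  let E := QuadraticAlgebra B (algebraMap A B g) 0
  let e : A →+* E := (algebraMap B E).comp (algebraMap A B)
  let w : E := algebraMap B E QuadraticAlgebra.omega
  let z : E := QuadraticAlgebra.omega
  have hw : w * w = e f := by
    have h : (QuadraticAlgebra.omega : B) * QuadraticAlgebra.omega = algebraMap A B f := by
      rw [QuadraticAlgebra.omega_mul_omega_eq_mk]
      rfl
    rw [← map_mul, h]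
    rfl
  have hz : z * z = e g := QuadraticAlgebra.omega_mul_omega_eq_mk
  -- `ψ` presents `E` by four generators. The universal properties of the two quadratic extensions
  -- give `G` back to the quotient by `J` with `G ∘ ψ` the quotient map, so the kernel of `ψ` is
  -- exactly `J`.
  let ψ : MvPolynomial (Fin 4) ℂ →+* E := eval₂Hom (e.comp C) ![e (X 0), e (X 1), w, z]
  have hψ : ∀ p : A, ψ (rename ![0, 1] p) = e p := by
    intro p
    have h : (ψ.comp (rename ![0, 1] : A →ₐ[ℂ] MvPolynomial (Fin 4) ℂ).toRingHom) = e := by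
      refine ringHom_ext (fun r => ?_) fun i => ?_
      · simp [ψ]
      · fin_cases i <;> simp [ψ]
    exact RingHom.congr_fun h p
  let θ : A →+* MvPolynomial (Fin 4) ℂ ⧸ J :=
    (Ideal.Quotient.mk J).comp (rename ![0, 1] : A →ₐ[ℂ] MvPolynomial (Fin 4) ℂ).toRingHom
  have hJf : X 2 * X 2 - rename ![0, 1] f ∈ J := hJ ▸ Ideal.subset_span (by simp)
  have hJg : X 3 * X 3 - rename ![0, 1] g ∈ J := hJ ▸ Ideal.subset_span (by simp)
  obtain ⟨F, hF⟩ := exists_ringHom_sqrt θ (f := f) (w := Ideal.Quotient.mk J (X 2)) (by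
    rw [← map_mul]
    exact Ideal.Quotient.eq.2 hJf)
  have hFC : ∀ p : A, F (algebraMap A B p) = θ p := by
    intro p
    rw [hF]
    change θ p + θ 0 * _ = _
    simp
  obtain ⟨G, hG⟩ := exists_ringHom_sqrt F (f := algebraMap A B g) (w := Ideal.Quotient.mk J (X 3))
    (by
      rw [← map_mul, hFC]
      exact Ideal.Quotient.eq.2 hJg)
  have hGC : ∀ p : B, G (algebraMap B E p) = F p := by
    intro p
    rw [hG]
    change F p + F 0 * _ = _
    simp
  have hGe : ∀ p : A, G (e p) = θ p := fun p => (hGC _).trans (hFC p)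
  have hGψ : G.comp ψ = Ideal.Quotient.mk J := by
    refine ringHom_ext (fun r => ?_) fun i => ?_
    · have hθ : θ (C r) = Ideal.Quotient.mk J (C r) := congrArg _ (rename_C ![0, 1] r)
      simp [ψ, hGe, hθ]
    · have hGw : G w = Ideal.Quotient.mk J (X 2) := by
        rw [hGC, hF]
        change θ 0 + θ 1 * _ = _
        simp
      have hGz : G z = Ideal.Quotient.mk J (X 3) := by
        rw [hG]
        change F 0 + F 1 * _ = _
        simp
      fin_cases i
      · have hθ : θ (X 0) = Ideal.Quotient.mk J (X 0) := congrArg _ (rename_X ![0, 1] 0)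
        simp [ψ, hGe, hθ]
      · have hθ : θ (X 1) = Ideal.Quotient.mk J (X 1) := congrArg _ (rename_X ![0, 1] 1)
        simp [ψ, hGe, hθ]
      · simpa [ψ] using hGw
      · simpa [ψ] using hGz
  have hker : RingHom.ker ψ = J := by
    apply le_antisymm
    · intro p hp
      rw [← Ideal.Quotient.eq_zero_iff_mem, ← hGψ, RingHom.comp_apply, RingHom.mem_ker.1 hp,
        map_zero]
    · rw [hJ, Ideal.span_le]
      rintro p (rfl | rfl)
      · simp only [SetLike.mem_coe, RingHom.mem_ker, map_sub, map_mul, hψ, ← hw]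
        simp [ψ]
      · simp only [SetLike.mem_coe, RingHom.mem_ker, map_sub, map_mul, hψ, ← hz]
        simp [ψ]
  have hsurj : Function.Surjective ψ := by
    intro x
    refine ⟨rename ![0, 1] x.re.re + rename ![0, 1] x.re.im * X 2 +
      (rename ![0, 1] x.im.re + rename ![0, 1] x.im.im * X 2) * X 3, ?_⟩
    have hb : ∀ b : B, e b.re + e b.im * w = algebraMap B E b := by
      intro b
      change algebraMap B E (algebraMap A B b.re) +
        algebraMap B E (algebraMap A B b.im) * algebraMap B E QuadraticAlgebra.omega = _
      rw [← map_mul, ← map_add, algebraMap_add_mul_omega]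
    have hx : algebraMap B E x.re + algebraMap B E x.im * z = x := algebraMap_add_mul_omega x
    have h2 : ψ (X 2) = w := by simp [ψ]
    have h3 : ψ (X 3) = z := by simp [ψ]
    simp only [map_add, map_mul, hψ, h2, h3, hb, hx]
  subst hker
  have eq := RingHom.quotientKerEquivOfSurjective hsurj
  exact ⟨eq.toMulEquiv.isDomain _, IsIntegrallyClosed.of_equiv eq.symm⟩

lemma not_isUnit_binary (α β : ℂ) :
    ¬ IsUnit (C α * X 0 ^ 2 + C β * X 1 ^ 2 : MvPolynomial (Fin 2) ℂ) := by
  intro h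
  have := h.map (eval (0 : Fin 2 → ℂ))
  simp at this

/-- The pencil spanned by two simultaneously diagonal forms, one of them the unit form. -/
noncomputable def diagForm (l : Fin 4 → ℂ) : MvPolynomial (Fin 4) ℂ := ∑ i, C (l i) * X i ^ 2

/-- A pencil of quadrics in `ℙ³` with four distinct degenerate members has a normal base locus. -/
theorem isIntegrallyClosed_diagonal {l : Fin 4 → ℂ} (hl : Function.Injective l) :
    IsDomain (MvPolynomial (Fin 4) ℂ ⧸
      (Ideal.span {diagForm 1} ⊔ Ideal.span {diagForm l} : Ideal (MvPolynomial (Fin 4) ℂ))) ∧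
    IsIntegrallyClosed (MvPolynomial (Fin 4) ℂ ⧸
      (Ideal.span {diagForm 1} ⊔ Ideal.span {diagForm l} : Ideal (MvPolynomial (Fin 4) ℂ))) := by
  have hne : ∀ i j, i ≠ j → l i - l j ≠ 0 := fun i j hij => sub_ne_zero.2 (hl.ne hij)
  have h30 := hne 3 0 (by decide)
  have h31 := hne 3 1 (by decide)
  have h20 := hne 2 0 (by decide)
  have h21 := hne 2 1 (by decide)
  have h23 := hne 2 3 (by decide)
  have h32 := hne 3 2 (by decide)
  have h01 := hne 0 1 (by decide)
  -- The coefficients arise by solving the two equations for `X 2 ^ 2` and `X 3 ^ 2`; the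
  -- determinant being nonzero makes the two binary forms coprime.
  have hdet : (l 3 - l 0) / (l 2 - l 3) * ((l 2 - l 1) / (l 3 - l 2)) -
      (l 3 - l 1) / (l 2 - l 3) * ((l 2 - l 0) / (l 3 - l 2)) ≠ 0 := by
    have : (l 3 - l 0) / (l 2 - l 3) * ((l 2 - l 1) / (l 3 - l 2)) -
      (l 3 - l 1) / (l 2 - l 3) * ((l 2 - l 0) / (l 3 - l 2)) = (l 0 - l 1) / (l 2 - l 3) := by
      field_simp
      ring
    rw [this]
    exact div_ne_zero h01 h23
  have h1C : (C (l 2) - C (l 3)) * C (l 2 - l 3)⁻¹ = (1 : MvPolynomial (Fin 4) ℂ) := by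
    rw [← C_sub, ← C_mul, mul_inv_cancel₀ h23, C_1]
  have hq : C (l 3 - l 2)⁻¹ = (-C (l 2 - l 3)⁻¹ : MvPolynomial (Fin 4) ℂ) := by
    rw [← C_neg, ← inv_neg, neg_sub]
  have hdiv : ∀ p q : ℂ, (C (p / q) : MvPolynomial (Fin 4) ℂ) = C p * C q⁻¹ := fun p q => by
    rw [div_eq_mul_inv, C_mul]
  refine isIntegrallyClosed_quotient_sqrt (not_isUnit_binary _ _) (not_isUnit_binary _ _)
    (squarefree_binary_mul (div_ne_zero h30 h23) (div_ne_zero h31 h23) (div_ne_zero h20 h32)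
      (div_ne_zero h21 h32) hdet) ?_
  rw [← Ideal.span_union, Set.singleton_union]
  have hr : ∀ α β : ℂ, rename ![0, 1] (C α * X 0 ^ 2 + C β * X 1 ^ 2 : MvPolynomial (Fin 2) ℂ) =
      (C α * X 0 ^ 2 + C β * X 1 ^ 2 : MvPolynomial (Fin 4) ℂ) := fun α β => by simp
  rw [hr, hr]
  apply le_antisymm
  · rw [Ideal.span_le]
    rintro p (rfl | rfl) <;> rw [SetLike.mem_coe, Ideal.mem_span_pair]
    · refine ⟨1, 1, ?_⟩
      simp only [diagForm, Fin.sum_univ_four, hdiv, hq, C_sub, Pi.one_apply, C_1]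
      linear_combination (X 0 ^ 2 + X 1 ^ 2) * h1C
    · refine ⟨C (l 2), C (l 3), ?_⟩
      simp only [diagForm, Fin.sum_univ_four, hdiv, hq, C_sub]
      linear_combination (C (l 0) * X 0 ^ 2 + C (l 1) * X 1 ^ 2) * h1C
  · rw [Ideal.span_le]
    rintro p (rfl | rfl) <;> rw [SetLike.mem_coe, Ideal.mem_span_pair]
    · refine ⟨-C (l 3) * C (l 2 - l 3)⁻¹, C (l 2 - l 3)⁻¹, ?_⟩
      simp only [diagForm, Fin.sum_univ_four, hdiv, C_sub, Pi.one_apply, C_1]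
      linear_combination (X 2 ^ 2) * h1C
    · refine ⟨C (l 2) * C (l 2 - l 3)⁻¹, -C (l 2 - l 3)⁻¹, ?_⟩
      simp only [diagForm, Fin.sum_univ_four, hdiv, hq, C_sub, Pi.one_apply, C_1]
      linear_combination (X 3 ^ 2) * h1C

end DiagonalPencil
end FanoV8
namespace FanoV8
open MvPolynomial Matrix

/-! ### Gradients under linear substitution -/

section Gradient
variable {σ τ : Type*} [Fintype σ] [Fintype τ]

lemma eval_diagForm (l : Fin 4 → ℂ) (y : Fin 4 → ℂ) :
    eval y (diagForm l) = ∑ i, l i * y i ^ 2 := by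
  simp [diagForm]

lemma isHomogeneous_diagForm (l : Fin 4 → ℂ) : (diagForm l).IsHomogeneous 2 :=
  IsHomogeneous.sum _ _ _ fun i _ => by
    simpa using (isHomogeneous_C _ (l i)).mul ((isHomogeneous_X ℂ i).pow 2)

lemma eval_pderiv_diagForm (l y : Fin 4 → ℂ) (j : Fin 4) :
    eval y (pderiv j (diagForm l)) = 2 * (l j * y j) := by
  rw [diagForm, map_sum, map_sum, Finset.sum_eq_single j]
  · simp
    ring
  · intro b _ hb
    simp [pderiv_X, hb]
  · simp

/-- Chain rule for linear substitutions. -/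
lemma eval_pderiv_pullback [DecidableEq σ] [DecidableEq τ] (w : Matrix τ σ ℂ)
    (f : MvPolynomial τ ℂ) (y : σ → ℂ) (j : σ) :
    eval y (pderiv j (pullback w f)) = ∑ i, w i j * eval (w *ᵥ y) (pderiv i f) := by
  induction f using MvPolynomial.induction_on with
  | C a => simp
  | add p q hp hq => simp [hp, hq, mul_add, Finset.sum_add_distrib]
  | mul_X p i hp =>
    have h1 : pderiv j (pullback w (X i)) = C (w i j) := by
      rw [pullback_X, map_sum, Finset.sum_eq_single j]
      · simp
      · intro b _ hb
        simp [pderiv_X, hb]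
      · simp
    have h2 : ∑ k, w k j * (eval (w *ᵥ y) p * eval (w *ᵥ y) (pderiv k (X i))) =
        eval (w *ᵥ y) p * w i j := by
      rw [Finset.sum_eq_single i]
      · simp
        ring
      · intro b _ hb
        simp [pderiv_X, hb.symm]
      · simp
    rw [map_mul, pderiv_mul, h1]
    simp only [pderiv_mul, map_add, map_mul, eval_pullback, eval_X, eval_C, hp, mul_add,
      Finset.sum_add_distrib, h2, Finset.sum_mul]
    congr 1
    exact Finset.sum_congr rfl fun k _ => by ring

end Gradient

/-! ### The curve of a diagonal pencil -/

section Curve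

variable {l : Fin 4 → ℂ}

/-- A nonzero zero of the unit form has two nonzero coordinates; there a relation reads `s + t * l j
= 0` for two distinct values of `l j`. -/
lemma linearIndependent_diagonal (hl : Function.Injective l) {y : Fin 4 → ℂ} (hy : y ≠ 0)
    (ha : eval y (diagForm 1) = 0) :
    LinearIndependent ℂ ![fun j => eval y (pderiv j (diagForm 1)),
      fun j => eval y (pderiv j (diagForm l))] := by
  obtain ⟨p, hp⟩ := Function.ne_iff.1 hy
  have hp : y p ≠ 0 := hp
  obtain ⟨r, hrp, hr⟩ : ∃ r, r ≠ p ∧ y r ≠ 0 := by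
    by_contra! h
    rw [eval_diagForm, Fintype.sum_eq_single p fun j hj => by simp [h j hj]] at ha
    simp [hp] at ha
  rw [LinearIndependent.pair_iff]
  intro s t hst
  have h : ∀ j, y j ≠ 0 → s + t * l j = 0 := by
    intro j hj
    have := congrFun hst j
    simp only [Pi.add_apply, Pi.smul_apply, smul_eq_mul, eval_pderiv_diagForm, Pi.one_apply,
      Pi.zero_apply] at this
    have h2 : (2 * y j) * (s + t * l j) = 0 := by linear_combination this
    exact (mul_eq_zero.1 h2).resolve_left (by simpa)
  have hpr : l p - l r ≠ 0 := sub_ne_zero.2 (hl.ne hrp.symm)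
  have ht : t = 0 := by
    have : t * (l p - l r) = 0 := by linear_combination h p hp - h r hr
    exact (mul_eq_zero.1 this).resolve_right hpr
  exact ⟨by simpa [ht] using h p hp, ht⟩

lemma homogeneousComponent_mem_pair {σ : Type*} {a b f : MvPolynomial σ ℂ} {d n : ℕ}
    (ha : a.IsHomogeneous d) (hb : b.IsHomogeneous d) (hn : n < d)
    (hf : f ∈ Ideal.span {a} ⊔ Ideal.span {b}) : homogeneousComponent n f = 0 := by
  obtain ⟨p, hp, q, hq, rfl⟩ := Submodule.mem_sup.1 hf
  obtain ⟨p, rfl⟩ := Ideal.mem_span_singleton'.1 hp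
  obtain ⟨q, rfl⟩ := Ideal.mem_span_singleton'.1 hq
  rw [map_add, homogeneousComponent_mul_of_lt ha hn, homogeneousComponent_mul_of_lt hb hn, add_zero]

/-- The ideal is prime without forms of degree below 2, so `diagForm 1` is prime; it does not divide
`diagForm l`, as `l` is not constant. -/
lemma hilb_diagonal (hl : Function.Injective l) {n : ℕ} (hn : 1 ≤ n) :
    hilb (Ideal.span {diagForm 1} ⊔ Ideal.span {diagForm l}) n = 4 * n := by
  have hprime : (Ideal.span {diagForm 1} ⊔ Ideal.span {diagForm l}).IsPrime :=
    (Ideal.Quotient.isDomain_iff_prime _).1 (isIntegrallyClosed_diagonal hl).1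
  have h1 := isHomogeneous_diagForm 1
  have h2 := isHomogeneous_diagForm l
  have hne : diagForm 1 ≠ 0 := by
    intro h
    have := congrArg (eval (Pi.single 0 1 : Fin 4 → ℂ)) h
    simp [eval_diagForm, Pi.single_apply] at this
  refine hilb_two_quadrics h1 h2 ?_ ?_ hn
  · refine prime_of_minimal_degree ((hasComponents_span_singleton h1).sup
      (hasComponents_span_singleton h2)) h1 hne (Ideal.mem_sup_left (Ideal.mem_span_singleton_self _))
      fun m hm g hg hgP => ?_
    rw [← homogeneousComponent_mem_pair h1 h2 hm hgP, homogeneousComponent_of_mem hg, if_pos rfl]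
  · intro h
    obtain ⟨s, t, hst⟩ := exists_C_of_mem_span_pair h1 h1 h2 (Ideal.mem_sup_left
      (Ideal.mem_span_singleton.2 h))
    have hs : ∀ i : Fin 4, l i = s + t := by
      intro i
      have := congrArg (eval (Pi.single i 1 : Fin 4 → ℂ)) hst
      simp only [map_add, smul_eval, eval_diagForm] at this
      rw [Fintype.sum_eq_single i fun j hj => by simp [hj],
        Fintype.sum_eq_single i fun j hj => by simp [hj]] at this
      simpa using this
    exact absurd (hl ((hs 0).trans (hs 1).symm)) (by decide)

lemma finrank_comap_of_surjective {V W : Type*} [AddCommGroup V] [Module ℂ V]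
    [FiniteDimensional ℂ V] [AddCommGroup W] [Module ℂ W] (L : V →ₗ[ℂ] W)
    (hL : Function.Surjective L) (G : Submodule ℂ W) :
    Module.finrank ℂ (G.comap L) = Module.finrank ℂ G + Module.finrank ℂ (LinearMap.ker L) := by
  have h := (L.domRestrict (G.comap L)).finrank_range_add_finrank_ker
  have hle : LinearMap.ker L ≤ G.comap L := fun x hx => by
    rw [Submodule.mem_comap, LinearMap.mem_ker.1 hx]
    exact zero_mem _
  rwa [LinearMap.range_domRestrict, Submodule.map_comap_eq_of_surjective hL,
    LinearMap.ker_domRestrict, (Submodule.comapSubtypeEquivOfLe hle).finrank_eq, eq_comm] at h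

/-- The gradients of the ideal of a diagonal pencil in a `3`-space. -/
lemma finrank_gradients (hl : Function.Injective l) {w : Matrix (Fin 7) (Fin 4) ℂ}
    {u : Matrix (Fin 4) (Fin 7) ℂ} (huw : u * w = 1) {y : Fin 4 → ℂ} (hy : y ≠ 0)
    (ha : eval y (diagForm 1) = 0) (hb : eval y (diagForm l) = 0) :
    Module.finrank ℂ (Submodule.span ℂ ((fun f => gradAt f (w *ᵥ y)) ''
      (((Ideal.span {diagForm 1} ⊔ Ideal.span {diagForm l}).comap (pullback w) : Ideal CoordRing) :
        Set CoordRing))) = 5 := by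
  let g : MvPolynomial (Fin 4) ℂ → Fin 4 → ℂ := fun f j => eval y (pderiv j f)
  let L := wᵀ.mulVecLin
  have hchain : ∀ f : CoordRing, L (gradAt f (w *ᵥ y)) = g (pullback w f) := by
    intro f
    funext j
    simp only [g, eval_pderiv_pullback]
    rfl
  have hL : Function.Surjective L := fun z => ⟨uᵀ *ᵥ z, by
    rw [mulVecLin_apply, mulVec_mulVec, ← transpose_mul, huw, transpose_one, one_mulVec]⟩
  have hG : Module.finrank ℂ (Submodule.span ℂ (Set.range ![g (diagForm 1), g (diagForm l)])) = 2 :=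
    finrank_span_eq_card (linearIndependent_diagonal hl hy ha)
  -- By the chain rule the gradients fill the preimage, under the surjection `wᵀ` with 3-dimensional
  -- kernel, of the plane of the two gradients: 5 = 2 + 3. The kernel consists of gradients of
  -- linear forms that vanish on the 3-space.
  have h5 := finrank_comap_of_surjective L hL
    (Submodule.span ℂ (Set.range ![g (diagForm 1), g (diagForm l)]))
  rw [hG, finrank_ker_transpose huw] at h5
  refine Eq.trans (congrArg (fun S : Submodule ℂ (Fin 7 → ℂ) => Module.finrank ℂ S) ?_) h5
  apply le_antisymm
  · rw [Submodule.span_le]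
    rintro _ ⟨f, hf, rfl⟩
    rw [SetLike.mem_coe, Submodule.mem_comap, hchain, Matrix.range_cons, Matrix.range_cons,
      Matrix.range_empty, Set.union_empty, Set.singleton_union, Submodule.mem_span_pair]
    obtain ⟨p, hp, q, hq, h⟩ := Submodule.mem_sup.1 (Ideal.mem_comap.1 hf)
    obtain ⟨p, rfl⟩ := Ideal.mem_span_singleton'.1 hp
    obtain ⟨q, rfl⟩ := Ideal.mem_span_singleton'.1 hq
    refine ⟨eval y p, eval y q, ?_⟩
    funext j
    simp only [g, Pi.add_apply, Pi.smul_apply, smul_eq_mul]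
    rw [← h]
    simp [ha, hb]
  · intro v hv
    rw [Submodule.mem_comap, Matrix.range_cons, Matrix.range_cons,
      Matrix.range_empty, Set.union_empty, Set.singleton_union, Submodule.mem_span_pair] at hv
    obtain ⟨s, t, hst⟩ := hv
    let f : CoordRing := pullback u (s • diagForm 1 + t • diagForm l)
    have hfw : pullback w f = s • diagForm 1 + t • diagForm l := pullback_pullback huw _
    have hf : f ∈ (Ideal.span {diagForm 1} ⊔ Ideal.span {diagForm l}).comap (pullback w) := by
      rw [Ideal.mem_comap, hfw, smul_eq_C_mul, smul_eq_C_mul]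
      exact add_mem (Ideal.mul_mem_left _ _ (Ideal.mem_sup_left (Ideal.mem_span_singleton_self _)))
        (Ideal.mul_mem_left _ _ (Ideal.mem_sup_right (Ideal.mem_span_singleton_self _)))
    have hv' : L (v - gradAt f (w *ᵥ y)) = 0 := by
      rw [map_sub, hchain, hfw, ← hst, sub_eq_zero]
      funext j
      simp [g]
    let v' := v - gradAt f (w *ᵥ y)
    let e : CoordRing := ∑ i, C (v' i) * X i
    have he : gradAt e (w *ᵥ y) = v' := by
      funext j
      simp only [gradAt, e, map_sum]
      rw [Finset.sum_eq_single j]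
      · simp
      · intro b _ hb
        simp [pderiv_X, hb]
      · simp
    have heI : e ∈ (Ideal.span {diagForm 1} ⊔ Ideal.span {diagForm l}).comap (pullback w) := by
      have : pullback w e = 0 := by
        apply MvPolynomial.funext
        intro z
        rw [eval_pullback, map_zero]
        have h : eval (w *ᵥ z) e = v' ⬝ᵥ w *ᵥ z := by
          simp [e, dotProduct]
        rw [h, dotProduct_mulVec, ← mulVec_transpose]
        exact (congrArg (· ⬝ᵥ z) hv').trans (zero_dotProduct z)
      rw [Ideal.mem_comap, this]
      exact zero_mem _
    have hvv : v = gradAt e (w *ᵥ y) + gradAt f (w *ᵥ y) := by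
      rw [he, sub_add_cancel]
    rw [hvv]
    exact add_mem (Submodule.subset_span ⟨e, heI, rfl⟩) (Submodule.subset_span ⟨f, hf, rfl⟩)

/-- A diagonal pencil of quadrics with distinct degenerate members in a `3`-space defines a
projectively normal elliptic quartic. -/
theorem exists_curve_of_diagonal {c : Param} (hl : Function.Injective l)
    {w : Matrix (Fin 7) (Fin 4) ℂ} {u : Matrix (Fin 4) (Fin 7) ℂ} (huw : u * w = 1)
    (hw : ∀ k, ∃ s t : ℂ, wᵀ * coeffHess c k * w = s • 1 + t • diagonal l) :
    ∃ I : Ideal CoordRing, idealV c ≤ I ∧ IsSmoothCurve I 4 1 ∧ IsProjectivelyNormal I := by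
  let J : Ideal (MvPolynomial (Fin 4) ℂ) := Ideal.span {diagForm 1} ⊔ Ideal.span {diagForm l}
  have hJ1 : diagForm 1 ∈ J := Ideal.mem_sup_left (Ideal.mem_span_singleton_self _)
  have hJl : diagForm l ∈ J := Ideal.mem_sup_right (Ideal.mem_span_singleton_self _)
  obtain ⟨hdom, hint⟩ := isIntegrallyClosed_diagonal hl
  have hprime : J.IsPrime := (Ideal.Quotient.isDomain_iff_prime _).1 hdom
  have hcomp : HasComponents J := (hasComponents_span_singleton (isHomogeneous_diagForm 1)).sup
    (hasComponents_span_singleton (isHomogeneous_diagForm l))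
  refine ⟨J.comap (pullback w), ?_, ⟨by norm_num, hcomp.comap_pullback w, inferInstance, ?_, ?_⟩, ?_⟩
  · rw [idealV, Ideal.span_le]
    rintro _ ⟨k, rfl⟩
    obtain ⟨s, t, hst⟩ := hw k
    have h : pullback w (quadrics c k) = C (s / 2) * diagForm 1 + C (t / 2) * diagForm l := by
      apply MvPolynomial.funext
      intro y
      have h2 : 2 * eval (w *ᵥ y) (quadrics c k) = y ⬝ᵥ (wᵀ * coeffHess c k * w) *ᵥ y := by
        rw [two_mul_eval_eq (isHomogeneous_quadrics c k), hess_quadrics, ← mulVec_mulVec,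
          ← mulVec_mulVec, mulVec_transpose, dotProduct_comm y, ← dotProduct_mulVec,
          dotProduct_comm]
      rw [hst] at h2
      have h3 : y ⬝ᵥ (s • (1 : Matrix (Fin 4) (Fin 4) ℂ) + t • diagonal l) *ᵥ y =
          s * eval y (diagForm 1) + t * eval y (diagForm l) := by
        simp only [add_mulVec, smul_mulVec, one_mulVec, dotProduct_add, dotProduct_smul,
          eval_diagForm, smul_eq_mul]
        simp [dotProduct, mulVec_diagonal, sq]
        left
        exact Finset.sum_congr rfl fun i _ => by ring
      rw [eval_pullback, map_add, map_mul, map_mul, eval_C, eval_C]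
      linear_combination (1 / 2 : ℂ) * h2 + (1 / 2 : ℂ) * h3
    rw [SetLike.mem_coe, Ideal.mem_comap, h]
    exact add_mem (J.mul_mem_left _ hJ1) (J.mul_mem_left _ hJl)
  · filter_upwards [Filter.eventually_ge_atTop 1] with n hn
    change ((hilb (J.comap (pullback w)) n : ℕ) : ℤ) = _
    rw [hilb_comap_pullback huw, hilb_diagonal hl hn]
    push_cast
    ring
  · intro x hx hxI
    have hpull : ∀ f ∈ J, eval (u *ᵥ x) f = 0 := by
      intro f hf
      rw [← eval_pullback]
      exact hxI _ (by rw [Ideal.mem_comap, pullback_pullback huw]; exact hf)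
    -- The linear equations of the 3-space belong to the ideal, so a zero of the ideal lies in the
    -- 3-space.
    have hxw : w *ᵥ (u *ᵥ x) = x := by
      funext i
      have h0 : pullback w (X i - ∑ j, C ((w * u) i j) * X j) = 0 := by
        apply MvPolynomial.funext
        intro y
        have : (w * u) *ᵥ (w *ᵥ y) = w *ᵥ y := by
          rw [mulVec_mulVec, Matrix.mul_assoc, huw, Matrix.mul_one]
        rw [eval_pullback]
        simp only [map_sub, map_sum, map_mul, eval_C, eval_X, map_zero]
        exact sub_eq_zero.2 (congrFun this i).symm
      have h1 := hxI (X i - ∑ j, C ((w * u) i j) * X j) (by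
        rw [Ideal.mem_comap, h0]; exact zero_mem _)
      simp only [map_sub, map_sum, map_mul, eval_C, eval_X] at h1
      rw [mulVec_mulVec]
      exact (sub_eq_zero.1 h1).symm
    have hy : u *ᵥ x ≠ 0 := fun h => hx (by rw [← hxw, h, mulVec_zero])
    have := finrank_gradients hl huw hy (hpull _ hJ1) (hpull _ hJl)
    rwa [hxw] at this
  · let φ : CoordRing →+* MvPolynomial (Fin 4) ℂ ⧸ J :=
      (Ideal.Quotient.mk J).comp (pullback w).toRingHom
    have hφ : Function.Surjective φ := by
      intro z
      obtain ⟨f, rfl⟩ := Ideal.Quotient.mk_surjective z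
      exact ⟨pullback u f, congrArg _ (pullback_pullback huw f)⟩
    have hker : RingHom.ker φ = J.comap (pullback w) := by
      ext f
      rw [RingHom.mem_ker, Ideal.mem_comap]
      exact Ideal.Quotient.eq_zero_iff_mem
    rw [← hker]
    have e := RingHom.quotientKerEquivOfSurjective hφ
    exact ⟨e.toMulEquiv.isDomain _, IsIntegrallyClosed.of_equiv e.symm⟩

end Curve
end FanoV8
namespace FanoV8
open MvPolynomial Matrix

/-! ### Diagonalisation of smooth pencils -/

section Diagonalization
variable {n : ℕ} {A B : Matrix (Fin n) (Fin n) ℂ}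

/-- A smooth pencil of quadratic forms can be diagonalised, with distinct eigenvalues. -/
theorem exists_diagonalization (hA : A.IsSymm) (hB : B.IsSymm) (hdet : A.det ≠ 0)
    (hs : ∀ y ≠ 0, ∀ μ : ℂ, B *ᵥ y = μ • A *ᵥ y → y ⬝ᵥ A *ᵥ y ≠ 0) :
    ∃ (P : Matrix (Fin n) (Fin n) ℂ) (l : Fin n → ℂ), Function.Injective l ∧
      Pᵀ * A * P = 1 ∧ Pᵀ * B * P = diagonal l := by
  -- `f` is self-adjoint for `A`, and `hs` says that its eigenvectors are not isotropic for `A`.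
  let f : Module.End ℂ (Fin n → ℂ) := (A⁻¹ * B).mulVecLin
  have hAf : ∀ x, A *ᵥ f x = B *ᵥ x := fun x => by
    rw [mulVecLin_apply, mulVec_mulVec, ← Matrix.mul_assoc,
      mul_nonsing_inv _ (isUnit_iff_ne_zero.2 hdet), Matrix.one_mul]
  have hadj : ∀ x y, f x ⬝ᵥ A *ᵥ y = x ⬝ᵥ A *ᵥ f y := fun x y => by
    rw [hAf, dotProduct_mulVec_comm hA, hAf, dotProduct_mulVec_comm hB]
  have heig : ∀ (μ : ℂ) (y : Fin n → ℂ), y ≠ 0 → f y = μ • y → y ⬝ᵥ A *ᵥ y ≠ 0 :=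
    fun μ y hy h => hs y hy μ (by rw [← hAf, h, mulVec_smul])
  have hadj' : ∀ (μ : ℂ) x y, (f - algebraMap ℂ (Module.End ℂ (Fin n → ℂ)) μ) x ⬝ᵥ A *ᵥ y =
      x ⬝ᵥ A *ᵥ (f - algebraMap ℂ (Module.End ℂ (Fin n → ℂ)) μ) y := fun μ x y => by
    simp only [LinearMap.sub_apply, Module.algebraMap_end_apply, sub_dotProduct, mulVec_sub,
      dotProduct_sub, hadj, smul_dotProduct, mulVec_smul, dotProduct_smul]
  -- Otherwise `(f - μ) z` is an eigenvector whose square for `A` is the pairing of `z` with `(f -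
  -- μ)² z = 0`. Hence `f` is diagonalisable.
  have hsq : ∀ (μ : ℂ) z, (f - algebraMap ℂ (Module.End ℂ (Fin n → ℂ)) μ)
      ((f - algebraMap ℂ (Module.End ℂ (Fin n → ℂ)) μ) z) = 0 →
      (f - algebraMap ℂ (Module.End ℂ (Fin n → ℂ)) μ) z = 0 := by
    intro μ z hz
    by_contra hne
    refine heig μ _ hne ?_ ?_
    · rw [LinearMap.sub_apply, sub_eq_zero] at hz
      exact hz
    · rw [hadj', hz, mulVec_zero, dotProduct_zero]
  have hpow : ∀ (μ : ℂ) (k : ℕ) z, ((f - algebraMap ℂ (Module.End ℂ (Fin n → ℂ)) μ) ^ k) z = 0 →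
      (f - algebraMap ℂ (Module.End ℂ (Fin n → ℂ)) μ) z = 0 := by
    intro μ k
    induction k with
    | zero =>
      intro z hz
      have : z = 0 := hz
      rw [this, map_zero]
    | succ k ih =>
      intro z hz
      rw [pow_succ, Module.End.mul_apply] at hz
      exact hsq μ z (ih _ hz)
  have htop : ⨆ μ : ℂ, f.eigenspace μ = ⊤ := by
    rw [eq_top_iff, ← Module.End.iSup_maxGenEigenspace_eq_top f]
    refine iSup_mono fun μ x hx => ?_
    obtain ⟨k, hk⟩ := (Module.End.mem_maxGenEigenspace f μ x).1 hx
    have := hpow μ k x hk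
    rw [LinearMap.sub_apply, sub_eq_zero] at this
    exact Module.End.mem_eigenspace_iff.2 this
  choose v hv using fun μ : f.Eigenvalues =>
    (show f.HasEigenvalue (μ : ℂ) from μ.2).exists_hasEigenvector
  have hvμ : ∀ μ : f.Eigenvalues, f (v μ) = (μ : ℂ) • v μ := fun μ => (hv μ).apply_eq_smul
  -- A 2-dimensional eigenspace would contain an isotropic vector, so all eigenvalues are simple.
  have hspan : ∀ (μ : f.Eigenvalues) x, x ∈ f.eigenspace (μ : ℂ) → x ∈ Submodule.span ℂ {v μ} := by
    intro μ x hx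
    have hle : Module.finrank ℂ (f.eigenspace (μ : ℂ)) ≤ 1 := by
      by_contra hlt
      obtain ⟨y, hy, hy0, hyy⟩ := exists_isotropic_vector (Matrix.toBilin' A) (isSymm_toBilin' hA)
        (U := f.eigenspace (μ : ℂ)) (by omega)
      exact heig μ y hy0 (Module.End.mem_eigenspace_iff.1 hy)
        (by simpa [Matrix.toBilin'_apply'] using hyy)
    have h1 : f.eigenspace (μ : ℂ) = Submodule.span ℂ {v μ} := by
      refine (Submodule.eq_of_le_of_finrank_le ?_ ?_).symm
      · exact (Submodule.span_singleton_le_iff_mem _ _).2 (hv μ).1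
      · rw [finrank_span_singleton (hv μ).2]
        exact hle
    exact h1 ▸ hx
  have hli : LinearIndependent ℂ v :=
    Module.End.eigenvectors_linearIndependent' f (fun μ : f.Eigenvalues => (μ : ℂ))
      Subtype.val_injective v hv
  have hsp : ⊤ ≤ Submodule.span ℂ (Set.range v) := by
    rw [← htop]
    refine iSup_le fun μ x hx => ?_
    by_cases hμ : f.HasEigenvalue μ
    · exact Submodule.span_mono (by rintro _ rfl; exact ⟨_, rfl⟩) (hspan ⟨μ, hμ⟩ x hx)
    · have : x = 0 := by
        by_contra h0
        exact hμ (Module.End.hasEigenvalue_of_hasEigenvector ⟨hx, h0⟩)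
      rw [this]
      exact zero_mem _
  have hcard := Module.finrank_eq_card_basis (Module.Basis.mk hli hsp)
  rw [Module.finrank_fin_fun] at hcard
  let e : Fin n ≃ f.Eigenvalues := (Fintype.equivFinOfCardEq hcard.symm).symm
  have hvv : ∀ μ, v μ ⬝ᵥ A *ᵥ v μ ≠ 0 := fun μ => heig μ _ (hv μ).2 (hvμ μ)
  choose r hr using fun μ => IsAlgClosed.exists_pow_nat_eq (v μ ⬝ᵥ A *ᵥ v μ)⁻¹ two_pos
  have hort : ∀ μ ν, μ ≠ ν → v μ ⬝ᵥ A *ᵥ v ν = 0 := by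
    intro μ ν hμν
    have h := hadj (v μ) (v ν)
    rw [hvμ, hvμ, smul_dotProduct, mulVec_smul, dotProduct_smul, smul_eq_mul, smul_eq_mul] at h
    have h2 : ((μ : ℂ) - ν) * (v μ ⬝ᵥ A *ᵥ v ν) = 0 := by linear_combination h
    exact (mul_eq_zero.1 h2).resolve_left (sub_ne_zero.2 fun h => hμν (Subtype.ext h))
  let P : Matrix (Fin n) (Fin n) ℂ := Matrix.of fun i j => (r (e j) • v (e j)) i
  have hP : ∀ (M : Matrix (Fin n) (Fin n) ℂ) i j,
      (Pᵀ * M * P) i j = (r (e i) • v (e i)) ⬝ᵥ M *ᵥ (r (e j) • v (e j)) := by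
    intro M i j
    rw [Matrix.mul_assoc]
    rfl
  have hPA : ∀ i j, (r (e i) • v (e i)) ⬝ᵥ A *ᵥ (r (e j) • v (e j)) = if i = j then 1 else 0 := by
    intro i j
    rw [smul_dotProduct, mulVec_smul, dotProduct_smul, smul_eq_mul, smul_eq_mul]
    split_ifs with h
    · rw [h, ← mul_assoc, ← sq, hr, inv_mul_cancel₀ (hvv _)]
    · rw [hort _ _ fun h' => h (e.injective h'), mul_zero, mul_zero]
  refine ⟨P, fun i => (e i : ℂ), fun i j h => e.injective (Subtype.ext h), ?_, ?_⟩
  · ext i j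
    rw [hP, hPA, one_apply]
  · ext i j
    have h : B *ᵥ (r (e j) • v (e j)) = ((e j : f.Eigenvalues) : ℂ) • A *ᵥ (r (e j) • v (e j)) := by
      rw [← hAf, map_smul, hvμ, smul_comm, mulVec_smul]
    rw [hP, h, dotProduct_smul, hPA, diagonal_apply]
    split_ifs with h'
    · rw [h', smul_eq_mul, mul_one]
    · rw [smul_zero]

/-- A smooth pencil of quadrics in a `3`-space, with a smooth member, which is the restriction of
the net, defines a projectively normal elliptic quartic. -/
theorem exists_curve_of_smooth_pencil {c : Param} {A B : Matrix (Fin 4) (Fin 4) ℂ} (hA : A.IsSymm)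
    (hB : B.IsSymm) (hdet : A.det ≠ 0)
    (hs : ∀ y ≠ 0, ∀ μ : ℂ, B *ᵥ y = μ • A *ᵥ y → y ⬝ᵥ A *ᵥ y ≠ 0)
    {w : Matrix (Fin 7) (Fin 4) ℂ} {u : Matrix (Fin 4) (Fin 7) ℂ} (huw : u * w = 1)
    (hw : ∀ k, ∃ s t : ℂ, wᵀ * coeffHess c k * w = s • A + t • B) :
    ∃ I : Ideal CoordRing, idealV c ≤ I ∧ IsSmoothCurve I 4 1 ∧ IsProjectivelyNormal I := by
  obtain ⟨P, l, hl, hPA, hPB⟩ := exists_diagonalization hA hB hdet hs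
  have huw' : (Pᵀ * A * u) * (w * P) = 1 := by
    rw [Matrix.mul_assoc, ← Matrix.mul_assoc u, huw, Matrix.one_mul, hPA]
  refine exists_curve_of_diagonal hl huw' fun k => ?_
  obtain ⟨s, t, hst⟩ := hw k
  refine ⟨s, t, ?_⟩
  rw [← hPA, ← hPB, transpose_mul]
  have : Pᵀ * wᵀ * coeffHess c k * (w * P) = Pᵀ * (wᵀ * coeffHess c k * w) * P := by
    simp only [Matrix.mul_assoc]
  rw [this, hst]
  simp [Matrix.mul_add, Matrix.add_mul]

end Diagonalization
end FanoV8
namespace FanoV8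
open MvPolynomial Matrix

/-! ### Parametrisation of all nets by nets adapted to a 3-space -/

section Parametrization

/-- Indices of a basis adapted to a flag `ℂ⁴ ⊂ ℂ⁷`. -/
abbrev FlagIndex : Type := Fin 4 ⊕ Fin 3

/-- The numbering of an adapted basis. -/
def flagEquiv : Fin 7 ≃ FlagIndex := (finSumFinEquiv (m := 4) (n := 3)).symm

/-- Indices of the parameters of a net of quadrics, one of which contains a `3`-space: a change of
basis of the net, a change of coordinates and three bilinear forms. -/
abbrev NetIndex : Type :=
  (Fin 3 × Fin 3) ⊕ (FlagIndex × Fin 7) ⊕ (Fin 3 × FlagIndex × FlagIndex)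

variable {R S : Type*} [CommRing R] [CommRing S]

/-- The coefficients of the quadratic form of a bilinear form. -/
def symCoeff (M : Matrix (Fin 7) (Fin 7) R) (s : Sym2 (Fin 7)) : R :=
  Sym2.lift ⟨fun i j => if i = j then M i j else M i j + M j i, fun i j => by
    by_cases h : i = j
    · rw [h]
    · simp [h, Ne.symm h, add_comm]⟩ s

lemma coeffHess_symCoeff (M : Fin 3 → Matrix (Fin 7) (Fin 7) R) (k : Fin 3) :
    coeffHess (fun p => symCoeff (M p.1) p.2) k = M k + (M k)ᵀ := by
  ext i j
  by_cases h : i = j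
  · subst h
    simp [coeffHess, symCoeff, mul_two]
  · simp [coeffHess, symCoeff, h]

lemma param_ext {c c' : Param} (h : ∀ k, coeffHess c k = coeffHess c' k) : c = c' := by
  funext ⟨k, s⟩
  induction s using Sym2.ind with
  | _ i j =>
    have := congrFun (congrFun (h k) i) j
    by_cases hij : i = j <;> simpa [coeffHess, hij] using this

/-- The change of basis of the net. -/
def netPart (y : NetIndex → R) : Matrix (Fin 3) (Fin 3) R :=
  Matrix.of fun k j => y (Sum.inl (k, j))

/-- The change of coordinates. -/
def coordPart (y : NetIndex → R) : Matrix FlagIndex (Fin 7) R :=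
  Matrix.of fun a i => y (Sum.inr (Sum.inl (a, i)))

/-- The three bilinear forms; the first one vanishes on the distinguished `3`-space. -/
def formPart (y : NetIndex → R) (j : Fin 3) : Matrix FlagIndex FlagIndex R :=
  Matrix.of fun a b => if j = 0 ∧ a.isLeft ∧ b.isLeft then 0 else y (Sum.inr (Sum.inr (j, a, b)))

/-- The bilinear forms of the parametrized net. -/
def netMatrix (y : NetIndex → R) (k : Fin 3) : Matrix (Fin 7) (Fin 7) R :=
  ∑ j, netPart y k j • ((coordPart y)ᵀ * formPart y j * coordPart y)

/-- The coefficients of the parametrized net. -/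
def netParam (y : NetIndex → R) (p : Fin 3 × Sym2 (Fin 7)) : R :=
  symCoeff (netMatrix y p.1) p.2

/-- The restrictions of the three quadratic forms to the distinguished `3`-space. -/
def blockForm (y : NetIndex → R) (j : Fin 3) : Matrix (Fin 4) (Fin 4) R :=
  (formPart y j + (formPart y j)ᵀ).submatrix Sum.inl Sum.inl

lemma map_formPart (φ : R →+* S) (y : NetIndex → R) (j : Fin 3) (a b : FlagIndex) :
    φ (formPart y j a b) = formPart (fun i => φ (y i)) j a b := by
  simp only [formPart, of_apply, apply_ite φ, map_zero]

lemma map_netParam (φ : R →+* S) (y : NetIndex → R) (p : Fin 3 × Sym2 (Fin 7)) :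
    φ (netParam y p) = netParam (fun i => φ (y i)) p := by
  have h : ∀ k i j, φ (netMatrix y k i j) = netMatrix (fun i => φ (y i)) k i j := by
    intro k i j
    simp only [netMatrix, Matrix.sum_apply, Matrix.smul_apply, smul_eq_mul, Matrix.mul_apply,
      map_sum, map_mul, map_formPart]
    rfl
  obtain ⟨k, s⟩ := p
  induction s using Sym2.ind with
  | _ i j => simp [netParam, symCoeff, apply_ite φ, h]

lemma map_blockForm (φ : R →+* S) (y : NetIndex → R) (j : Fin 3) (a b : Fin 4) :
    φ (blockForm y j a b) = blockForm (fun i => φ (y i)) j a b := by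
  simp [blockForm, map_formPart]

lemma blockForm_isSymm (y : NetIndex → R) (j : Fin 3) : (blockForm y j).IsSymm := by
  ext a b
  simp [blockForm, add_comm]

lemma blockForm_zero (y : NetIndex → R) : blockForm y 0 = 0 := by
  ext a b
  simp [blockForm, formPart]

/-- The restriction of the parametrized net to the distinguished `3`-space. -/
lemma exists_restriction (y : NetIndex → ℂ)
    (hdet : ((coordPart y).submatrix flagEquiv id).det ≠ 0) :
    ∃ (w : Matrix (Fin 7) (Fin 4) ℂ) (u : Matrix (Fin 4) (Fin 7) ℂ), u * w = 1 ∧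
      ∀ k, wᵀ * coeffHess (netParam y) k * w =
        netPart y k 1 • blockForm y 1 + netPart y k 2 • blockForm y 2 := by
  let e : Fin 7 ≃ FlagIndex := flagEquiv
  let g := coordPart y
  let gs : Matrix (Fin 7) (Fin 7) ℂ := g.submatrix e id
  -- `P` inverts the change of coordinates; its first four columns span the distinguished 3-space,
  -- where form 0 vanishes and only forms 1 and 2 survive.
  let P : Matrix (Fin 7) FlagIndex ℂ := gs⁻¹.submatrix id e.symm
  have hgP : g * P = 1 := by
    have h1 : g = gs.submatrix e.symm id := by
      ext a i
      simp [gs]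
    have h2 : g * P = (gs * gs⁻¹).submatrix e.symm e.symm := by
      rw [h1]
      exact submatrix_mul_equiv gs gs⁻¹ e.symm (Equiv.refl _) e.symm
    rw [h2, mul_nonsing_inv _ (isUnit_iff_ne_zero.2 hdet), submatrix_one_equiv]
  have hPg : Pᵀ * gᵀ = 1 := by rw [← transpose_mul, hgP, transpose_one]
  refine ⟨P.submatrix id Sum.inl, g.submatrix Sum.inl id, ?_, fun k => ?_⟩
  · ext a b
    have := congrFun (congrFun hgP (Sum.inl a)) (Sum.inl b)
    rw [one_apply] at this ⊢
    simpa [Matrix.mul_apply] using this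
  · have h1 : coeffHess (netParam y) k = netMatrix y k + (netMatrix y k)ᵀ :=
      coeffHess_symCoeff (netMatrix y) k
    have h2 : Pᵀ * netMatrix y k * P = ∑ j, netPart y k j • formPart y j := by
      rw [netMatrix, Matrix.mul_sum, Matrix.sum_mul]
      refine Finset.sum_congr rfl fun j _ => ?_
      rw [Matrix.mul_smul, Matrix.smul_mul]
      congr 1
      calc Pᵀ * (gᵀ * formPart y j * g) * P = (Pᵀ * gᵀ) * formPart y j * (g * P) := by
            simp only [Matrix.mul_assoc]
        _ = formPart y j := by rw [hPg, hgP, Matrix.one_mul, Matrix.mul_one]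
    have h3 : Pᵀ * coeffHess (netParam y) k * P =
        ∑ j, netPart y k j • (formPart y j + (formPart y j)ᵀ) := by
      have h4 : Pᵀ * (netMatrix y k)ᵀ * P = (Pᵀ * netMatrix y k * P)ᵀ := by
        simp only [transpose_mul, transpose_transpose, Matrix.mul_assoc]
      rw [h1, Matrix.mul_add, Matrix.add_mul, h4, h2, transpose_sum, ← Finset.sum_add_distrib]
      exact Finset.sum_congr rfl fun j _ => by rw [transpose_smul, smul_add]
    have h5 : (P.submatrix id (Sum.inl : Fin 4 → FlagIndex))ᵀ * coeffHess (netParam y) k *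
        P.submatrix id (Sum.inl : Fin 4 → FlagIndex) =
          (Pᵀ * coeffHess (netParam y) k * P).submatrix Sum.inl Sum.inl := rfl
    have h6 : (∑ j, netPart y k j • (formPart y j + (formPart y j)ᵀ)).submatrix
        (Sum.inl : Fin 4 → FlagIndex) (Sum.inl : Fin 4 → FlagIndex) =
        ∑ j, netPart y k j • blockForm y j := by
      ext a b
      simp [Matrix.sum_apply, blockForm, mul_add]
    rw [h5, h3, h6, Fin.sum_univ_three, blockForm_zero, smul_zero, zero_add]

/-- A singular quadric in `ℙ⁶` contains a `3`-space. -/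
lemma exists_adapted_basis {N : Matrix (Fin 7) (Fin 7) ℂ} (hN : N.IsSymm) (hdet : N.det = 0) :
    ∃ (P : Matrix (Fin 7) FlagIndex ℂ) (g : Matrix FlagIndex (Fin 7) ℂ), P * g = 1 ∧
      ∀ a b : Fin 4, (Pᵀ * N * P) (Sum.inl a) (Sum.inl b) = 0 := by
  obtain ⟨v, hv, hNv⟩ := exists_mulVec_eq_zero_iff.2 hdet
  have hvl : ∀ y, Matrix.toBilin' N v y = 0 := fun y => by
    rw [Matrix.toBilin'_apply', dotProduct_mulVec_comm hN, hNv, dotProduct_zero]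
  have hker : Submodule.span ℂ {v} ≤ (Matrix.toBilin' N).ker :=
    (Submodule.span_singleton_le_iff_mem _ _).2 (LinearMap.mem_ker.2 (LinearMap.ext hvl))
  -- A null vector lies in the radical, so `2 * 4 ≤ 7 + 1` permits an isotropic subspace of
  -- dimension 4.
  obtain ⟨W, -, hW4, hW⟩ := exists_isotropic_subspace (Matrix.toBilin' N) (isSymm_toBilin' hN)
    (W₀ := Submodule.span ℂ {v}) (m := 4)
    (fun x hx y _ => by
      rw [LinearMap.mem_ker.1 (hker hx), LinearMap.zero_apply])
    (by rw [finrank_span_singleton hv]; norm_num)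
    (by rw [inf_eq_left.2 hker, finrank_span_singleton hv, Module.finrank_fin_fun])
  obtain ⟨D, hD⟩ := Submodule.exists_isCompl W
  have hD3 : Module.finrank ℂ D = 3 := by
    have := Submodule.finrank_add_eq_of_isCompl hD
    rw [hW4, Module.finrank_fin_fun] at this
    omega
  let b : Module.Basis FlagIndex ℂ (Fin 7 → ℂ) :=
    ((Module.finBasisOfFinrankEq ℂ W hW4).prod (Module.finBasisOfFinrankEq ℂ D hD3)).map
      (Submodule.prodEquivOfIsCompl W D hD)
  have hbW : ∀ a : Fin 4, b (Sum.inl a) ∈ W := fun a => by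
    simp [b]
  refine ⟨(Pi.basisFun ℂ (Fin 7)).toMatrix b, b.toMatrix (Pi.basisFun ℂ (Fin 7)),
    Module.Basis.toMatrix_mul_toMatrix_flip _ _, fun i j => ?_⟩
  have h := hW _ (hbW i) _ (hbW j)
  rw [Matrix.toBilin'_apply'] at h
  rw [Matrix.mul_assoc, ← h]
  rfl

/-- Each net of quadrics in `ℙ⁶` has a basis whose first member is singular. -/
lemma exists_singular_member (H : Fin 3 → Matrix (Fin 7) (Fin 7) ℂ) (hH : ∀ k, (H k).IsSymm) :
    ∃ (h : Matrix (Fin 3) (Fin 3) ℂ) (N : Fin 3 → Matrix (Fin 7) (Fin 7) ℂ),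
      (∀ j, (N j).IsSymm) ∧ (N 0).det = 0 ∧ ∀ k, H k = ∑ j, h k j • N j := by
  -- On the pencil of the first two forms the determinant is a binary form of degree 7. The singular
  -- member found replaces one of the two forms that occurs in it.
  let p : MvPolynomial (Fin 2) ℂ :=
    (Matrix.of fun i j => C (H 0 i j) * X 0 + C (H 1 i j) * X 1 : Matrix (Fin 7) (Fin 7) _).det
  have hp : ∀ x : Fin 2 → ℂ, eval x p = (x 0 • H 0 + x 1 • H 1).det := by
    intro x
    rw [RingHom.map_det]
    congr 1
    ext i j
    simp [mul_comm]
  obtain ⟨x, hx, hx0⟩ := exists_binary_zero p (n := 7) (by norm_num) (fun s x => by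
    have h := det_smul (x 0 • H 0 + x 1 • H 1) s
    rw [Fintype.card_fin] at h
    rw [hp, hp, ← h]
    simp [smul_add, mul_smul])
  rw [hp] at hx0
  have hN : (x 0 • H 0 + x 1 • H 1).IsSymm := ((hH 0).smul _).add ((hH 1).smul _)
  by_cases h0 : x 0 = 0
  · have h1 : x 1 ≠ 0 := fun h1 => hx (by
      funext i
      fin_cases i
      exacts [h0, h1])
    refine ⟨!![0, 1, 0; (x 1)⁻¹, 0, 0; 0, 0, 1], ![x 0 • H 0 + x 1 • H 1, H 0, H 2], ?_, hx0, ?_⟩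
    · intro j
      fin_cases j
      exacts [hN, hH 0, hH 2]
    · intro k
      fin_cases k <;> simp [Fin.sum_univ_three, h0, h1, smul_smul]
  · refine ⟨!![(x 0)⁻¹, -(x 1 * (x 0)⁻¹), 0; 0, 1, 0; 0, 0, 1],
      ![x 0 • H 0 + x 1 • H 1, H 1, H 2], ?_, hx0, ?_⟩
    · intro j
      fin_cases j
      exacts [hN, hH 1, hH 2]
    · intro k
      fin_cases k <;> simp [Fin.sum_univ_three, h0, smul_smul, mul_comm]

/-- All nets of quadrics in `ℙ⁶` are parametrized. -/
theorem exists_netParam_eq (c : Param) : ∃ y : NetIndex → ℂ, netParam y = c := by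
  have hsymm : ∀ k, (coeffHess c k).IsSymm := fun k => hess_quadrics c k ▸ hess_isSymm _
  obtain ⟨h, N, hN, hN0, hc⟩ := exists_singular_member (coeffHess c) hsymm
  obtain ⟨P, g, hPg, hblock⟩ := exists_adapted_basis (hN 0) hN0
  -- The factor `1 / 2` compensates the passage from `M` to `M + Mᵀ` in `symCoeff`.
  let y : NetIndex → ℂ := Sum.elim (fun p => h p.1 p.2) (Sum.elim (fun p => g p.1 p.2)
    fun p => (1 / 2 : ℂ) * (Pᵀ * N p.1 * P) p.2.1 p.2.2)
  have hform : ∀ j, formPart y j = (1 / 2 : ℂ) • (Pᵀ * N j * P) := by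
    intro j
    ext a b
    simp only [formPart, of_apply]
    split_ifs with hm
    · obtain ⟨rfl, ha, hb⟩ := hm
      obtain ⟨a, rfl⟩ := Sum.isLeft_iff.1 ha
      obtain ⟨b, rfl⟩ := Sum.isLeft_iff.1 hb
      rw [Matrix.smul_apply, hblock, smul_zero]
    · rfl
  have hgP : gᵀ * Pᵀ = 1 := by rw [← transpose_mul, hPg, transpose_one]
  have hgg : ∀ j, gᵀ * formPart y j * g = (1 / 2 : ℂ) • N j := by
    intro j
    rw [hform, Matrix.mul_smul, Matrix.smul_mul]
    congr 1
    calc gᵀ * (Pᵀ * N j * P) * g = (gᵀ * Pᵀ) * N j * (P * g) := by simp only [Matrix.mul_assoc]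
      _ = N j := by rw [hgP, hPg, Matrix.one_mul, Matrix.mul_one]
  refine ⟨y, param_ext fun k => ?_⟩
  have h1 : coeffHess (netParam y) k = netMatrix y k + (netMatrix y k)ᵀ :=
    coeffHess_symCoeff (netMatrix y) k
  have h2 : netMatrix y k = (1 / 2 : ℂ) • coeffHess c k := by
    rw [hc, Finset.smul_sum]
    refine Finset.sum_congr rfl fun j _ => ?_
    rw [smul_comm, ← hgg]
    rfl
  rw [h1, h2, transpose_smul, (hsymm k).eq, ← add_smul]
  norm_num

end Parametrization
end FanoV8
namespace FanoV8
open MvPolynomial Matrix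

/-! ### Existence of the curve on the general V₈ -/

section General

/-- The smooth pencils among the pencils of quadrics spanned by two blocks form an open set. -/
lemma exists_smooth_pencil_condition (y₀ : NetIndex → ℂ)
    (h₁ : blockForm y₀ 1 = (2 : ℂ) • 1)
    (h₂ : blockForm y₀ 2 = (2 : ℂ) • diagonal fun i : Fin 4 => ((i : ℕ) : ℂ)) :
    ∃ G : MvPolynomial NetIndex ℂ, G ≠ 0 ∧ ∀ y, eval y G ≠ 0 → ∀ z ≠ 0, ∀ μ : ℂ,
      blockForm y 2 *ᵥ z = μ • blockForm y 1 *ᵥ z → z ⬝ᵥ blockForm y 1 *ᵥ z ≠ 0 := by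
  let R := MvPolynomial NetIndex ℂ
  let g : Fin 3 → Fin 4 → MvPolynomial (Fin 4) R := fun j a =>
    ∑ b, C (blockForm (X : NetIndex → R) j a b) * X b
  -- Common zeros are the points of the first quadric where the two gradients are proportional.
  let f : Unit ⊕ (Fin 4 × Fin 4) → MvPolynomial (Fin 4) R :=
    Sum.elim (fun _ => ∑ a, X a * g 1 a) (fun e => g 1 e.1 * g 2 e.2 - g 1 e.2 * g 2 e.1)
  have hg : ∀ j a, (g j a).IsHomogeneous 1 := fun j a =>
    IsHomogeneous.sum _ _ _ fun i _ => isHomogeneous_C_mul_X _ _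
  have hge : ∀ (y : NetIndex → ℂ) (z : Fin 4 → ℂ) j a,
      eval z (map (eval y) (g j a)) = (blockForm y j *ᵥ z) a := by
    intro y z j a
    simp [g, mulVec, dotProduct, map_blockForm]
  have hf0 : ∀ (y : NetIndex → ℂ) (z : Fin 4 → ℂ) t,
      eval z (map (eval y) (f (Sum.inl t))) = z ⬝ᵥ blockForm y 1 *ᵥ z := by
    intro y z t
    simp only [f, Sum.elim_inl, map_sum, map_mul, map_X, eval_X, hge]
    rfl
  have hf1 : ∀ (y : NetIndex → ℂ) (z : Fin 4 → ℂ) e, eval z (map (eval y) (f (Sum.inr e))) =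
      (blockForm y 1 *ᵥ z) e.1 * (blockForm y 2 *ᵥ z) e.2 -
        (blockForm y 1 *ᵥ z) e.2 * (blockForm y 2 *ᵥ z) e.1 := by
    intro y z e
    simp only [f, Sum.elim_inr, map_sub, map_mul, hge]
  obtain ⟨G, hG, hGy⟩ := exists_ne_zero_forall_eq_zero f (fun _ => 2) (by
      rintro (t | e)
      · exact IsHomogeneous.sum _ _ _ fun j _ => (isHomogeneous_X R j).mul (hg 1 j)
      · exact ((hg 1 e.1).mul (hg 2 e.2)).sub ((hg 1 e.2).mul (hg 2 e.1))) y₀ (by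
      intro z hz
      have h0 := hz (Sum.inl ())
      rw [hf0, h₁] at h0
      have h1 : ∀ a b : Fin 4, a ≠ b → z a ≠ 0 → z b = 0 := by
        intro a b hab ha
        have h := hz (Sum.inr (a, b))
        rw [hf1, h₁, h₂] at h
        simp only [smul_mulVec, one_mulVec, Pi.smul_apply, mulVec_diagonal, smul_eq_mul] at h
        have hab' : ((b : ℕ) : ℂ) - a ≠ 0 := by
          rw [sub_ne_zero]
          exact_mod_cast fun h : (b : ℕ) = a => hab (Fin.ext h.symm)
        have h' : (4 * (((b : ℕ) : ℂ) - a) * z a) * z b = 0 := by linear_combination h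
        exact (mul_eq_zero.1 h').resolve_left
          (mul_ne_zero (mul_ne_zero (by norm_num) hab') ha)
      by_contra hne
      obtain ⟨p, hp⟩ := Function.ne_iff.1 hne
      have hp : z p ≠ 0 := hp
      rw [smul_mulVec, one_mulVec, dotProduct_smul, dotProduct,
        Fintype.sum_eq_single p fun b hb => by rw [h1 p b hb.symm hp, mul_zero]] at h0
      simp [hp] at h0)
  refine ⟨G, fun h => hG (by rw [h, map_zero]), fun y hy z hz μ hμ hzz => hz (hGy y hy z ?_)⟩
  rintro (t | e)
  · rw [hf0, hzz]
  · rw [hf1, hμ]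
    simp only [Pi.smul_apply, smul_eq_mul]
    ring

/-- The general net of quadrics contains a projectively normal elliptic quartic in its base
locus. -/
theorem exists_ne_zero_forall_exists_curve :
    ∃ F : MvPolynomial (Fin 3 × Sym2 (Fin 7)) ℂ, F ≠ 0 ∧ ∀ c, eval c F ≠ 0 →
      ∃ I : Ideal CoordRing, idealV c ≤ I ∧ IsSmoothCurve I 4 1 ∧ IsProjectivelyNormal I := by
  let R := MvPolynomial NetIndex ℂ
  -- A point where none of the three polynomials vanishes: identity coordinates, first block the
  -- identity, second block with distinct eigenvalues. The conditions do not involve the change of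
  -- basis of the net, which may be zero here.
  let y₀ : NetIndex → ℂ := Sum.elim 0 (Sum.elim (fun p => if flagEquiv p.2 = p.1 then 1 else 0)
    fun p => if p.2.1 = p.2.2 then
      (if p.1 = 1 then 1 else Sum.elim (fun i : Fin 4 => ((i : ℕ) : ℂ)) 0 p.2.1) else 0)
  have h₁ : blockForm y₀ 1 = (2 : ℂ) • 1 := by
    ext a b
    by_cases h : a = b
    · simp [blockForm, formPart, y₀, h]
      norm_num
    · simp [blockForm, formPart, y₀, h, Ne.symm h]
  have h₂ : blockForm y₀ 2 = (2 : ℂ) • diagonal fun i : Fin 4 => ((i : ℕ) : ℂ) := by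
    ext a b
    by_cases h : a = b
    · simp [blockForm, formPart, y₀, h]
      ring
    · simp [blockForm, formPart, y₀, h, Ne.symm h]
  obtain ⟨G₁, hG₁, hG⟩ := exists_smooth_pencil_condition y₀ h₁ h₂
  let G₂ : R := ((coordPart (X : NetIndex → R)).submatrix flagEquiv id).det
  let G₃ : R := (blockForm (X : NetIndex → R) 1).det
  have hG₂ : ∀ y, eval y G₂ = ((coordPart y).submatrix flagEquiv id).det := by
    intro y
    rw [RingHom.map_det]
    congr 1
    ext i j
    simp [coordPart]
  have hG₃ : ∀ y, eval y G₃ = (blockForm y 1).det := by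
    intro y
    rw [RingHom.map_det]
    congr 1
    ext i j
    simp [map_blockForm]
  have hG₂0 : G₂ ≠ 0 := by
    intro h
    have h0 := hG₂ y₀
    have h1 : (coordPart y₀).submatrix flagEquiv id = 1 := by
      ext i j
      simp [coordPart, y₀, one_apply, eq_comm]
    rw [h, map_zero, h1, det_one] at h0
    exact zero_ne_one h0
  have hG₃0 : G₃ ≠ 0 := by
    intro h
    have h0 := hG₃ y₀
    rw [h, map_zero, h₁, det_smul, det_one] at h0
    norm_num at h0
  -- Since the parametrisation is onto, a generic condition on parameters holds for some parameter
  -- of each generic net.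
  obtain ⟨F, hF, hFc⟩ := exists_ne_zero_forall_exists_preimage
    (fun p => netParam (X : NetIndex → R) p) (fun c => by
      obtain ⟨y, rfl⟩ := exists_netParam_eq c
      exact ⟨y, fun p => by simp [map_netParam]⟩) (mul_ne_zero (mul_ne_zero hG₁ hG₂0) hG₃0)
  refine ⟨F, hF, fun c hc => ?_⟩
  obtain ⟨y, hyc, hy⟩ := hFc c hc
  obtain rfl : netParam y = c := funext fun p => by
    rw [← hyc p]
    simp [map_netParam]
  rw [map_mul, map_mul, hG₂, hG₃] at hy
  have hy3 := right_ne_zero_of_mul hy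
  have hy2 := right_ne_zero_of_mul (left_ne_zero_of_mul hy)
  have hy1 := left_ne_zero_of_mul (left_ne_zero_of_mul hy)
  obtain ⟨w, u, huw, hw⟩ := exists_restriction y hy2
  exact exists_curve_of_smooth_pencil (blockForm_isSymm y 1) (blockForm_isSymm y 2) hy3 (hG y hy1)
    huw fun k => ⟨_, _, hw k⟩

end General
end FanoV8

theorem mainTheorem5 :
    FanoV8.GeneralV8 (fun c =>
      (∃ I : Ideal FanoV8.CoordRing,
        FanoV8.idealV c ≤ I ∧ FanoV8.IsSmoothCurve I 4 1 ∧ FanoV8.IsProjectivelyNormal I) ∧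
      (∀ I : Ideal FanoV8.CoordRing, FanoV8.idealV c ≤ I → FanoV8.IsEllipticQuartic I →
        ∃ Q ∈ FanoV8.net c, FanoV8.quadricRank Q = 6 ∧ FanoV8.IsCutOutInside c I Q)) ∧
    (∀ c : FanoV8.Param, FanoV8.IsV8 c →
      ∀ I : Ideal FanoV8.CoordRing, FanoV8.idealV c ≤ I → FanoV8.IsEllipticQuartic I →
        ∃ Q ∈ FanoV8.net c, Q ≠ 0 ∧ FanoV8.quadricRank Q ≤ 6 ∧
          FanoV8.IsCutOutInside c I Q) := by
  refine ⟨?_, fun c hc I hle hI => FanoV8.exists_quadric_of_isEllipticQuartic hc hle hI⟩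
  obtain ⟨F₁, hF₁, h₁⟩ := FanoV8.exists_ne_zero_forall_isV8
  obtain ⟨F₂, hF₂, h₂⟩ := FanoV8.exists_ne_zero_forall_six_le_rank
  obtain ⟨F₃, hF₃, h₃⟩ := FanoV8.exists_ne_zero_forall_exists_curve
  refine ⟨F₁ * F₂ * F₃, mul_ne_zero (mul_ne_zero hF₁ hF₂) hF₃, fun c hc => ?_⟩
  rw [map_mul, map_mul] at hc
  have hV := h₁ c (left_ne_zero_of_mul (left_ne_zero_of_mul hc))
  refine ⟨hV, h₃ c (right_ne_zero_of_mul hc), fun I hle hI => ?_⟩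
  obtain ⟨Q, hQ, hQ0, hrank, hcut⟩ := FanoV8.exists_quadric_of_isEllipticQuartic hV hle hI
  exact ⟨Q, hQ, le_antisymm hrank (h₂ c (right_ne_zero_of_mul (left_ne_zero_of_mul hc)) Q hQ hQ0),
    hcut⟩
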